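/- Let $k$ be a field (of any characteristic) and let $B$ be a Poisson Hopf algebra over $k$: a commutative Hopf algebra with a Poisson bracket such that $\Delta(\{a,b\})=\{\Delta(a),\Delta(b)\}$, where $\{a\otimes b,c\otimes d\}=ac\otimes\{b,d\}+\{a,c\}\otimes bd$. Assume that $B$ is pointed, i.e. its coradical is spanned by the group $G=G(B)$ of group-like elements, and that $\{g,t\}=0$ for all $g,t\in G$. Let $(B_n)_{n\ge 0}$ be the coradical filtration of $B$ and $B_{-1}=0$. For a Poisson algebra $A$, the enveloping algebra $A^e$ is the associative unital $k$-algebra generated by two linear copies $\{m_a\}$, $\{h_a\}$ of $A$ with relations $m_{xy}=m_xm_y$, $h_{\{x,y\}}=h_xh_y-h_yh_x$, $h_{xy}=m_yh_x+m_xh_y$, $m_{\{x,y\}}=h_xm_y-m_yh_x$, $m_1=1$. A homomorphism $f$ of Poisson algebras induces an algebra map $f^e$ with $f^e(m_a)=m_{f(a)}$, $f^e(h_a)=h_{f(a)}$. If $A$ is a Poisson bialgebra, $A^e$ is a bialgebra with $\Delta m=(m\otimes m)\Delta$, $\Delta h=(m\otimes h+h\otimes m)\Delta$, $\varepsilon m=\varepsilon$,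 $\varepsilon h=0$. Then the following hold. (1) $C=\operatorname{gr}B=\bigoplus_{n\ge 0}B_n/B_{n-1}$, with the operations inherited from $B$ (in particular $\{\bar x,\bar y\}=\overline{\{x,y\}}\in C(i+j)$ for $x\in B_i$, $y\in B_j$), is a graded Poisson Hopf algebra: it is a Poisson Hopf algebra and a graded Hopf algebra with $C(n)=B_n/B_{n-1}$, and $\{C(i),C(j)\}\subseteq C(i+j)$. (2) Let $kG$ have the zero Poisson bracket, let $\iota:kG\to C$ be the inclusion of $kG=C(0)$, and let $\pi:C\to kG$ be the projection, i.e. the Hopf algebra map with $\pi\iota=\mathrm{id}$ which is zero on $C(n)$ for $n\ge 1$. Let $R=\{x\in C:(\mathrm{id}\otimes\pi)\Delta(x)=x\otimes 1\}$, so that $C\cong R\# kG$, $r\,\iota(g)\leftrightarrow r\# g$, is Radford's biproduct decomposition of $C$. The maps $\iota$ and $\pi$ are Poisson maps and $R$ is a Poisson subalgebra of $C$. Write $g$ also for $\iota(g)$. For $g\in G$ and $y\in R$, the elements $g^{-1}\{g,y\}$ and $\{g,\{y,g^{-1}\}\}$ lie in $R$, and $R^e$ is a $(kG)^e$-module algebra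 via $$m_g\cdot m_y=m_y,\quad m_g\cdot h_y=h_y+m_{g^{-1}\{g,y\}},\quad h_g\cdot m_y=m_{g^{-1}\{g,y\}},\quad h_g\cdot h_y=h_{g^{-1}\{g,y\}}+m_{\{g,\{y,g^{-1}\}\}}.$$ Let $\Psi:R^e\to C^e$ be induced by the inclusion $R\to C$. Its image lies in the algebra of coinvariants $\{z\in C^e:(\mathrm{id}\otimes\pi^e)\Delta(z)=z\otimes 1\}$, and the linear map $$\Phi:R^e\#(kG)^e\to C^e,\qquad \Phi(a\# x)=\Psi(a)\,\iota^e(x),$$ on the smash product is an isomorphism of algebras. Moreover $\Phi$ is the unique algebra map $R^e\#(kG)^e\to C^e$ with $\Phi(m_r\# m_g)=m_{rg}$ and $\Phi\big(m_r\# h_g+(1\# m_g)(h_r\# 1)\big)=h_{rg}$ for all $r\in R$, $g\in G$. -/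

import Mathlib

open scoped TensorProduct

universe u v w

/-- A Poisson bracket on a commutative `k`-algebra `A`. -/
structure PoissonBracket (k : Type v) (A : Type u) [CommRing k] [CommRing A] [Algebra k A] where
  br : A →ₗ[k] A →ₗ[k] A
  br_self : ∀ a, br a a = 0
  jacobi : ∀ a b c, br a (br b c) + br b (br c a) + br c (br a b) = 0
  leibniz : ∀ a b c, br a (b * c) = br a b * c + b * br a c

namespace PoissonBracket

section Basic

variable {k : Type v} {A : Type u} [CommRing k] [CommRing A] [Algebra k A]

theorem br_skew (P : PoissonBracket k A) (a b : A) : P.br a b = -P.br b a := by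
  have h := P.br_self (a + b)
  simp only [map_add, LinearMap.add_apply, P.br_self, zero_add, add_zero] at h
  exact eq_neg_of_add_eq_zero_right h

/-- The zero bracket. -/
def trivial (k : Type v) (A : Type u) [CommRing k] [CommRing A] [Algebra k A] :
    PoissonBracket k A where
  br := 0
  br_self := by simp
  jacobi := by simp
  leibniz := by simp

/-- The restriction of a Poisson bracket to a Poisson subalgebra. -/
def restrict (P : PoissonBracket k A) (R : Subalgebra k A)
    (hR : ∀ x ∈ R, ∀ y ∈ R, P.br x y ∈ R) : PoissonBracket k R where
  br := LinearMap.mk₂ k (fun x y => ⟨P.br x y, hR x x.2 y y.2⟩)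
    (by intros; ext; simp) (by intros; ext; simp) (by intros; ext; simp) (by intros; ext; simp)
  br_self := by intro a; ext; simp [P.br_self]
  jacobi := by intro a b c; ext; simpa using P.jacobi a b c
  leibniz := by intro a b c; ext; simp [P.leibniz]

@[simp] theorem coe_restrict_br (P : PoissonBracket k A) (R : Subalgebra k A)
    (hR : ∀ x ∈ R, ∀ y ∈ R, P.br x y ∈ R) (x y : R) :
    (((P.restrict R hR).br x y : R) : A) = P.br x y := rfl

/-- The bracket of `A ⊗ A`, given by `{a ⊗ b, c ⊗ d} = ac ⊗ {b, d} + {a, c} ⊗ bd`. -/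
noncomputable def tensorBr (P : PoissonBracket k A) :
    A ⊗[k] A →ₗ[k] A ⊗[k] A →ₗ[k] A ⊗[k] A :=
  TensorProduct.map₂ (LinearMap.mul k A) P.br + TensorProduct.map₂ P.br (LinearMap.mul k A)

@[simp] theorem tensorBr_tmul (P : PoissonBracket k A) (a b c d : A) :
    P.tensorBr (a ⊗ₜ b) (c ⊗ₜ d) = (a * c) ⊗ₜ P.br b d + P.br a c ⊗ₜ (b * d) := by
  simp [tensorBr]

/-- `f` is a homomorphism of Poisson algebras. -/
def IsHom {A' : Type w} [CommRing A'] [Algebra k A'] (P : PoissonBracket k A)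
    (Q : PoissonBracket k A') (f : A →ₐ[k] A') : Prop :=
  ∀ x y, f (P.br x y) = Q.br (f x) (f y)

end Basic

theorem isHom_val {k : Type v} {A : Type u} [CommRing k] [CommRing A] [Algebra k A]
    (P : PoissonBracket k A) (R : Subalgebra k A) (hR : ∀ x ∈ R, ∀ y ∈ R, P.br x y ∈ R) :
    (P.restrict R hR).IsHom P R.val := fun _ _ => rfl

/-! ### Poisson bialgebras -/

/-- A commutative bialgebra with a Poisson bracket is a Poisson bialgebra if
`Δ {a, b} = {Δ a, Δ b}`; if it is a Hopf algebra, it is then called a Poisson Hopf algebra. -/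
class IsPoissonBialgebra {k : Type v} {A : Type u} [CommRing k] [CommRing A] [Bialgebra k A]
    (P : PoissonBracket k A) : Prop where
  comul_br : ∀ a b : A, Coalgebra.comul (R := k) (P.br a b) =
    P.tensorBr (Coalgebra.comul a) (Coalgebra.comul b)

instance {k : Type v} {A : Type u} [CommRing k] [CommRing A] [Bialgebra k A] :
    IsPoissonBialgebra (trivial k A) where
  comul_br a b := by
    have h : (trivial k A).tensorBr = 0 := by
      ext; simp [trivial]
    rw [h]; simp [trivial]

theorem counit_br {k : Type v} {A : Type u} [CommRing k] [CommRing A] [Bialgebra k A]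
    (P : PoissonBracket k A) [hP : IsPoissonBialgebra P] (a b : A) :
    Coalgebra.counit (R := k) (P.br a b) = 0 := by
  let e := Bialgebra.counitAlgHom k A
  let l : A ⊗[k] A →ₗ[k] A := (TensorProduct.lid k A).toLinearMap ∘ₗ
    LinearMap.rTensor A (Coalgebra.counit (R := k))
  let r : A ⊗[k] A →ₗ[k] A := (TensorProduct.rid k A).toLinearMap ∘ₗ
    LinearMap.lTensor A (Coalgebra.counit (R := k))
  have key : ∀ u v : A ⊗[k] A, Coalgebra.counit (R := k) (l (P.tensorBr u v)) =
      Coalgebra.counit (R := k) (P.br (l u) (l v)) +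
      Coalgebra.counit (R := k) (P.br (r u) (r v)) := by
    intro u v
    induction u with
    | zero => simp
    | add x y hx hy => simp only [map_add, LinearMap.add_apply, hx, hy]; abel
    | tmul a b =>
      induction v with
      | zero => simp
      | add x y hx hy => simp only [map_add, hx, hy]; abel
      | tmul c d =>
        simp [l, r]
        ring
  have hl : ∀ x : A, l (Coalgebra.comul x) = x := by intro x; simp [l]
  have hr : ∀ x : A, r (Coalgebra.comul x) = x := by intro x; simp [r]
  have := key (Coalgebra.comul a) (Coalgebra.comul b)
  rw [← hP.comul_br, hl, hl, hl, hr, hr] at this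
  simpa using this

/-! ### The enveloping algebra -/

section Env

variable {k : Type v} {A : Type u} [CommRing k] [CommRing A] [Algebra k A]

/-- The relations of the enveloping algebra: the first copy of `A` in `A ⊕ A` spans the
`m_a`, the second copy the `h_a`. -/
inductive EnvRel (P : PoissonBracket k A) :
    FreeAlgebra k (A ⊕ A) → FreeAlgebra k (A ⊕ A) → Prop
  | m_add (x y : A) : EnvRel P (FreeAlgebra.ι k (Sum.inl (x + y)))
      (FreeAlgebra.ι k (Sum.inl x) + FreeAlgebra.ι k (Sum.inl y))
  | m_smul (c : k) (x : A) : EnvRel P (FreeAlgebra.ι k (Sum.inl (c • x)))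
      (c • FreeAlgebra.ι k (Sum.inl x))
  | h_add (x y : A) : EnvRel P (FreeAlgebra.ι k (Sum.inr (x + y)))
      (FreeAlgebra.ι k (Sum.inr x) + FreeAlgebra.ι k (Sum.inr y))
  | h_smul (c : k) (x : A) : EnvRel P (FreeAlgebra.ι k (Sum.inr (c • x)))
      (c • FreeAlgebra.ι k (Sum.inr x))
  | m_mul (x y : A) : EnvRel P (FreeAlgebra.ι k (Sum.inl (x * y)))
      (FreeAlgebra.ι k (Sum.inl x) * FreeAlgebra.ι k (Sum.inl y))
  | h_br (x y : A) : EnvRel P (FreeAlgebra.ι k (Sum.inr (P.br x y)))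
      (FreeAlgebra.ι k (Sum.inr x) * FreeAlgebra.ι k (Sum.inr y) -
        FreeAlgebra.ι k (Sum.inr y) * FreeAlgebra.ι k (Sum.inr x))
  | h_mul (x y : A) : EnvRel P (FreeAlgebra.ι k (Sum.inr (x * y)))
      (FreeAlgebra.ι k (Sum.inl y) * FreeAlgebra.ι k (Sum.inr x) +
        FreeAlgebra.ι k (Sum.inl x) * FreeAlgebra.ι k (Sum.inr y))
  | m_br (x y : A) : EnvRel P (FreeAlgebra.ι k (Sum.inl (P.br x y)))
      (FreeAlgebra.ι k (Sum.inr x) * FreeAlgebra.ι k (Sum.inl y) -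
        FreeAlgebra.ι k (Sum.inl y) * FreeAlgebra.ι k (Sum.inr x))
  | m_one : EnvRel P (FreeAlgebra.ι k (Sum.inl 1)) 1

/-- The enveloping algebra `A^e` of a Poisson algebra `A`. -/
def Env (P : PoissonBracket k A) : Type (max u v) := RingQuot (EnvRel P)

noncomputable instance (P : PoissonBracket k A) : Ring (Env P) :=
  inferInstanceAs (Ring (RingQuot (EnvRel P)))

noncomputable instance (P : PoissonBracket k A) : Algebra k (Env P) :=
  inferInstanceAs (Algebra k (RingQuot (EnvRel P)))

namespace Env

variable (P : PoissonBracket k A)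

/-- The quotient map from the free algebra. -/
noncomputable def mk : FreeAlgebra k (A ⊕ A) →ₐ[k] Env P := RingQuot.mkAlgHom k (EnvRel P)

theorem mk_rel {P : PoissonBracket k A} {a b : FreeAlgebra k (A ⊕ A)} (r : EnvRel P a b) :
    mk P a = mk P b := RingQuot.mkAlgHom_rel k r

/-- The structure map `m : A → A^e`. -/
noncomputable def m : A →ₐ[k] Env P :=
  AlgHom.ofLinearMap
    { toFun := fun x => mk P (FreeAlgebra.ι k (Sum.inl x))
      map_add' := fun x y => by rw [mk_rel (EnvRel.m_add x y), map_add]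
      map_smul' := fun c x => by rw [mk_rel (EnvRel.m_smul c x), map_smul]; rfl }
    (by
      change mk P _ = 1
      rw [mk_rel EnvRel.m_one, map_one])
    (fun x y => by
      change mk P _ = mk P _ * mk P _
      rw [mk_rel (EnvRel.m_mul x y), map_mul])

/-- The structure map `h : A → A^e`. -/
noncomputable def h : A →ₗ[k] Env P where
  toFun := fun x => mk P (FreeAlgebra.ι k (Sum.inr x))
  map_add' := fun x y => by rw [mk_rel (EnvRel.h_add x y), map_add]
  map_smul' := fun c x => by rw [mk_rel (EnvRel.h_smul c x), map_smul]; rfl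

theorem h_br (x y : A) : h P (P.br x y) = h P x * h P y - h P y * h P x := by
  change mk P _ = mk P _ * mk P _ - mk P _ * mk P _
  rw [mk_rel (EnvRel.h_br x y), map_sub, map_mul, map_mul]

theorem h_mul (x y : A) : h P (x * y) = m P y * h P x + m P x * h P y := by
  change mk P _ = mk P _ * mk P _ + mk P _ * mk P _
  rw [mk_rel (EnvRel.h_mul x y), map_add, map_mul, map_mul]

theorem m_br (x y : A) : m P (P.br x y) = h P x * m P y - m P y * h P x := by
  change mk P _ = mk P _ * mk P _ - mk P _ * mk P _
  rw [mk_rel (EnvRel.m_br x y), map_sub, map_mul, map_mul]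

variable {P}

theorem algHom_ext {E : Type w} [Semiring E] [Algebra k E] {f g : Env P →ₐ[k] E}
    (hm : ∀ x, f (m P x) = g (m P x)) (hh : ∀ x, f (h P x) = g (h P x)) : f = g := by
  apply RingQuot.ringQuot_ext'
  apply FreeAlgebra.hom_ext
  funext x
  cases x with
  | inl x => exact hm x
  | inr x => exact hh x

/-- The universal property of the structure maps. -/
noncomputable def lift {E : Type w} [Ring E] [Algebra k E] (f : A →ₐ[k] E) (g : A →ₗ[k] E)
    (h1 : ∀ x y, g (P.br x y) = g x * g y - g y * g x)
    (h2 : ∀ x y, g (x * y) = f y * g x + f x * g y)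
    (h3 : ∀ x y, f (P.br x y) = g x * f y - f y * g x) : Env P →ₐ[k] E :=
  RingQuot.liftAlgHom k ⟨FreeAlgebra.lift k (Sum.elim f g), by
    intro a b r
    induction r <;> simp [h1, h2, h3]⟩

@[simp] theorem lift_m {E : Type w} [Ring E] [Algebra k E] (f : A →ₐ[k] E) (g : A →ₗ[k] E)
    (h1 : ∀ x y, g (P.br x y) = g x * g y - g y * g x)
    (h2 : ∀ x y, g (x * y) = f y * g x + f x * g y)
    (h3 : ∀ x y, f (P.br x y) = g x * f y - f y * g x) (x : A) :
    lift f g h1 h2 h3 (m P x) = f x := by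
  change RingQuot.liftAlgHom k _ (RingQuot.mkAlgHom k _ _) = _
  rw [RingQuot.liftAlgHom_mkAlgHom_apply]; simp

@[simp] theorem lift_h {E : Type w} [Ring E] [Algebra k E] (f : A →ₐ[k] E) (g : A →ₗ[k] E)
    (h1 : ∀ x y, g (P.br x y) = g x * g y - g y * g x)
    (h2 : ∀ x y, g (x * y) = f y * g x + f x * g y)
    (h3 : ∀ x y, f (P.br x y) = g x * f y - f y * g x) (x : A) :
    lift f g h1 h2 h3 (h P x) = g x := by
  change RingQuot.liftAlgHom k _ (RingQuot.mkAlgHom k _ _) = _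
  rw [RingQuot.liftAlgHom_mkAlgHom_apply]; simp

/-- The algebra map `f^e : A^e → A'^e` induced by a Poisson homomorphism `f : A → A'`. -/
noncomputable def map {A' : Type w} [CommRing A'] [Algebra k A'] {Q : PoissonBracket k A'}
    (f : A →ₐ[k] A') (hf : P.IsHom Q f) : Env P →ₐ[k] Env Q :=
  lift ((m Q).comp f) ((h Q).comp f.toLinearMap)
    (fun x y => by simp [hf x y, h_br]) (fun x y => by simp [h_mul])
    (fun x y => by simp [hf x y, m_br])

end Env

end Env

/-! ### The bialgebra structure of the enveloping algebra -/

namespace Env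

variable {k : Type v} {A : Type u} [CommRing k] [CommRing A] [Bialgebra k A]

section

variable (P : PoissonBracket k A)

/-- `m ⊗ m`. -/
noncomputable def mm : A ⊗[k] A →ₐ[k] Env P ⊗[k] Env P := Algebra.TensorProduct.map (m P) (m P)

/-- `m ⊗ h + h ⊗ m`. -/
noncomputable def mh : A ⊗[k] A →ₗ[k] Env P ⊗[k] Env P :=
  TensorProduct.map (m P).toLinearMap (h P) + TensorProduct.map (h P) (m P).toLinearMap

@[simp] theorem mm_tmul (a b : A) : mm P (a ⊗ₜ b) = m P a ⊗ₜ m P b := by simp [mm]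

@[simp] theorem mh_tmul (a b : A) :
    mh P (a ⊗ₜ b) = m P a ⊗ₜ h P b + h P a ⊗ₜ m P b := by simp [mh]

theorem mm_br (u v : A ⊗[k] A) :
    mm P (P.tensorBr u v) = mh P u * mm P v - mm P v * mh P u := by
  induction u with
  | zero => simp
  | add x y hx hy =>
    simp only [map_add, LinearMap.add_apply, hx, hy, add_mul, mul_add]; abel
  | tmul a b =>
    induction v with
    | zero => simp
    | add x y hx hy => simp only [map_add, hx, hy, add_mul, mul_add]; abel
    | tmul c d =>
      have e1 : m P c * m P a = m P a * m P c := by rw [← map_mul, ← map_mul, mul_comm]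
      have e2 : m P d * m P b = m P b * m P d := by rw [← map_mul, ← map_mul, mul_comm]
      simp only [tensorBr_tmul, map_add, mm_tmul, mh_tmul, m_br, map_mul, add_mul, mul_add,
        Algebra.TensorProduct.tmul_mul_tmul, TensorProduct.tmul_sub, TensorProduct.sub_tmul, e1, e2]
      abel

theorem mh_mul (u v : A ⊗[k] A) :
    mh P (u * v) = mm P v * mh P u + mm P u * mh P v := by
  induction u with
  | zero => simp
  | add x y hx hy =>
    simp only [map_add, hx, hy, add_mul, mul_add]; abel
  | tmul a b =>
    induction v with
    | zero => simp
    | add x y hx hy => simp only [map_add, hx, hy, add_mul, mul_add]; abel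
    | tmul c d =>
      have e1 : m P c * m P a = m P a * m P c := by rw [← map_mul, ← map_mul, mul_comm]
      have e2 : m P d * m P b = m P b * m P d := by rw [← map_mul, ← map_mul, mul_comm]
      simp only [mm_tmul, mh_tmul, h_mul, map_mul, mul_add,
        Algebra.TensorProduct.tmul_mul_tmul, TensorProduct.tmul_add, TensorProduct.add_tmul, e1, e2]
      abel

theorem mh_br (u v : A ⊗[k] A) :
    mh P (P.tensorBr u v) = mh P u * mh P v - mh P v * mh P u := by
  induction u with
  | zero => simp
  | add x y hx hy =>
    simp only [map_add, LinearMap.add_apply, hx, hy, add_mul, mul_add]; abel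
  | tmul a b =>
    induction v with
    | zero => simp
    | add x y hx hy => simp only [map_add, hx, hy, add_mul, mul_add]; abel
    | tmul c d =>
      have e1 : m P c * m P a = m P a * m P c := by rw [← map_mul, ← map_mul, mul_comm]
      have e2 : m P d * m P b = m P b * m P d := by rw [← map_mul, ← map_mul, mul_comm]
      have f1 : h P c * m P a = m P a * h P c - (h P a * m P c - m P c * h P a) := by
        rw [← m_br, P.br_skew, map_neg, m_br]; abel
      have f2 : h P d * m P b = m P b * h P d - (h P b * m P d - m P d * h P b) := by
        rw [← m_br, P.br_skew, map_neg, m_br]; abel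
      simp only [tensorBr_tmul, map_add, mh_tmul, m_br, h_br, h_mul, map_mul, add_mul, mul_add,
        Algebra.TensorProduct.tmul_mul_tmul, TensorProduct.tmul_sub, TensorProduct.sub_tmul,
        TensorProduct.tmul_add, TensorProduct.add_tmul, e1, e2, f1, f2]
      abel

theorem assoc_mm (w : A ⊗[k] A) (b : A) :
    Algebra.TensorProduct.assoc k k k (Env P) (Env P) (Env P) (mm P w ⊗ₜ m P b) =
      TensorProduct.map (m P).toLinearMap (mm P).toLinearMap
        (TensorProduct.assoc k A A A (w ⊗ₜ b)) := by
  induction w with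
  | zero => simp
  | add x y hx hy => simp only [map_add, TensorProduct.add_tmul, hx, hy]
  | tmul c d => simp

theorem assoc_mh (w : A ⊗[k] A) (b : A) :
    Algebra.TensorProduct.assoc k k k (Env P) (Env P) (Env P)
        (mm P w ⊗ₜ h P b + mh P w ⊗ₜ m P b) =
      (TensorProduct.map (m P).toLinearMap (mh P) +
        TensorProduct.map (h P) (mm P).toLinearMap)
        (TensorProduct.assoc k A A A (w ⊗ₜ b)) := by
  induction w with
  | zero => simp
  | add x y hx hy =>
    simp only [map_add, TensorProduct.add_tmul] at hx hy ⊢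
    rw [← hx, ← hy]; abel
  | tmul c d => simp [TensorProduct.tmul_add, TensorProduct.add_tmul, add_assoc]

variable [hP : IsPoissonBialgebra P]

/-- The comultiplication of `A^e`: `Δ m = (m ⊗ m) Δ` and `Δ h = (m ⊗ h + h ⊗ m) Δ`. -/
noncomputable def comulHom : Env P →ₐ[k] Env P ⊗[k] Env P :=
  lift ((mm P).comp (Bialgebra.comulAlgHom k A)) ((mh P).comp (Coalgebra.comul (R := k)))
    (fun x y => by simp [hP.comul_br, mh_br])
    (fun x y => by simp [mh_mul])
    (fun x y => by simp [hP.comul_br, mm_br])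

/-- The counit of `A^e`: `ε m = ε` and `ε h = 0`. -/
noncomputable def counitHom : Env P →ₐ[k] k :=
  lift (Bialgebra.counitAlgHom k A) 0
    (fun x y => by simp) (fun x y => by simp) (fun x y => by simp [counit_br])

@[simp] theorem comulHom_m (x : A) :
    comulHom P (m P x) = mm P (Coalgebra.comul (R := k) x) := by simp [comulHom]

@[simp] theorem comulHom_h (x : A) :
    comulHom P (h P x) = mh P (Coalgebra.comul (R := k) x) := by simp [comulHom]

@[simp] theorem counitHom_m (x : A) :
    counitHom P (m P x) = Coalgebra.counit (R := k) x := by simp [counitHom]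

@[simp] theorem counitHom_h (x : A) : counitHom P (h P x) = 0 := by simp [counitHom]

theorem coassoc_m (u : A ⊗[k] A) :
    Algebra.TensorProduct.assoc k k k (Env P) (Env P) (Env P)
        (Algebra.TensorProduct.map (comulHom P) (AlgHom.id k (Env P)) (mm P u)) =
      TensorProduct.map (m P).toLinearMap (mm P).toLinearMap
        (TensorProduct.assoc k A A A (LinearMap.rTensor A Coalgebra.comul u)) := by
  induction u with
  | zero => simp
  | add x y hx hy => simp only [map_add, hx, hy]
  | tmul a b => simp [assoc_mm]

theorem coassoc_h (u : A ⊗[k] A) :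
    Algebra.TensorProduct.assoc k k k (Env P) (Env P) (Env P)
        (Algebra.TensorProduct.map (comulHom P) (AlgHom.id k (Env P)) (mh P u)) =
      (TensorProduct.map (m P).toLinearMap (mh P) +
        TensorProduct.map (h P) (mm P).toLinearMap)
        (TensorProduct.assoc k A A A (LinearMap.rTensor A Coalgebra.comul u)) := by
  induction u with
  | zero => simp
  | add x y hx hy => simp only [map_add, hx, hy]
  | tmul a b =>
    rw [LinearMap.rTensor_tmul, ← assoc_mh]
    simp

theorem coassoc_m' (u : A ⊗[k] A) :
    Algebra.TensorProduct.map (AlgHom.id k (Env P)) (comulHom P) (mm P u) =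
      TensorProduct.map (m P).toLinearMap (mm P).toLinearMap
        (LinearMap.lTensor A Coalgebra.comul u) := by
  induction u with
  | zero => simp
  | add x y hx hy => simp only [map_add, hx, hy]
  | tmul a b => simp

theorem coassoc_h' (u : A ⊗[k] A) :
    Algebra.TensorProduct.map (AlgHom.id k (Env P)) (comulHom P) (mh P u) =
      (TensorProduct.map (m P).toLinearMap (mh P) +
        TensorProduct.map (h P) (mm P).toLinearMap)
        (LinearMap.lTensor A Coalgebra.comul u) := by
  induction u with
  | zero => simp
  | add x y hx hy => simp only [map_add, hx, hy]
  | tmul a b => simp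

theorem counit_left_m (u : A ⊗[k] A) :
    Algebra.TensorProduct.map (counitHom P) (AlgHom.id k (Env P)) (mm P u) =
      LinearMap.lTensor k (m P).toLinearMap (LinearMap.rTensor A Coalgebra.counit u) := by
  induction u with
  | zero => simp
  | add x y hx hy => simp only [map_add, hx, hy]
  | tmul a b => simp

theorem counit_left_h (u : A ⊗[k] A) :
    Algebra.TensorProduct.map (counitHom P) (AlgHom.id k (Env P)) (mh P u) =
      LinearMap.lTensor k (h P) (LinearMap.rTensor A Coalgebra.counit u) := by
  induction u with
  | zero => simp
  | add x y hx hy => simp only [map_add, hx, hy]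
  | tmul a b => simp

theorem counit_right_m (u : A ⊗[k] A) :
    Algebra.TensorProduct.map (AlgHom.id k (Env P)) (counitHom P) (mm P u) =
      LinearMap.rTensor k (m P).toLinearMap (LinearMap.lTensor A Coalgebra.counit u) := by
  induction u with
  | zero => simp
  | add x y hx hy => simp only [map_add, hx, hy]
  | tmul a b => simp

theorem counit_right_h (u : A ⊗[k] A) :
    Algebra.TensorProduct.map (AlgHom.id k (Env P)) (counitHom P) (mh P u) =
      LinearMap.rTensor k (h P) (LinearMap.lTensor A Coalgebra.counit u) := by
  induction u with
  | zero => simp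
  | add x y hx hy => simp only [map_add, hx, hy]
  | tmul a b => simp

/-- The bialgebra structure of the enveloping algebra of a Poisson bialgebra. -/
noncomputable instance instBialgebraEnv : Bialgebra k (Env P) :=
  Bialgebra.ofAlgHom (comulHom P) (counitHom P)
    (algHom_ext
      (fun x => by
        change Algebra.TensorProduct.assoc k k k (Env P) (Env P) (Env P)
          (Algebra.TensorProduct.map (comulHom P) (AlgHom.id k (Env P))
            (comulHom P (m P x))) =
          Algebra.TensorProduct.map (AlgHom.id k (Env P)) (comulHom P) (comulHom P (m P x))
        rw [comulHom_m, coassoc_m, coassoc_m', Coalgebra.coassoc_apply])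
      (fun x => by
        change Algebra.TensorProduct.assoc k k k (Env P) (Env P) (Env P)
          (Algebra.TensorProduct.map (comulHom P) (AlgHom.id k (Env P))
            (comulHom P (h P x))) =
          Algebra.TensorProduct.map (AlgHom.id k (Env P)) (comulHom P) (comulHom P (h P x))
        rw [comulHom_h, coassoc_h, coassoc_h', Coalgebra.coassoc_apply]))
    (algHom_ext
      (fun x => by simp [counit_left_m])
      (fun x => by simp [counit_left_h]))
    (algHom_ext
      (fun x => by simp [counit_right_m])
      (fun x => by simp [counit_right_h]))

theorem comul_m (x : A) : Coalgebra.comul (R := k) (m P x) =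
    TensorProduct.map (m P).toLinearMap (m P).toLinearMap (Coalgebra.comul (R := k) x) :=
  comulHom_m P x

theorem comul_h (x : A) : Coalgebra.comul (R := k) (h P x) =
    TensorProduct.map (m P).toLinearMap (h P) (Coalgebra.comul (R := k) x) +
      TensorProduct.map (h P) (m P).toLinearMap (Coalgebra.comul (R := k) x) :=
  comulHom_h P x

theorem counit_m (x : A) : Coalgebra.counit (R := k) (m P x) = Coalgebra.counit (R := k) x :=
  counitHom_m P x

theorem counit_h (x : A) : Coalgebra.counit (R := k) (h P x) = 0 := counitHom_h P x

end

end Env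

end PoissonBracket


/-! ### Module algebras and smash products -/

/-- A left `H`-module algebra structure on `A`: an `H`-module structure with
`h · (ab) = ∑ (h₁ · a)(h₂ · b)` and `h · 1 = ε(h) 1`. -/
structure ModuleAlgebra (k : Type v) (H : Type u) (A : Type w) [CommRing k] [Ring H]
    [Bialgebra k H] [Ring A] [Algebra k A] where
  act : H →ₐ[k] Module.End k A
  act_one : ∀ x : H, act x 1 = algebraMap k A (Coalgebra.counit x)
  act_mul : ∀ (x : H) (a b : A), act x (a * b) =
    TensorProduct.lift ((LinearMap.mul k A).compl₁₂
      (act.toLinearMap.flip a) (act.toLinearMap.flip b)) (Coalgebra.comul (R := k) x)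

namespace ModuleAlgebra

variable {k : Type v} {H : Type u} {A : Type w} [CommRing k] [Ring H]
    [Bialgebra k H] [Ring A] [Algebra k A]

/-- The smash product `A # H`, with underlying space `A ⊗ H`. -/
def Smash (_σ : ModuleAlgebra k H A) : Type (max u w) := A ⊗[k] H

namespace Smash

variable (σ : ModuleAlgebra k H A)

noncomputable instance : AddCommGroup (Smash σ) := inferInstanceAs (AddCommGroup (A ⊗[k] H))

noncomputable instance : Module k (Smash σ) := inferInstanceAs (Module k (A ⊗[k] H))

/-- The element `a # x`. -/
def mk (a : A) (x : H) : Smash σ := (a ⊗ₜ[k] x : A ⊗[k] H)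

/-- The diagonal action of `H` on `A ⊗ H`: `x · (b ⊗ y) = ∑ (x₁ · b) ⊗ x₂ y`. -/
noncomputable def diag : H →ₐ[k] Module.End k (A ⊗[k] H) :=
  (Module.endTensorEndAlgHom (R := k) (S := k) (A := k)).comp
    ((Algebra.TensorProduct.map σ.act (Algebra.lmul k H)).comp (Bialgebra.comulAlgHom k H))

/-- Left multiplication in the smash product: `a # x` acts on `A ⊗ H` as `x`
followed by multiplication by `a` on the left factor. -/
noncomputable def lmul : A ⊗[k] H →ₗ[k] Module.End k (A ⊗[k] H) :=
  TensorProduct.lift ((LinearMap.mul k (Module.End k (A ⊗[k] H))).compl₁₂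
    (LinearMap.rTensorHom H ∘ₗ LinearMap.mul k A) (diag σ).toLinearMap)

@[simp] theorem lmul_tmul (a : A) (x : H) :
    lmul σ (a ⊗ₜ x) = LinearMap.rTensor H (LinearMap.mulLeft k a) * diag σ x := rfl

theorem diag_tmul (x : H) (c : A) (z : H) : diag σ x (c ⊗ₜ z) =
    TensorProduct.map (σ.act.toLinearMap.flip c) (LinearMap.mulRight k z)
      (Coalgebra.comul (R := k) x) := by
  simp only [diag, AlgHom.comp_apply, Bialgebra.comulAlgHom_apply]
  generalize Coalgebra.comul (R := k) x = u
  induction u with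
  | zero => simp
  | add u v hu hv => simp only [map_add, LinearMap.add_apply, hu, hv]
  | tmul p q => simp [Module.endTensorEndAlgHom_apply]

theorem diag_one (x : H) : diag σ x (1 ⊗ₜ 1) = 1 ⊗ₜ x := by
  rw [diag_tmul]
  have h : ∀ u : H ⊗[k] H,
      TensorProduct.map (σ.act.toLinearMap.flip 1) (LinearMap.mulRight k 1) u =
      TensorProduct.map (Algebra.linearMap k A) LinearMap.id
        (LinearMap.rTensor H Coalgebra.counit u) := by
    intro u
    induction u with
    | zero => simp
    | add u v hu hv => simp only [map_add, hu, hv]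
    | tmul p q => simp [σ.act_one]
  rw [h]
  simp

/-- `x ∘ b = ∑ (x₁ · b) ∘ x₂` as operators on `A ⊗ H`. -/
theorem diag_mul_mulLeft (x : H) (b : A) :
    diag σ x * LinearMap.rTensor H (LinearMap.mulLeft k b) = lmul σ (diag σ x (b ⊗ₜ 1)) := by
  ext c z
  let G : H ⊗[k] H →ₗ[k] A ⊗[k] H :=
    TensorProduct.map (σ.act.toLinearMap.flip c) (LinearMap.mulRight k z)
  let F : H ⊗[k] (H ⊗[k] H) →ₗ[k] A ⊗[k] H := TensorProduct.lift
    (LinearMap.lcomp k (A ⊗[k] H) G ∘ₗ LinearMap.rTensorHom H ∘ₗ LinearMap.mul k A ∘ₗ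
      σ.act.toLinearMap.flip b)
  have h1 : ∀ u : H ⊗[k] H, TensorProduct.map (σ.act.toLinearMap.flip (b * c))
      (LinearMap.mulRight k z) u =
      F (TensorProduct.assoc k H H H (LinearMap.rTensor H Coalgebra.comul u)) := by
    intro u
    induction u with
    | zero => simp
    | add u v hu hv => simp only [map_add, hu, hv]
    | tmul p q =>
      have h3 : ∀ w : H ⊗[k] H, (TensorProduct.lift ((LinearMap.mul k A).compl₁₂
          (σ.act.toLinearMap.flip b) (σ.act.toLinearMap.flip c)) w) ⊗ₜ[k] (q * z) =
          F (TensorProduct.assoc k H H H (w ⊗ₜ q)) := by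
        intro w
        induction w with
        | zero => simp
        | add u v hu hv => simp only [map_add, TensorProduct.add_tmul, hu, hv]
        | tmul p q => simp [F, G]
      rw [LinearMap.rTensor_tmul, ← h3, ← σ.act_mul]
      simp
  have h2 : ∀ u : H ⊗[k] H, lmul σ (TensorProduct.map (σ.act.toLinearMap.flip b)
      (LinearMap.mulRight k 1) u) (c ⊗ₜ z) = F (LinearMap.lTensor H Coalgebra.comul u) := by
    intro u
    induction u with
    | zero => simp
    | add u v hu hv => simp only [map_add, LinearMap.add_apply, hu, hv]
    | tmul p q =>
      simp [F, G, diag_tmul]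
      rfl
  have e1 : (diag σ x * LinearMap.rTensor H (LinearMap.mulLeft k b)) (c ⊗ₜ z) =
      diag σ x ((b * c) ⊗ₜ z) := by simp
  change (diag σ x * LinearMap.rTensor H (LinearMap.mulLeft k b)) (c ⊗ₜ z) =
    lmul σ (diag σ x (b ⊗ₜ 1)) (c ⊗ₜ z)
  rw [e1, diag_tmul, h1, diag_tmul, h2, Coalgebra.coassoc_apply]

theorem lmul_mulRight (u : A ⊗[k] H) (y : H) :
    lmul σ (LinearMap.lTensor A (LinearMap.mulRight k y) u) = lmul σ u * diag σ y := by
  induction u with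
  | zero => simp
  | add u v hu hv => simp only [map_add, hu, hv, add_mul]
  | tmul p q => simp [mul_assoc]

theorem diag_mulRight (x : H) (b : A) (y : H) :
    diag σ x (b ⊗ₜ y) = LinearMap.lTensor A (LinearMap.mulRight k y) (diag σ x (b ⊗ₜ 1)) := by
  rw [diag_tmul, diag_tmul]
  generalize Coalgebra.comul (R := k) x = u
  induction u with
  | zero => simp
  | add u v hu hv => simp only [map_add, hu, hv]
  | tmul p q => simp

theorem lmul_mulLeft (a : A) (u : A ⊗[k] H) :
    lmul σ (LinearMap.rTensor H (LinearMap.mulLeft k a) u) =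
      LinearMap.rTensor H (LinearMap.mulLeft k a) * lmul σ u := by
  induction u with
  | zero => simp
  | add u v hu hv => simp only [map_add, hu, hv, mul_add]
  | tmul p q =>
    rw [LinearMap.rTensor_tmul, lmul_tmul, lmul_tmul, ← mul_assoc]
    congr 1
    ext c z
    simp

theorem lmul_lmul (u v : A ⊗[k] H) : lmul σ (lmul σ u v) = lmul σ u * lmul σ v := by
  induction u with
  | zero => simp
  | add p q hp hq => simp only [map_add, LinearMap.add_apply, add_mul, hp, hq]
  | tmul a x =>
    induction v with
    | zero => simp
    | add p q hp hq => simp only [map_add, mul_add, hp, hq]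
    | tmul b y =>
      rw [lmul_tmul, Module.End.mul_apply, lmul_mulLeft, diag_mulRight, lmul_mulRight,
        ← diag_mul_mulLeft, lmul_tmul]
      simp only [mul_assoc]

theorem lmul_one : lmul σ (1 ⊗ₜ 1) = 1 := by
  ext c z
  simp

theorem lmul_apply_one (u : A ⊗[k] H) : lmul σ u (1 ⊗ₜ 1) = u := by
  induction u with
  | zero => simp
  | add p q hp hq => simp only [map_add, LinearMap.add_apply, hp, hq]
  | tmul a x => simp [diag_one]

noncomputable instance : Ring (Smash σ) where
  __ := (inferInstance : AddCommGroup (Smash σ))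
  mul := fun u v => lmul σ u v
  one := mk σ 1 1
  left_distrib := fun a b c => map_add (lmul σ a) b c
  right_distrib := fun a b c => DFunLike.congr_fun (map_add (lmul σ) a b) c
  zero_mul := fun a => DFunLike.congr_fun (map_zero (lmul σ)) a
  mul_zero := fun a => map_zero (lmul σ a)
  mul_assoc := fun a b c => DFunLike.congr_fun (lmul_lmul σ a b) c
  one_mul := fun a => DFunLike.congr_fun (lmul_one σ) a
  mul_one := fun a => lmul_apply_one σ a

noncomputable instance : Algebra k (Smash σ) :=
  Algebra.ofModule
    (fun c u v => DFunLike.congr_fun (map_smul (lmul σ) c u) v)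
    (fun c u v => map_smul (lmul σ u) c v)

/-- The multiplication rule `(a # x)(b # y) = ∑ a (x₁ · b) # x₂ y`. -/
theorem mk_mul_mk (a b : A) (x y : H) {ι : Type*} (r : Coalgebra.Repr k x ι) :
    mk σ a x * mk σ b y =
      ∑ i ∈ r.index, mk σ (a * σ.act (r.left i) b) (r.right i * y) := by
  change lmul σ (a ⊗ₜ x) (b ⊗ₜ y) = _
  rw [lmul_tmul, Module.End.mul_apply, diag_tmul, ← r.eq]
  simp [mk]
  rfl

theorem one_eq : (1 : Smash σ) = mk σ 1 1 := rfl

end Smash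
end ModuleAlgebra


/-! ### Coradical, coradical filtration and the associated graded space -/

section Coradical

variable (k : Type v) (B : Type u) [Field k] [AddCommGroup B] [Module k B] [Coalgebra k B]

variable {k B} in
/-- `D` is a subcoalgebra: `Δ(D) ⊆ D ⊗ D`. -/
def IsSubcoalgebra (D : Submodule k B) : Prop :=
  ∀ x ∈ D, Coalgebra.comul (R := k) x ∈ LinearMap.range (TensorProduct.mapIncl D D)

variable {k B} in
/-- `D` is a simple subcoalgebra. -/
def IsSimpleSubcoalgebra (D : Submodule k B) : Prop :=
  IsSubcoalgebra D ∧ D ≠ ⊥ ∧ ∀ E ≤ D, IsSubcoalgebra E → E = ⊥ ∨ E = D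

/-- The coradical: the sum of all simple subcoalgebras. -/
def coradical : Submodule k B := sSup {D | IsSimpleSubcoalgebra D}

/-- A coalgebra is pointed if its coradical is spanned by the group-like elements. -/
def IsPointedCoalgebra : Prop :=
  coradical k B = Submodule.span k {g : B | IsGroupLikeElem k g}

/-- The coradical filtration: `B₀` is the coradical and
`Bₙ₊₁ = Δ⁻¹(B ⊗ Bₙ + B₀ ⊗ B)`. -/
noncomputable def coradFilt : ℕ → Submodule k B
  | 0 => coradical k B
  | n + 1 => Submodule.comap (Coalgebra.comul (R := k))
      (LinearMap.range (LinearMap.lTensor B (coradFilt n).subtype) ⊔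
        LinearMap.range (LinearMap.rTensor B (coradical k B).subtype))

/-- `Bₙ₋₁`, with `B₋₁ = 0`. -/
noncomputable def coradFiltPred : ℕ → Submodule k B
  | 0 => ⊥
  | n + 1 => coradFilt k B n

/-- `Bₙ / Bₙ₋₁`. -/
abbrev GrPiece (n : ℕ) : Type u :=
  coradFilt k B n ⧸ (coradFiltPred k B n).submoduleOf (coradFilt k B n)

/-- The graded vector space `gr B = ⨁ₙ Bₙ / Bₙ₋₁`. -/
abbrev Gr : Type u := DirectSum ℕ (GrPiece k B)

/-- The map `Bₙ → gr B` taking an element of `Bₙ` to its class in degree `n`. -/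
noncomputable def grCls (n : ℕ) : coradFilt k B n →ₗ[k] Gr k B :=
  DirectSum.lof k ℕ (GrPiece k B) n ∘ₗ
    ((coradFiltPred k B n).submoduleOf (coradFilt k B n)).mkQ

/-- The homogeneous component `C(n)` of a vector space identified with `gr B`. -/
noncomputable def grComponent {k : Type v} {B : Type u} [Field k] [AddCommGroup B] [Module k B]
    [Coalgebra k B] {C : Type u} [AddCommGroup C] [Module k C] (e : Gr k B ≃ₗ[k] C) (n : ℕ) :
    Submodule k C :=
  LinearMap.range (e.toLinearMap ∘ₗ DirectSum.lof k ℕ (GrPiece k B) n)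

end Coradical

/-! ### Graded Poisson Hopf algebras, and the structure of `gr B` -/

section Graded

variable {k : Type v} [Field k] {C : Type u} [CommRing C] [HopfAlgebra k C]

/-- `C = ⨁ₙ 𝒞 n` is a graded Poisson Hopf algebra: a Poisson Hopf algebra and a graded Hopf
algebra, with `{𝒞 i, 𝒞 j} ⊆ 𝒞 (i + j)`. -/
structure IsGradedPoissonHopf (PC : PoissonBracket k C) (𝒞 : ℕ → Submodule k C) : Prop where
  poisson : PC.IsPoissonBialgebra
  isInternal : DirectSum.IsInternal 𝒞
  one_mem : (1 : C) ∈ 𝒞 0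
  mul_mem : ∀ i j, ∀ x ∈ 𝒞 i, ∀ y ∈ 𝒞 j, x * y ∈ 𝒞 (i + j)
  comul_mem : ∀ n, ∀ x ∈ 𝒞 n, Coalgebra.comul (R := k) x ∈
    ⨆ p ∈ Finset.HasAntidiagonal.antidiagonal n, LinearMap.range (TensorProduct.mapIncl (𝒞 p.1) (𝒞 p.2))
  counit_eq_zero : ∀ n ≠ 0, ∀ x ∈ 𝒞 n, Coalgebra.counit (R := k) x = 0
  antipode_mem : ∀ n, ∀ x ∈ 𝒞 n, HopfAlgebra.antipode k x ∈ 𝒞 n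
  br_mem : ∀ i j, ∀ x ∈ 𝒞 i, ∀ y ∈ 𝒞 j, PC.br x y ∈ 𝒞 (i + j)

/-- Under the identification `e` of vector spaces, the operations of `C` are those which `gr B`
inherits from `B`: they are computed on representatives. In particular the coradical filtration
of `B` is compatible with all the operations. For the comultiplication, if
`Δ a = ∑ᵢ₊ⱼ₌ₙ uᵢⱼ` with `uᵢⱼ ∈ Bᵢ ⊗ Bⱼ`, then `Δ ā` is the sum of the classes of the `uᵢⱼ`. -/
structure IsAssociatedGraded {B : Type u} [CommRing B] [HopfAlgebra k B]
    (P : PoissonBracket k B) (PC : PoissonBracket k C) (e : Gr k B ≃ₗ[k] C) : Prop where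
  one : ∃ h : (1 : B) ∈ coradFilt k B 0, e (grCls k B 0 ⟨1, h⟩) = 1
  mul : ∀ i j (a : coradFilt k B i) (b : coradFilt k B j),
    ∃ h : (a * b : B) ∈ coradFilt k B (i + j),
      e (grCls k B i a) * e (grCls k B j b) = e (grCls k B (i + j) ⟨a * b, h⟩)
  counit : ∀ n (a : coradFilt k B n), Coalgebra.counit (R := k) (e (grCls k B n a)) =
    if n = 0 then Coalgebra.counit (R := k) (a : B) else 0
  exists_comul : ∀ n (a : coradFilt k B n),
    ∃ u : ∀ p : ℕ × ℕ, coradFilt k B p.1 ⊗[k] coradFilt k B p.2,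
      Coalgebra.comul (R := k) (a : B) = ∑ p ∈ Finset.HasAntidiagonal.antidiagonal n,
        TensorProduct.mapIncl (coradFilt k B p.1) (coradFilt k B p.2) (u p)
  comul : ∀ n (a : coradFilt k B n)
    (u : ∀ p : ℕ × ℕ, coradFilt k B p.1 ⊗[k] coradFilt k B p.2),
      Coalgebra.comul (R := k) (a : B) = ∑ p ∈ Finset.HasAntidiagonal.antidiagonal n,
        TensorProduct.mapIncl (coradFilt k B p.1) (coradFilt k B p.2) (u p) →
      Coalgebra.comul (R := k) (e (grCls k B n a)) = ∑ p ∈ Finset.HasAntidiagonal.antidiagonal n,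
        TensorProduct.map (e.toLinearMap ∘ₗ grCls k B p.1) (e.toLinearMap ∘ₗ grCls k B p.2) (u p)
  antipode : ∀ n (a : coradFilt k B n), ∃ h : HopfAlgebra.antipode k (a : B) ∈ coradFilt k B n,
    HopfAlgebra.antipode k (e (grCls k B n a)) =
      e (grCls k B n ⟨HopfAlgebra.antipode k (a : B), h⟩)
  br : ∀ i j (a : coradFilt k B i) (b : coradFilt k B j),
    ∃ h : P.br (a : B) (b : B) ∈ coradFilt k B (i + j),
      PC.br (e (grCls k B i a)) (e (grCls k B j b)) =
        e (grCls k B (i + j) ⟨P.br (a : B) (b : B), h⟩)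

end Graded

/-! ### The biproduct decomposition -/

section Biproduct

/-- The coinvariants `{x | (id ⊗ π) Δ(x) = x ⊗ 1}` of an algebra map `π : C → H`. -/
noncomputable def rightCoinvariants {k : Type v} [CommRing k] {C : Type u} [Ring C] [Bialgebra k C]
    {H : Type w} [Ring H] [Algebra k H] (π : C →ₐ[k] H) : Subalgebra k C :=
  AlgHom.equalizer
    ((Algebra.TensorProduct.map (AlgHom.id k C) π).comp (Bialgebra.comulAlgHom k C))
    Algebra.TensorProduct.includeLeft

/-- Radford's decomposition `C ≅ R # H` of a commutative Hopf algebra `C`, where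
`ι : H → C` and `π : C → H` are bialgebra maps with `π ι = id` and `R` is the algebra of
`π`-coinvariants. As `C` is commutative, `H` acts trivially on `R`, and the biproduct is `R ⊗ H` as
an algebra. `R` has the left `H`-coaction `ρ = (π ⊗ id) Δ` and the comultiplication
`r ↦ ∑ r₁ ιπS(r₂) ⊗ r₃`, and the comultiplication of the biproduct is
`r # x ↦ ∑ (r⁽¹⁾ # (r⁽²⁾)₍₋₁₎ x₁) ⊗ ((r⁽²⁾)₍₀₎ # x₂)`. -/
structure IsBiproduct {k : Type v} [Field k] {C : Type u} [CommRing C] [HopfAlgebra k C]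
    {H : Type w} [CommRing H] [Bialgebra k H] (ι : H →ₐc[k] C) (π : C →ₐc[k] H) : Prop where
  bijective : Function.Bijective (Algebra.TensorProduct.productMap
    (rightCoinvariants (π : C →ₐ[k] H)).val (ι : H →ₐ[k] C))
  comul : ∃ (ρ : rightCoinvariants (π : C →ₐ[k] H) →ₗ[k] H ⊗[k] rightCoinvariants (π : C →ₐ[k] H))
    (δ : rightCoinvariants (π : C →ₐ[k] H) →ₗ[k]
      rightCoinvariants (π : C →ₐ[k] H) ⊗[k] rightCoinvariants (π : C →ₐ[k] H)),
    (∀ r, LinearMap.lTensor H (rightCoinvariants (π : C →ₐ[k] H)).val.toLinearMap (ρ r) =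
      LinearMap.rTensor C (π : C →ₐ[k] H).toLinearMap (Coalgebra.comul (R := k) (r : C))) ∧
    (∀ r, TensorProduct.map (rightCoinvariants (π : C →ₐ[k] H)).val.toLinearMap
        (rightCoinvariants (π : C →ₐ[k] H)).val.toLinearMap (δ r) =
      LinearMap.rTensor C
        (LinearMap.mul' k C ∘ₗ LinearMap.lTensor C ((ι : H →ₐ[k] C).toLinearMap ∘ₗ
          (π : C →ₐ[k] H).toLinearMap ∘ₗ HopfAlgebra.antipode k) ∘ₗ Coalgebra.comul)
        (Coalgebra.comul (R := k) (r : C))) ∧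
    ∀ (r : rightCoinvariants (π : C →ₐ[k] H)) (x : H),
      Coalgebra.comul (R := k) ((r : C) * ι x) =
        TensorProduct.map
            (Algebra.TensorProduct.productMap (rightCoinvariants (π : C →ₐ[k] H)).val
              (ι : H →ₐ[k] C)).toLinearMap
            (rightCoinvariants (π : C →ₐ[k] H)).val.toLinearMap
          ((TensorProduct.assoc k _ _ _).symm (LinearMap.lTensor _ ρ (δ r))) *
        TensorProduct.map (ι : H →ₐ[k] C).toLinearMap (ι : H →ₐ[k] C).toLinearMap
          (Coalgebra.comul (R := k) x)

end Biproduct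

/-! The filtration. Put F_n = B_{n-1}. By definition of the coradical filtration, Δ induces an
injection of B/F_{n+1} into B/F_1 ⊗ B/F_n (`exists_injective_quotient`). Coassociativity, together
with flatness over a field, turns this into Δ(F_{i+j}) ⊆ B ⊗ F_j + F_i ⊗ B, and intersecting over i
+ j = n + 1 gives Δ(B_n) ⊆ ∑ B_i ⊗ B_{n-i} (`comul_mem_tensorFilt`). Membership in B_{n+1} is tested
by Δ, and product, bracket and antipode are each compatible with Δ, so they respect the filtration
by induction on the degree. The induction starts because B_0 = kG is a subcoalgebra closed under
products and antipode, on which the bracket vanishes. Every operation of gr B is then computed on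
representatives, and the axioms are inherited from B.

The biproduct. Algebra maps from C to a commutative algebra form a group under convolution. In that
language E = id * (ιπ)⁻¹ projects C onto R, and (E ⊗ π)Δ inverts the product map R ⊗ kG → C. The
maps ι and π are Poisson because the bracket of C vanishes on C(0). Since kG has zero bracket,
applying id ⊗ π to Δ{x, y} shows that R is closed under the bracket and under d_g = g⁻¹{g, -}.

The action. The d_g are commuting Poisson derivations of R, additive in g. Each one extends to a
derivation δ_g of R^e and also defines an automorphism τ_g, which fixes m_y and sends h_y to h_y +
m_{d_g y}. Letting m_g act as τ_g and h_g as τ_g δ_g gives the module algebra. These are also the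
rules by which m_g and h_g move past Ψ(R^e) inside C^e (`m_mul_envVal`, `h_mul_envVal`), so Φ is an
algebra map.

The inverse. It comes from the universal property of C^e, with m_{rg} and h_{rg} sent to the
elements prescribed in the theorem. In terms of l_g = m_{g⁻¹} h_g, which satisfies l_g a = a l_g +
δ_g(a) for a in R^e, the image of h_{rg} is m_g (m_r l_g + h_r). The defining relations of C^e then
become three identities in a noncommutative ring (`relation_m_br`, `relation_h_mul`,
`relation_h_br`). Uniqueness holds because g = 1 and r = 1 in the two formulas recover all
generators. -/

/-! ### Subspaces of `B ⊗ B` over a field -/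

section TensorSubmodule

variable {k : Type v} {B : Type u} [Field k] [AddCommGroup B] [Module k B]

/-- The image of `V ⊗ W` in `B ⊗ B`. -/
def tensorSub (V W : Submodule k B) : Submodule k (B ⊗[k] B) :=
  Submodule.map₂ (TensorProduct.mk k B B) V W

theorem range_mapIncl_eq_tensorSub (V W : Submodule k B) :
    LinearMap.range (TensorProduct.mapIncl V W) = tensorSub V W :=
  TensorProduct.range_mapIncl V W

theorem tmul_mem_tensorSub {V W : Submodule k B} {a b : B} (ha : a ∈ V) (hb : b ∈ W) :
    a ⊗ₜ[k] b ∈ tensorSub V W :=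
  Submodule.apply_mem_map₂ _ ha hb

theorem tensorSub_le {V W : Submodule k B} {S : Submodule k (B ⊗[k] B)} :
    tensorSub V W ≤ S ↔ ∀ a ∈ V, ∀ b ∈ W, a ⊗ₜ[k] b ∈ S :=
  Submodule.map₂_le

theorem tensorSub_mono {V V' W W' : Submodule k B} (hV : V ≤ V') (hW : W ≤ W') :
    tensorSub V W ≤ tensorSub V' W' :=
  Submodule.map₂_le_map₂ hV hW

theorem tensorSub_bot_right (V : Submodule k B) : tensorSub V ⊥ = ⊥ :=
  Submodule.map₂_bot_right _ _

theorem tensorSub_bot_left (V : Submodule k B) : tensorSub ⊥ V = ⊥ :=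
  Submodule.map₂_bot_left _ _

theorem range_lTensor_subtype (W : Submodule k B) :
    LinearMap.range (LinearMap.lTensor B W.subtype) = tensorSub ⊤ W := by
  rw [LinearMap.lTensor, TensorProduct.range_map, LinearMap.range_id, Submodule.range_subtype]
  rfl

theorem range_rTensor_subtype (W : Submodule k B) :
    LinearMap.range (LinearMap.rTensor B W.subtype) = tensorSub W ⊤ := by
  rw [LinearMap.rTensor, TensorProduct.range_map, LinearMap.range_id, Submodule.range_subtype]
  rfl

/-- This converts conditions of the form Δx ∈ B ⊗ W + V ⊗ B into vanishing in B/V ⊗ B/W, where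
injections can be composed. -/
theorem ker_map_mkQ (V W : Submodule k B) :
    LinearMap.ker (TensorProduct.map V.mkQ W.mkQ) = tensorSub ⊤ W ⊔ tensorSub V ⊤ := by
  rw [TensorProduct.map_ker (f := V.subtype) (f' := W.subtype) (LinearMap.exact_subtype_mkQ V)
    V.mkQ_surjective (LinearMap.exact_subtype_mkQ W) W.mkQ_surjective, range_lTensor_subtype,
    range_rTensor_subtype]

theorem ker_lTensor_mkQ (W : Submodule k B) :
    LinearMap.ker (LinearMap.lTensor B W.mkQ) = tensorSub ⊤ W := by
  rw [(lTensor_exact B (LinearMap.exact_subtype_mkQ W) W.mkQ_surjective).linearMap_ker_eq,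
    range_lTensor_subtype]

theorem ker_rTensor_mkQ (W : Submodule k B) :
    LinearMap.ker (LinearMap.rTensor B W.mkQ) = tensorSub W ⊤ := by
  rw [(rTensor_exact B (LinearMap.exact_subtype_mkQ W) W.mkQ_surjective).linearMap_ker_eq,
    range_rTensor_subtype]

/-- Flatness of B/V: an element of B ⊗ W that dies in B/V ⊗ B already dies in B/V ⊗ W, and right
exactness lifts it to V ⊗ W. -/
theorem tensorSub_inf (V W : Submodule k B) :
    tensorSub V ⊤ ⊓ tensorSub ⊤ W ≤ tensorSub V W := by
  rintro x ⟨hV, hW⟩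
  rw [← range_lTensor_subtype] at hW
  obtain ⟨y, rfl⟩ := hW
  rw [← ker_rTensor_mkQ] at hV
  have h1 : LinearMap.lTensor (B ⧸ V) W.subtype (LinearMap.rTensor W V.mkQ y) = 0 := by
    rw [← LinearMap.comp_apply, LinearMap.lTensor_comp_rTensor, ← LinearMap.rTensor_comp_lTensor]
    exact hV
  have h2 : LinearMap.rTensor W V.mkQ y = 0 := by
    apply Module.Flat.lTensor_preserves_injective_linearMap (M := B ⧸ V) W.subtype
      W.injective_subtype
    rw [h1, map_zero]
  obtain ⟨z, rfl⟩ := (rTensor_exact W (LinearMap.exact_subtype_mkQ V)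
    V.mkQ_surjective y).1 h2
  rw [← range_mapIncl_eq_tensorSub]
  refine ⟨z, ?_⟩
  rw [← LinearMap.comp_apply, LinearMap.lTensor_comp_rTensor]

end TensorSubmodule

/-! ### The coradical filtration and the comultiplication -/

section Filtration

variable {k : Type v} {B : Type u} [Field k] [AddCommGroup B] [Module k B] [Coalgebra k B]

theorem isSubcoalgebra_span_isGroupLikeElem :
    IsSubcoalgebra (Submodule.span k {g : B | IsGroupLikeElem k g}) := by
  intro x hx
  rw [range_mapIncl_eq_tensorSub]
  induction hx using Submodule.span_induction with
  | mem g hg =>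
    rw [IsGroupLikeElem.comul_eq_tmul_self hg]
    exact tmul_mem_tensorSub (Submodule.subset_span hg) (Submodule.subset_span hg)
  | zero => simp
  | add x y _ _ hx hy => rw [map_add]; exact add_mem hx hy
  | smul c x _ hx => rw [map_smul]; exact Submodule.smul_mem _ _ hx

theorem IsPointedCoalgebra.coradFilt_zero (hB : IsPointedCoalgebra k B) :
    coradFilt k B 0 = Submodule.span k {g : B | IsGroupLikeElem k g} := hB

theorem IsPointedCoalgebra.isSubcoalgebra (hB : IsPointedCoalgebra k B) :
    IsSubcoalgebra (coradFilt k B 0) := by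
  rw [hB.coradFilt_zero]
  exact isSubcoalgebra_span_isGroupLikeElem

theorem IsPointedCoalgebra.comul_mem_zero (hB : IsPointedCoalgebra k B) {x : B}
    (hx : x ∈ coradFilt k B 0) :
    Coalgebra.comul (R := k) x ∈ tensorSub (coradFilt k B 0) (coradFilt k B 0) := by
  rw [← range_mapIncl_eq_tensorSub]
  exact hB.isSubcoalgebra x hx

theorem mem_coradFilt_succ {n : ℕ} {x : B} : x ∈ coradFilt k B (n + 1) ↔
    Coalgebra.comul (R := k) x ∈ tensorSub ⊤ (coradFilt k B n) ⊔
      tensorSub (coradFilt k B 0) ⊤ := by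
  rw [← range_lTensor_subtype, ← range_rTensor_subtype]
  rfl

theorem rTensor_counit_mem {V : Submodule k B} {u : B ⊗[k] B} (hu : u ∈ tensorSub V ⊤) :
    TensorProduct.rid k B (LinearMap.lTensor B (Coalgebra.counit (R := k)) u) ∈ V := by
  have : tensorSub V ⊤ ≤ V.comap ((TensorProduct.rid k B).toLinearMap ∘ₗ
      LinearMap.lTensor B (Coalgebra.counit (R := k))) := by
    rw [tensorSub_le]
    intro a ha b _
    simpa using V.smul_mem _ ha
  exact this hu

/-- The shift F_n = B_{n-1} makes the recursion uniform from F_0 = 0. The case n = 0 is not part of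
the definition: one direction holds because B_0 is a subcoalgebra, the other by applying id ⊗ ε. -/
theorem mem_coradFiltPred_succ (hB : IsPointedCoalgebra k B) {n : ℕ} {x : B} :
    x ∈ coradFiltPred k B (n + 1) ↔
    Coalgebra.comul (R := k) x ∈ tensorSub ⊤ (coradFiltPred k B n) ⊔
      tensorSub (coradFiltPred k B 1) ⊤ := by
  cases n with
  | zero =>
    simp only [coradFiltPred, tensorSub_bot_right, bot_sup_eq]
    refine ⟨fun h => tensorSub_mono le_rfl le_top (hB.comul_mem_zero h), fun h => ?_⟩
    simpa using rTensor_counit_mem h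
  | succ n => exact mem_coradFilt_succ

/-- The injection `B / Fₙ₊₁ → B / F₁ ⊗ B / Fₙ` induced by the comultiplication. -/
theorem exists_injective_quotient (hB : IsPointedCoalgebra k B) (n : ℕ) :
    ∃ J : (B ⧸ coradFiltPred k B (n + 1)) →ₗ[k]
      (B ⧸ coradFiltPred k B 1) ⊗[k] (B ⧸ coradFiltPred k B n),
      Function.Injective J ∧ J ∘ₗ (coradFiltPred k B (n + 1)).mkQ =
        TensorProduct.map (coradFiltPred k B 1).mkQ (coradFiltPred k B n).mkQ ∘ₗ
          Coalgebra.comul := by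
  have h : coradFiltPred k B (n + 1) = LinearMap.ker
      (TensorProduct.map (coradFiltPred k B 1).mkQ (coradFiltPred k B n).mkQ ∘ₗ
        Coalgebra.comul) := by
    ext x
    rw [mem_coradFiltPred_succ hB, ← ker_map_mkQ]
    rfl
  refine ⟨Submodule.liftQ _ _ h.le, ?_, Submodule.liftQ_mkQ _ _ _⟩
  rw [← LinearMap.ker_eq_bot, Submodule.ker_liftQ_eq_bot']
  exact h

/-- By injectivity of id ⊗ J it suffices to kill the image of Δx in B ⊗ B/F_1 ⊗ B/F_n. After
coassociativity, Δ is applied to the left factor of an element of B ⊗ F_n + F_1 ⊗ B. The first part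
dies in the third leg. The second dies in the middle leg, as Δ(F_1) ⊆ F_1 ⊗ F_1. -/
theorem comul_mem_tensorSub_top (hB : IsPointedCoalgebra k B) (n : ℕ) {x : B}
    (hx : x ∈ coradFiltPred k B n) :
    Coalgebra.comul (R := k) x ∈ tensorSub ⊤ (coradFiltPred k B n) := by
  cases n with
  | zero =>
    obtain rfl : x = 0 := by simpa [coradFiltPred] using hx
    simp
  | succ n =>
    obtain ⟨J, hJ, hJq⟩ := exists_injective_quotient hB n
    rw [← ker_lTensor_mkQ, LinearMap.mem_ker]
    apply Module.Flat.lTensor_preserves_injective_linearMap (M := B) J hJ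
    rw [map_zero, ← LinearMap.comp_apply, ← LinearMap.lTensor_comp, hJq, LinearMap.lTensor_comp,
      LinearMap.comp_apply, ← Coalgebra.coassoc_apply]
    rw [mem_coradFiltPred_succ hB] at hx
    have : tensorSub ⊤ (coradFiltPred k B n) ⊔ tensorSub (coradFiltPred k B 1) ⊤ ≤
        LinearMap.ker (LinearMap.lTensor B (TensorProduct.map (coradFiltPred k B 1).mkQ
          (coradFiltPred k B n).mkQ) ∘ₗ (TensorProduct.assoc k B B B).toLinearMap ∘ₗ
          LinearMap.rTensor B (Coalgebra.comul (R := k))) := by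
      rw [sup_le_iff, tensorSub_le, tensorSub_le]
      constructor
      · intro a _ b hb
        rw [LinearMap.mem_ker, LinearMap.comp_apply, LinearMap.comp_apply, LinearMap.rTensor_tmul]
        generalize Coalgebra.comul (R := k) a = u
        induction u with
        | zero => simp
        | add u v hu hv => rw [TensorProduct.add_tmul, map_add, map_add, hu, hv, add_zero]
        | tmul p q => simp [(Submodule.Quotient.mk_eq_zero _).2 hb]
      · intro a ha b _
        rw [LinearMap.mem_ker, LinearMap.comp_apply, LinearMap.comp_apply, LinearMap.rTensor_tmul]
        have hle : tensorSub (coradFilt k B 0) (coradFilt k B 0) ≤ LinearMap.ker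
            (LinearMap.lTensor B (TensorProduct.map (coradFiltPred k B 1).mkQ
              (coradFiltPred k B n).mkQ) ∘ₗ (TensorProduct.assoc k B B B).toLinearMap ∘ₗ
              (TensorProduct.mk k _ _).flip b) := by
          rw [tensorSub_le]
          intro p _ q hq
          have : (Submodule.Quotient.mk q : B ⧸ coradFiltPred k B 1) = 0 :=
            (Submodule.Quotient.mk_eq_zero _).2 hq
          simp [this]
        exact hle (hB.comul_mem_zero ha)
    exact this hx

/-- Induction on i, embedding B/F_{i+1} into B/F_1 ⊗ B/F_i. Coassociativity moves the second Δ to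
the right factor of an element of B ⊗ F_{i+j} + F_1 ⊗ B; there the induction hypothesis handles
F_{i+j}, and F_1 dies in the first leg. -/
theorem comul_mem_tensorSub_sup (hB : IsPointedCoalgebra k B) (i j : ℕ) {x : B}
    (hx : x ∈ coradFiltPred k B (i + j)) : Coalgebra.comul (R := k) x ∈
      tensorSub ⊤ (coradFiltPred k B j) ⊔ tensorSub (coradFiltPred k B i) ⊤ := by
  induction i generalizing x with
  | zero =>
    rw [zero_add] at hx
    exact Submodule.mem_sup_left (comul_mem_tensorSub_top hB j hx)
  | succ i ih =>
    obtain ⟨J, hJ, hJq⟩ := exists_injective_quotient hB i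
    rw [← ker_map_mkQ, LinearMap.mem_ker]
    apply Module.Flat.rTensor_preserves_injective_linearMap
      (M := B ⧸ coradFiltPred k B j) J hJ
    rw [map_zero, LinearMap.rTensor, ← LinearMap.comp_apply, ← TensorProduct.map_comp, hJq]
    apply (TensorProduct.assoc k _ _ _).injective
    have key : (TensorProduct.assoc k _ _ _).toLinearMap ∘ₗ TensorProduct.map
        (TensorProduct.map (coradFiltPred k B 1).mkQ (coradFiltPred k B i).mkQ ∘ₗ
          Coalgebra.comul) (LinearMap.id ∘ₗ (coradFiltPred k B j).mkQ) =
        TensorProduct.map (coradFiltPred k B 1).mkQ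
          (TensorProduct.map (coradFiltPred k B i).mkQ (coradFiltPred k B j).mkQ) ∘ₗ
        (TensorProduct.assoc k _ _ _).toLinearMap ∘ₗ LinearMap.rTensor B Coalgebra.comul := by
      ext a b
      simp only [TensorProduct.AlgebraTensorModule.curry_apply, TensorProduct.curry_apply,
        LinearMap.coe_restrictScalars, LinearMap.comp_apply, TensorProduct.map_tmul,
        LinearMap.rTensor_tmul, LinearMap.id_apply]
      generalize Coalgebra.comul (R := k) a = u
      induction u with
      | zero => simp
      | add u v hu hv => simp only [TensorProduct.add_tmul, map_add, hu, hv]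
      | tmul p q => simp
    have key' := LinearMap.congr_fun key (Coalgebra.comul (R := k) x)
    rw [LinearMap.comp_apply] at key'
    rw [map_zero]
    refine key'.trans ?_
    rw [LinearMap.comp_apply, LinearMap.comp_apply]
    erw [Coalgebra.coassoc_apply]
    rw [show i + 1 + j = i + j + 1 by omega, mem_coradFiltPred_succ hB] at hx
    have : tensorSub ⊤ (coradFiltPred k B (i + j)) ⊔ tensorSub (coradFiltPred k B 1) ⊤ ≤
        LinearMap.ker (TensorProduct.map (coradFiltPred k B 1).mkQ
          (TensorProduct.map (coradFiltPred k B i).mkQ (coradFiltPred k B j).mkQ) ∘ₗ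
          LinearMap.lTensor B Coalgebra.comul) := by
      rw [sup_le_iff, tensorSub_le, tensorSub_le]
      constructor
      · intro a _ b hb
        have h := ih hb
        rw [← ker_map_mkQ, LinearMap.mem_ker] at h
        rw [LinearMap.mem_ker, LinearMap.comp_apply, LinearMap.lTensor_tmul, TensorProduct.map_tmul,
          h, TensorProduct.tmul_zero]
      · intro a ha b _
        have : (Submodule.Quotient.mk a : B ⧸ coradFiltPred k B 1) = 0 :=
          (Submodule.Quotient.mk_eq_zero _).2 ha
        simp [this]
    exact this hx

theorem coradFilt_le_succ (hB : IsPointedCoalgebra k B) (n : ℕ) :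
    coradFilt k B n ≤ coradFilt k B (n + 1) := by
  intro x hx
  exact mem_coradFilt_succ.2 (Submodule.mem_sup_left (comul_mem_tensorSub_top hB (n + 1) hx))

theorem coradFilt_mono (hB : IsPointedCoalgebra k B) : Monotone (coradFilt k B) :=
  monotone_nat_of_le_succ (coradFilt_le_succ hB)

theorem coradFiltPred_mono (hB : IsPointedCoalgebra k B) : Monotone (coradFiltPred k B) :=
  monotone_nat_of_le_succ fun n => by
    cases n with
    | zero => exact bot_le
    | succ n => exact coradFilt_le_succ hB n

variable (k B) in
/-- The filtration of `B ⊗ B` by the sums of the `Bᵢ ⊗ Bⱼ` with `i + j = n`. -/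
def tensorFilt (n : ℕ) : Submodule k (B ⊗[k] B) :=
  Submodule.span k {x | ∃ i j, i + j = n ∧ ∃ a ∈ coradFilt k B i, ∃ b ∈ coradFilt k B j,
    x = a ⊗ₜ b}

theorem tmul_mem_tensorFilt {i j n : ℕ} (h : i + j = n) {a b : B} (ha : a ∈ coradFilt k B i)
    (hb : b ∈ coradFilt k B j) : a ⊗ₜ[k] b ∈ tensorFilt k B n :=
  Submodule.subset_span ⟨i, j, h, a, ha, b, hb, rfl⟩

theorem tensorSub_le_tensorFilt {i j n : ℕ} (h : i + j = n) :
    tensorSub (coradFilt k B i) (coradFilt k B j) ≤ tensorFilt k B n :=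
  tensorSub_le.2 fun _ ha _ hb => tmul_mem_tensorFilt h ha hb

theorem tensorFilt_le {n : ℕ} {S : Submodule k (B ⊗[k] B)}
    (h : ∀ i j, i + j = n → ∀ a ∈ coradFilt k B i, ∀ b ∈ coradFilt k B j, a ⊗ₜ[k] b ∈ S) :
    tensorFilt k B n ≤ S := by
  refine Submodule.span_le.2 ?_
  rintro _ ⟨i, j, hn, a, ha, b, hb, rfl⟩
  exact h i j hn a ha b hb

/-- The pieces B_i ⊗ B_j are split off from x one at a time, leaving a remainder in B ⊗ F_j with j
decreasing; at j = 0 nothing remains. -/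
theorem iInf_le_tensorFilt (hB : IsPointedCoalgebra k B) {n : ℕ} {x : B ⊗[k] B}
    (hx : ∀ i j, i + j = n + 1 →
      x ∈ tensorSub ⊤ (coradFiltPred k B j) ⊔ tensorSub (coradFiltPred k B i) ⊤) :
    x ∈ tensorFilt k B n := by
  have key : ∀ i j, i + j = n + 1 → x ∈
      (tensorFilt k B n ⊓ tensorSub (coradFiltPred k B i) ⊤) ⊔
        tensorSub ⊤ (coradFiltPred k B j) := by
    intro i
    induction i with
    | zero =>
      intro j hj
      have := hx 0 j hj
      rw [coradFiltPred, tensorSub_bot_left, sup_bot_eq] at this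
      exact Submodule.mem_sup_right this
    | succ i ih =>
      intro j hj
      obtain ⟨s, ⟨hs, hs'⟩, t, ht, rfl⟩ := Submodule.mem_sup.1 (ih (j + 1) (by omega))
      have hs2 : s ∈ tensorSub (coradFiltPred k B (i + 1)) ⊤ :=
        tensorSub_mono (coradFiltPred_mono hB (Nat.le_succ i)) le_rfl hs'
      have ht2 : t ∈ tensorSub ⊤ (coradFiltPred k B j) ⊔
          tensorSub (coradFiltPred k B (i + 1)) ⊤ := by
        have h1 := Submodule.sub_mem _ (hx (i + 1) j hj) (Submodule.mem_sup_right hs2)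
        simpa using h1
      obtain ⟨q, hq, p, hp, rfl⟩ := Submodule.mem_sup.1 ht2
      -- The new piece p lies in F_{i+1} ⊗ B by choice and in B ⊗ F_{j+1} as t - q, hence in F_{i+1}
      -- ⊗ F_{j+1} = B_i ⊗ B_j, where i + j = n.
      have hp2 : p ∈ tensorSub ⊤ (coradFiltPred k B (j + 1)) := by
        have h1 := Submodule.sub_mem _ ht
          (tensorSub_mono le_rfl (coradFiltPred_mono hB (Nat.le_succ j)) hq)
        simpa using h1
      have hp3 : p ∈ tensorFilt k B n :=
        tensorSub_le_tensorFilt (by omega) (tensorSub_inf _ _ ⟨hp, hp2⟩)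
      have : s + (q + p) = (s + p) + q := by abel
      rw [this]
      exact Submodule.add_mem_sup ⟨add_mem hs hp3, add_mem hs2 hp⟩ hq
  have := key (n + 1) 0 rfl
  rw [coradFiltPred, coradFiltPred, tensorSub_bot_right, sup_bot_eq] at this
  exact this.1

/-- `Δ(Bₙ) ⊆ ∑ Bᵢ ⊗ Bₙ₋ᵢ`. -/
theorem comul_mem_tensorFilt (hB : IsPointedCoalgebra k B) {n : ℕ} {x : B}
    (hx : x ∈ coradFilt k B n) : Coalgebra.comul (R := k) x ∈ tensorFilt k B n := by
  refine iInf_le_tensorFilt hB fun i j h => comul_mem_tensorSub_sup hB i j ?_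
  rw [h]
  exact hx

theorem tensorFilt_eq_iSup (n : ℕ) : tensorFilt k B n =
    ⨆ p ∈ Finset.HasAntidiagonal.antidiagonal n,
      LinearMap.range (TensorProduct.mapIncl (coradFilt k B p.1) (coradFilt k B p.2)) := by
  simp only [range_mapIncl_eq_tensorSub]
  apply le_antisymm
  · refine tensorFilt_le fun i j h a ha b hb => ?_
    exact Submodule.mem_iSup_of_mem (i, j) (Submodule.mem_iSup_of_mem (by simpa using h)
      (tmul_mem_tensorSub ha hb))
  · refine iSup₂_le fun p hp => tensorSub_le_tensorFilt (by simpa using hp)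

theorem exists_of_mem_tensorFilt {n : ℕ} {x : B ⊗[k] B} (hx : x ∈ tensorFilt k B n) :
    ∃ u : ∀ p : ℕ × ℕ, coradFilt k B p.1 ⊗[k] coradFilt k B p.2,
      x = ∑ p ∈ Finset.HasAntidiagonal.antidiagonal n,
        TensorProduct.mapIncl (coradFilt k B p.1) (coradFilt k B p.2) (u p) := by
  rw [tensorFilt_eq_iSup, Submodule.mem_iSup_finset_iff_exists_sum] at hx
  obtain ⟨μ, hμ⟩ := hx
  choose u hu using fun p => (μ p).2
  exact ⟨u, by simp only [hu, hμ]⟩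

end Filtration

/-! ### Product, bracket and antipode respect the filtration -/

section FiltrationOperations

theorem tensorFilt_bilinear_mem {k : Type v} {B : Type u} [Field k] [AddCommGroup B] [Module k B]
    [Coalgebra k B] {M : Type*} [AddCommGroup M] [Module k M]
    (f : B ⊗[k] B →ₗ[k] B ⊗[k] B →ₗ[k] M) (S : Submodule k M) {n m : ℕ}
    (h : ∀ i j, i + j = n → ∀ a ∈ coradFilt k B i, ∀ b ∈ coradFilt k B j,
      ∀ i' j', i' + j' = m → ∀ c ∈ coradFilt k B i', ∀ d ∈ coradFilt k B j',
        f (a ⊗ₜ b) (c ⊗ₜ d) ∈ S)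
    {u v : B ⊗[k] B} (hu : u ∈ tensorFilt k B n) (hv : v ∈ tensorFilt k B m) : f u v ∈ S := by
  have h1 : ∀ i j, i + j = n → ∀ a ∈ coradFilt k B i, ∀ b ∈ coradFilt k B j,
      tensorFilt k B m ≤ S.comap (f (a ⊗ₜ b)) := fun i j hij a ha b hb =>
    tensorFilt_le fun i' j' hij' c hc d hd => h i j hij a ha b hb i' j' hij' c hc d hd
  have h2 : tensorFilt k B n ≤ S.comap (f.flip v) :=
    tensorFilt_le fun i j hij a ha b hb => h1 i j hij a ha b hb hv
  exact h2 hu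

variable {k : Type v} {B : Type u} [Field k] [CommRing B]

section Bialgebra

variable [Bialgebra k B]

theorem one_mem_coradFilt_zero (hB : IsPointedCoalgebra k B) : (1 : B) ∈ coradFilt k B 0 := by
  rw [hB.coradFilt_zero]
  exact Submodule.subset_span IsGroupLikeElem.one

theorem groupLike_mem_coradFilt_zero (hB : IsPointedCoalgebra k B) (g : GroupLike k B) :
    (g : B) ∈ coradFilt k B 0 := by
  rw [hB.coradFilt_zero]
  exact Submodule.subset_span g.2

theorem coradFilt_zero_induction (hB : IsPointedCoalgebra k B)
    {p : ∀ x : B, x ∈ coradFilt k B 0 → Prop} (zero : p 0 (zero_mem _))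
    (add : ∀ x hx y hy, p x hx → p y hy → p (x + y) (add_mem hx hy))
    (smul : ∀ (c : k) x hx, p x hx → p (c • x) (Submodule.smul_mem _ c hx))
    (groupLike : ∀ g : GroupLike k B, p g (groupLike_mem_coradFilt_zero hB g)) {x : B}
    (hx : x ∈ coradFilt k B 0) : p x hx := by
  have hx' := hx
  rw [hB.coradFilt_zero] at hx'
  induction hx' using Submodule.span_induction with
  | mem g hg => exact groupLike ⟨g, hg⟩
  | zero => exact zero
  | add x y h1 h2 h3 h4 =>
    rw [← hB.coradFilt_zero] at h1 h2
    exact add x h1 y h2 (h3 h1) (h4 h2)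
  | smul c x h1 h2 =>
    rw [← hB.coradFilt_zero] at h1
    exact smul c x h1 (h2 h1)

theorem br_eq_zero_of_mem_zero (hB : IsPointedCoalgebra k B) (P : PoissonBracket k B)
    (hG : ∀ g t : B, IsGroupLikeElem k g → IsGroupLikeElem k t → P.br g t = 0) {x y : B}
    (hx : x ∈ coradFilt k B 0) (hy : y ∈ coradFilt k B 0) : P.br x y = 0 := by
  induction hx using coradFilt_zero_induction hB with
  | zero => simp
  | add a _ b _ ha hb => rw [map_add, LinearMap.add_apply, ha, hb, add_zero]
  | smul c a _ ha => rw [map_smul, LinearMap.smul_apply, ha, smul_zero]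
  | groupLike g =>
  induction hy using coradFilt_zero_induction hB with
  | zero => simp
  | add a _ b _ ha hb => rw [map_add, ha, hb, add_zero]
  | smul c a _ ha => rw [map_smul, ha, smul_zero]
  | groupLike t => exact hG g t g.2 t.2

/-- Induction on the total degree, expanding Δ(x)Δ(y) into terms ac ⊗ bd. In degree zero, products
of group-likes are group-like. -/
theorem mul_mem_coradFilt (hB : IsPointedCoalgebra k B) {i j : ℕ} {x y : B}
    (hx : x ∈ coradFilt k B i) (hy : y ∈ coradFilt k B j) : x * y ∈ coradFilt k B (i + j) := by
  generalize hn : i + j = n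
  induction n using Nat.strong_induction_on generalizing i j x y with
  | _ n ih =>
  cases n with
  | zero =>
    obtain ⟨rfl, rfl⟩ : i = 0 ∧ j = 0 := by omega
    rw [hB.coradFilt_zero] at hx hy ⊢
    have := Submodule.mul_mem_mul hx hy
    rw [Submodule.span_mul_span] at this
    refine Submodule.span_mono ?_ this
    rintro _ ⟨a, ha, b, hb, rfl⟩
    exact IsGroupLikeElem.mul ha hb
  | succ n =>
    rw [mem_coradFilt_succ, Bialgebra.comul_mul]
    refine tensorFilt_bilinear_mem (LinearMap.mul k (B ⊗[k] B)) _ ?_ (comul_mem_tensorFilt hB hx)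
      (comul_mem_tensorFilt hB hy)
    intro p q hpq a ha b hb p' q' hpq' c hc d hd
    rw [LinearMap.mul_apply', Algebra.TensorProduct.tmul_mul_tmul]
    -- Either both left factors lie in B_0, and so does their product, or the right factors have
    -- total degree at most n and the induction hypothesis applies to them.
    by_cases h0 : p + p' = 0
    · exact Submodule.mem_sup_right (tmul_mem_tensorSub
        (ih 0 (Nat.succ_pos n) (i := p) (j := p') ha hc h0) trivial)
    · exact Submodule.mem_sup_left (tmul_mem_tensorSub trivial (coradFilt_mono hB (by omega)
        (ih (q + q') (by omega) hb hd rfl)))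

/-- The same induction as for products, with Δ{x, y} expanded into ac ⊗ {b, d} + {a, c} ⊗ bd. -/
theorem br_mem_coradFilt (hB : IsPointedCoalgebra k B) (P : PoissonBracket k B)
    [hP : P.IsPoissonBialgebra]
    (hG : ∀ g t : B, IsGroupLikeElem k g → IsGroupLikeElem k t → P.br g t = 0) {i j : ℕ} {x y : B}
    (hx : x ∈ coradFilt k B i) (hy : y ∈ coradFilt k B j) :
    P.br x y ∈ coradFilt k B (i + j) := by
  generalize hn : i + j = n
  induction n using Nat.strong_induction_on generalizing i j x y with
  | _ n ih =>
  cases n with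
  | zero =>
    obtain ⟨rfl, rfl⟩ : i = 0 ∧ j = 0 := by omega
    rw [br_eq_zero_of_mem_zero hB P hG hx hy]
    exact zero_mem _
  | succ n =>
    rw [mem_coradFilt_succ, hP.comul_br]
    refine tensorFilt_bilinear_mem P.tensorBr _ ?_ (comul_mem_tensorFilt hB hx)
      (comul_mem_tensorFilt hB hy)
    intro p q hpq a ha b hb p' q' hpq' c hc d hd
    rw [PoissonBracket.tensorBr_tmul]
    by_cases h0 : p + p' = 0
    -- Here {G, G} = 0 enters: {a, c} = 0, so only ac ⊗ {b, d} is left, and ac ∈ B_0.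
    · obtain ⟨rfl, rfl⟩ : p = 0 ∧ p' = 0 := by omega
      rw [br_eq_zero_of_mem_zero hB P hG ha hc, TensorProduct.zero_tmul, add_zero]
      exact Submodule.mem_sup_right (tmul_mem_tensorSub (mul_mem_coradFilt hB ha hc) trivial)
    · refine Submodule.mem_sup_left (add_mem (tmul_mem_tensorSub trivial (coradFilt_mono hB ?_
        (ih (q + q') (by omega) hb hd rfl))) (tmul_mem_tensorSub trivial (coradFilt_mono hB ?_
          (mul_mem_coradFilt hB hb hd)))) <;> omega

end Bialgebra

variable [HopfAlgebra k B]

open WithConv in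
/-- The antipode is an antihomomorphism of coalgebras. -/
theorem comul_antipode (x : B) : Coalgebra.comul (R := k) (HopfAlgebra.antipode k x) =
    TensorProduct.map (HopfAlgebra.antipode k) (HopfAlgebra.antipode k)
      (TensorProduct.comm k B B (Coalgebra.comul (R := k) x)) := by
  let iL : WithConv (B →ₐ[k] B ⊗[k] B) := toConv Algebra.TensorProduct.includeLeft
  let iR : WithConv (B →ₐ[k] B ⊗[k] B) := toConv Algebra.TensorProduct.includeRight
  have h1 : iL * iR = toConv (Bialgebra.comulAlgHom k B) := by
    apply WithConv.ofConv_injective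
    ext x
    simp only [iL, iR, AlgHom.convMul_apply, Bialgebra.comulAlgHom_apply]
    generalize Coalgebra.comul (R := k) x = u
    induction u with
    | zero => simp
    | add u v hu hv => simp only [map_add, hu, hv]
    | tmul a b => simp
  -- In the convolution group of algebra maps B → B ⊗ B, inversion is composition with the antipode
  -- and Δ is the product of the two inclusions; reversing that product produces the flip.
  have h2 : (iL * iR)⁻¹ = iR⁻¹ * iL⁻¹ := mul_inv_rev iL iR
  rw [h1] at h2
  have h3 := DFunLike.congr_fun (congrArg WithConv.ofConv h2) x
  refine h3.trans ?_
  rw [AlgHom.convMul_apply]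
  generalize Coalgebra.comul (R := k) x = u
  induction u with
  | zero => simp
  | add u v hu hv => simp only [map_add, hu, hv]
  | tmul a b =>
    change ((1 : B) ⊗ₜ[k] HopfAlgebra.antipode k a) * (HopfAlgebra.antipode k b ⊗ₜ[k] (1 : B)) = _
    simp

/-- A term a ⊗ b of Δx with a ∈ B_i and b ∈ B_j becomes S(b) ⊗ S(a). If j = 0 the left factor lies
in B_0; otherwise i ≤ n and induction puts the right factor in B_n. -/
theorem antipode_mem_coradFilt (hB : IsPointedCoalgebra k B) {n : ℕ} {x : B}
    (hx : x ∈ coradFilt k B n) : HopfAlgebra.antipode k x ∈ coradFilt k B n := by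
  induction n using Nat.strong_induction_on generalizing x with
  | _ n ih =>
  cases n with
  | zero =>
    rw [hB.coradFilt_zero] at hx ⊢
    induction hx using Submodule.span_induction with
    | mem g hg => exact Submodule.subset_span (IsGroupLikeElem.antipode (R := k) hg)
    | zero => simp
    | add x y _ _ hx hy => rw [map_add]; exact add_mem hx hy
    | smul c x _ hx => rw [map_smul]; exact Submodule.smul_mem _ _ hx
  | succ n =>
    rw [mem_coradFilt_succ, comul_antipode]
    have h : tensorFilt k B (n + 1) ≤ (tensorSub ⊤ (coradFilt k B n) ⊔
        tensorSub (coradFilt k B 0) ⊤).comap (TensorProduct.map (HopfAlgebra.antipode k)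
          (HopfAlgebra.antipode k) ∘ₗ (TensorProduct.comm k B B).toLinearMap) := by
      refine tensorFilt_le fun i j hij a ha b hb => ?_
      change HopfAlgebra.antipode k b ⊗ₜ[k] HopfAlgebra.antipode k a ∈
        tensorSub ⊤ (coradFilt k B n) ⊔ tensorSub (coradFilt k B 0) ⊤
      cases j with
      | zero => exact Submodule.mem_sup_right (tmul_mem_tensorSub (ih 0 (by omega) hb) trivial)
      | succ j => exact Submodule.mem_sup_left (tmul_mem_tensorSub trivial
          (coradFilt_mono hB (by omega) (ih i (by omega) ha)))
    exact h (comul_mem_tensorFilt hB hx)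

end FiltrationOperations

/-! ### The carrier of `gr B` and symbol maps -/

section GrAlg

variable {k : Type v} {B : Type u} [Field k] [CommRing B] [HopfAlgebra k B]

/-- The associated graded space of a pointed commutative Hopf algebra, as the carrier of the
graded algebra structure. -/
def GrAlg (_hB : IsPointedCoalgebra k B) : Type u := Gr k B

namespace GrAlg

variable {hB : IsPointedCoalgebra k B}

noncomputable instance : AddCommGroup (GrAlg hB) := inferInstanceAs (AddCommGroup (Gr k B))

noncomputable instance : Module k (GrAlg hB) := inferInstanceAs (Module k (Gr k B))

/-- Extending the class map from B_n to all of B allows symbols to be tensored and composed without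
membership proofs. The values outside B_n are arbitrary and have no influence on the results. -/
theorem exists_extend_grCls (n : ℕ) : ∃ f : B →ₗ[k] GrAlg hB,
    f ∘ₗ (coradFilt k B n).subtype = grCls k B n :=
  LinearMap.exists_extend (p := coradFilt k B n) (V' := GrAlg hB) (grCls k B n)

variable (hB) in
/-- A linear extension to `B` of the map `Bₙ → C(n)`. -/
noncomputable def symb (n : ℕ) : B →ₗ[k] GrAlg hB := (exists_extend_grCls n).choose

theorem symb_coe {n : ℕ} (x : coradFilt k B n) : symb hB n x = grCls k B n x :=
  LinearMap.congr_fun (exists_extend_grCls (hB := hB) n).choose_spec x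

theorem symb_eq {n : ℕ} {x : B} (hx : x ∈ coradFilt k B n) :
    symb hB n x = grCls k B n ⟨x, hx⟩ :=
  symb_coe (⟨x, hx⟩ : coradFilt k B n)

theorem symb_eq_zero {n : ℕ} {x : B} (hx : x ∈ coradFiltPred k B n) : symb hB n x = 0 := by
  have h : x ∈ coradFilt k B n := coradFiltPred_mono hB (Nat.le_succ n) hx
  rw [symb_eq h, grCls, LinearMap.comp_apply]
  have h2 : ((coradFiltPred k B n).submoduleOf (coradFilt k B n)).mkQ ⟨x, h⟩ = 0 :=
    (Submodule.Quotient.mk_eq_zero _).2 hx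
  rw [h2]
  exact map_zero _

theorem symb_eq_zero_of_lt {m n : ℕ} (hmn : m < n) {x : B} (hx : x ∈ coradFilt k B m) :
    symb hB n x = 0 :=
  symb_eq_zero (coradFiltPred_mono hB (Nat.succ_le_of_lt hmn) (a := m + 1) hx)

theorem induction {p : GrAlg hB → Prop} (c : GrAlg hB) (zero : p 0)
    (add : ∀ x y, p x → p y → p (x + y))
    (symb : ∀ n, ∀ x ∈ coradFilt k B n, p (symb hB n x)) : p c := by
  refine DirectSum.induction_on (motive := p) c zero (fun n x => ?_) add
  obtain ⟨y, rfl⟩ := Submodule.mkQ_surjective _ x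
  have := symb n y y.2
  rw [symb_coe] at this
  exact this

section Desc

variable {M : Type*} [AddCommGroup M] [Module k M]

/-- The linear map on `gr B` induced by maps on the `Bₙ` which vanish on `Bₙ₋₁`. -/
noncomputable def desc (f : ∀ n, coradFilt k B n →ₗ[k] M)
    (hf : ∀ n (x : coradFilt k B n), (x : B) ∈ coradFiltPred k B n → f n x = 0) :
    GrAlg hB →ₗ[k] M :=
  DirectSum.toModule k ℕ M fun n => Submodule.liftQ _ (f n) fun x hx => hf n x hx

theorem desc_symb (f : ∀ n, coradFilt k B n →ₗ[k] M)
    (hf : ∀ n (x : coradFilt k B n), (x : B) ∈ coradFiltPred k B n → f n x = 0)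
    {n : ℕ} {x : B} (hx : x ∈ coradFilt k B n) :
    desc f hf (symb hB n x) = f n ⟨x, hx⟩ := by
  rw [symb_eq hx, grCls, LinearMap.comp_apply]
  exact (DirectSum.toModule_lof k (φ := fun n => Submodule.liftQ _ (f n) fun x hx => hf n x hx)
    n _).trans (Submodule.liftQ_apply _ _ _)

theorem hom_ext {f g : GrAlg hB →ₗ[k] M}
    (h : ∀ n, ∀ x ∈ coradFilt k B n, f (symb hB n x) = g (symb hB n x)) : f = g := by
  ext c
  induction c using induction with
  | zero => simp
  | add x y hx hy => rw [map_add, map_add, hx, hy]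
  | symb n x hx => exact h n x hx

/-- The bilinear map on `gr B` induced by bilinear maps on `Bᵢ × Bⱼ`. -/
noncomputable def desc₂ (f : ℕ → ℕ → B →ₗ[k] B →ₗ[k] M)
    (h₁ : ∀ i j, ∀ x ∈ coradFiltPred k B i, ∀ y ∈ coradFilt k B j, f i j x y = 0)
    (h₂ : ∀ i j, ∀ x ∈ coradFilt k B i, ∀ y ∈ coradFiltPred k B j, f i j x y = 0) :
    GrAlg hB →ₗ[k] GrAlg hB →ₗ[k] M :=
  desc (fun i =>
    { toFun := fun x => desc (fun j => f i j x ∘ₗ (coradFilt k B j).subtype)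
        fun j y hy => by rw [LinearMap.comp_apply]; exact h₂ i j x x.2 y hy
      map_add' := fun x y => hom_ext fun j z hz => by
        rw [LinearMap.add_apply, desc_symb _ _ hz, desc_symb _ _ hz, desc_symb _ _ hz]; simp
      map_smul' := fun c x => hom_ext fun j z hz => by
        rw [LinearMap.smul_apply, desc_symb _ _ hz, desc_symb _ _ hz]; simp })
    fun i x hx => hom_ext fun j z hz => by
      refine (desc_symb _ _ hz).trans ?_
      exact h₁ i j x hx z hz

theorem desc₂_symb (f : ℕ → ℕ → B →ₗ[k] B →ₗ[k] M)
    (h₁ : ∀ i j, ∀ x ∈ coradFiltPred k B i, ∀ y ∈ coradFilt k B j, f i j x y = 0)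
    (h₂ : ∀ i j, ∀ x ∈ coradFilt k B i, ∀ y ∈ coradFiltPred k B j, f i j x y = 0)
    {i j : ℕ} {x y : B} (hx : x ∈ coradFilt k B i) (hy : y ∈ coradFilt k B j) :
    desc₂ f h₁ h₂ (symb hB i x) (symb hB j y) = f i j x y := by
  rw [desc₂, desc_symb _ _ hx]
  exact desc_symb _ _ hy

end Desc

/-! ### The algebra structure -/

theorem mul_mem_coradFiltPred_left {i j : ℕ} {x y : B} (hx : x ∈ coradFiltPred k B i)
    (hy : y ∈ coradFilt k B j) (hB : IsPointedCoalgebra k B) :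
    x * y ∈ coradFiltPred k B (i + j) := by
  cases i with
  | zero =>
    obtain rfl : x = 0 := by simpa [coradFiltPred] using hx
    simp
  | succ i =>
    rw [show i + 1 + j = i + j + 1 by omega]
    exact mul_mem_coradFilt hB hx hy

variable (hB) in
/-- The multiplication of `gr B`. -/
noncomputable def mulL : GrAlg hB →ₗ[k] GrAlg hB →ₗ[k] GrAlg hB :=
  desc₂ (fun i j => (LinearMap.mul k B).compr₂ (symb hB (i + j)))
    (fun i j x hx y hy => symb_eq_zero (mul_mem_coradFiltPred_left hx hy hB))
    (fun i j x hx y hy => symb_eq_zero (by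
      rw [LinearMap.mul_apply', mul_comm, add_comm]; exact mul_mem_coradFiltPred_left hy hx hB))

noncomputable instance : Mul (GrAlg hB) := ⟨fun a b => mulL hB a b⟩

noncomputable instance : One (GrAlg hB) := ⟨symb hB 0 1⟩

theorem one_def : (1 : GrAlg hB) = symb hB 0 1 := rfl

theorem mulL_apply (a b : GrAlg hB) : mulL hB a b = a * b := rfl

theorem symb_mul_symb {i j : ℕ} {x y : B} (hx : x ∈ coradFilt k B i) (hy : y ∈ coradFilt k B j) :
    symb hB i x * symb hB j y = symb hB (i + j) (x * y) :=
  desc₂_symb _ _ _ hx hy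

protected theorem left_distrib (a b c : GrAlg hB) : a * (b + c) = a * b + a * c :=
  map_add (mulL hB a) b c

protected theorem mul_comm (a b : GrAlg hB) : a * b = b * a := by
  rw [← mulL_apply, ← mulL_apply]
  induction a using induction with
  | zero => simp
  | add x y hx hy => rw [map_add, LinearMap.add_apply, hx, hy, map_add]
  | symb n x hx =>
    induction b using induction with
    | zero => simp
    | add x y hx hy => rw [map_add, hx, hy, map_add, LinearMap.add_apply]
    | symb m y hy =>
      rw [mulL_apply, mulL_apply, symb_mul_symb hx hy, symb_mul_symb hy hx, mul_comm, add_comm]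

protected theorem right_distrib (a b c : GrAlg hB) : (a + b) * c = a * c + b * c :=
  LinearMap.congr_fun (map_add (mulL hB) a b) c

protected theorem zero_mul (c : GrAlg hB) : 0 * c = 0 :=
  LinearMap.congr_fun (map_zero (mulL hB)) c

protected theorem mul_zero (c : GrAlg hB) : c * 0 = 0 :=
  map_zero (mulL hB c)

protected theorem mul_assoc (a b c : GrAlg hB) : a * b * c = a * (b * c) := by
  induction a using induction with
  | zero => simp only [GrAlg.zero_mul]
  | add x y hx hy => simp only [GrAlg.right_distrib, hx, hy]
  | symb n x hx =>
  induction b using induction with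
  | zero => simp only [GrAlg.zero_mul, GrAlg.mul_zero]
  | add x y hx hy => simp only [GrAlg.right_distrib, GrAlg.left_distrib, hx, hy]
  | symb m y hy =>
  induction c using induction with
  | zero => simp only [GrAlg.mul_zero]
  | add x y hx hy => simp only [GrAlg.left_distrib, hx, hy]
  | symb l z hz =>
    rw [symb_mul_symb hx hy, symb_mul_symb hy hz, symb_mul_symb (mul_mem_coradFilt hB hx hy) hz,
      symb_mul_symb hx (mul_mem_coradFilt hB hy hz), mul_assoc, add_assoc]

protected theorem one_mul (a : GrAlg hB) : 1 * a = a := by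
  induction a using induction with
  | zero => exact GrAlg.mul_zero _
  | add x y hx hy => rw [GrAlg.left_distrib, hx, hy]
  | symb n x hx =>
    rw [one_def, symb_mul_symb (one_mem_coradFilt_zero hB) hx, one_mul, zero_add]

noncomputable instance : CommRing (GrAlg hB) where
  __ := (inferInstance : AddCommGroup (GrAlg hB))
  mul_comm := GrAlg.mul_comm
  mul_assoc := GrAlg.mul_assoc
  one_mul := GrAlg.one_mul
  mul_one a := (GrAlg.mul_comm a 1).trans (GrAlg.one_mul a)
  zero_mul := GrAlg.zero_mul
  mul_zero := GrAlg.mul_zero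
  left_distrib := GrAlg.left_distrib
  right_distrib := GrAlg.right_distrib

noncomputable instance : Algebra k (GrAlg hB) :=
  Algebra.ofModule (fun c u v => LinearMap.congr_fun (map_smul (mulL hB) c u) v)
    (fun c u v => map_smul (mulL hB u) c v)

theorem algebraMap_eq (c : k) : algebraMap k (GrAlg hB) c = symb hB 0 (algebraMap k B c) := by
  rw [Algebra.algebraMap_eq_smul_one, Algebra.algebraMap_eq_smul_one, map_smul, one_def]

/-! ### The symbol map on `B ⊗ B` -/

variable (hB) in
/-- The sum of the maps `Bᵢ ⊗ Bⱼ → C(i) ⊗ C(j)` with `i + j = n`, extended to `B ⊗ B`. -/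
noncomputable def symb₂ (n : ℕ) : B ⊗[k] B →ₗ[k] GrAlg hB ⊗[k] GrAlg hB :=
  ∑ p ∈ Finset.HasAntidiagonal.antidiagonal n, TensorProduct.map (symb hB p.1) (symb hB p.2)

/-- Of the summands (p, q) only (i, j) survives: p > i kills the symbol of a, while p < i forces q >
j and kills that of b. Hence the arbitrary choice in `symb` is invisible on the n-th part of the
filtration. -/
theorem symb₂_tmul {i j n : ℕ} (h : i + j = n) {a b : B} (ha : a ∈ coradFilt k B i)
    (hb : b ∈ coradFilt k B j) : symb₂ hB n (a ⊗ₜ b) = symb hB i a ⊗ₜ symb hB j b := by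
  rw [symb₂, LinearMap.sum_apply, Finset.sum_eq_single (i, j)]
  · simp
  · rintro ⟨p, q⟩ hpq hne
    rw [Finset.HasAntidiagonal.mem_antidiagonal] at hpq
    rw [TensorProduct.map_tmul]
    rcases lt_trichotomy i p with hlt | rfl | hlt
    · rw [symb_eq_zero_of_lt hlt ha, TensorProduct.zero_tmul]
    · obtain rfl : j = q := by simp only at hpq; omega
      exact absurd rfl hne
    · rw [symb_eq_zero_of_lt (show j < q by simp only at hpq; omega) hb, TensorProduct.tmul_zero]
  · intro hn
    exact absurd (Finset.HasAntidiagonal.mem_antidiagonal.2 h) hn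

theorem symb₂_eq_zero_of_lt {m n : ℕ} (hmn : m < n) {u : B ⊗[k] B} (hu : u ∈ tensorFilt k B m) :
    symb₂ hB n u = 0 := by
  have : tensorFilt k B m ≤ LinearMap.ker (symb₂ hB n) := by
    refine tensorFilt_le fun i j hij a ha b hb => ?_
    rw [LinearMap.mem_ker, symb₂, LinearMap.sum_apply]
    refine Finset.sum_eq_zero ?_
    rintro ⟨p, q⟩ hpq
    rw [Finset.HasAntidiagonal.mem_antidiagonal] at hpq
    simp only at hpq
    rw [TensorProduct.map_tmul]
    by_cases h : i < p
    · rw [symb_eq_zero_of_lt h ha, TensorProduct.zero_tmul]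
    · rw [symb_eq_zero_of_lt (show j < q by omega) hb, TensorProduct.tmul_zero]
  exact this hu

/-- An identity between linear functions of `symb₂ n u` and of `u`, for `u` in the `n`-th part of
the filtration of `B ⊗ B`, may be checked on pure tensors. -/
theorem symb₂_hom_ext {M : Type*} [AddCommGroup M] [Module k M] {n : ℕ}
    (f : GrAlg hB ⊗[k] GrAlg hB →ₗ[k] M) (g : B ⊗[k] B →ₗ[k] M)
    (h : ∀ i j, i + j = n → ∀ a ∈ coradFilt k B i, ∀ b ∈ coradFilt k B j,
      f (symb hB i a ⊗ₜ symb hB j b) = g (a ⊗ₜ b))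
    {u : B ⊗[k] B} (hu : u ∈ tensorFilt k B n) : f (symb₂ hB n u) = g u := by
  have : tensorFilt k B n ≤ LinearMap.eqLocus (f ∘ₗ symb₂ hB n) g := by
    refine tensorFilt_le fun i j hij a ha b hb => ?_
    rw [LinearMap.mem_eqLocus, LinearMap.comp_apply, symb₂_tmul hij ha hb, h i j hij a ha b hb]
  exact this hu

/-- The two-variable analogue of `symb₂_hom_ext`; it serves both the product and the bracket of the
tensor square. -/
theorem symb₂_bilinear {n m : ℕ}
    (F : GrAlg hB ⊗[k] GrAlg hB →ₗ[k] GrAlg hB ⊗[k] GrAlg hB →ₗ[k] GrAlg hB ⊗[k] GrAlg hB)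
    (f : B ⊗[k] B →ₗ[k] B ⊗[k] B →ₗ[k] B ⊗[k] B)
    (h : ∀ i j, i + j = n → ∀ a ∈ coradFilt k B i, ∀ b ∈ coradFilt k B j,
      ∀ i' j', i' + j' = m → ∀ c ∈ coradFilt k B i', ∀ d ∈ coradFilt k B j',
        F (symb hB i a ⊗ₜ symb hB j b) (symb hB i' c ⊗ₜ symb hB j' d) =
          symb₂ hB (n + m) (f (a ⊗ₜ b) (c ⊗ₜ d)))
    {u v : B ⊗[k] B} (hu : u ∈ tensorFilt k B n) (hv : v ∈ tensorFilt k B m) :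
    F (symb₂ hB n u) (symb₂ hB m v) = symb₂ hB (n + m) (f u v) := by
  have h1 := tensorFilt_bilinear_mem
    (F.compl₁₂ (symb₂ hB n) (symb₂ hB m) - f.compr₂ (symb₂ hB (n + m))) ⊥ ?_ hu hv
  · exact sub_eq_zero.1 h1
  · intro i j hij a ha b hb i' j' hij' c hc d hd
    refine (Submodule.mem_bot k).2 (sub_eq_zero.2 ?_)
    rw [LinearMap.compl₁₂_apply, symb₂_tmul hij ha hb, symb₂_tmul hij' hc hd,
      h i j hij a ha b hb i' j' hij' c hc d hd, LinearMap.compr₂_apply]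

theorem symb₂_mul {n m : ℕ} {u v : B ⊗[k] B} (hu : u ∈ tensorFilt k B n)
    (hv : v ∈ tensorFilt k B m) :
    symb₂ hB n u * symb₂ hB m v = symb₂ hB (n + m) (u * v) := by
  refine symb₂_bilinear (LinearMap.mul k (GrAlg hB ⊗[k] GrAlg hB)) (LinearMap.mul k (B ⊗[k] B))
    ?_ hu hv
  intro i j hij a ha b hb i' j' hij' c hc d hd
  rw [LinearMap.mul_apply', LinearMap.mul_apply', Algebra.TensorProduct.tmul_mul_tmul,
    Algebra.TensorProduct.tmul_mul_tmul, symb_mul_symb ha hc, symb_mul_symb hb hd,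
    symb₂_tmul (by omega) (mul_mem_coradFilt hB ha hc) (mul_mem_coradFilt hB hb hd)]

end GrAlg
end GrAlg

section GrAlg

variable {k : Type v} {B : Type u} [Field k] [CommRing B] [HopfAlgebra k B]

namespace GrAlg

variable {hB : IsPointedCoalgebra k B}

/-! ### The Hopf algebra structure -/

variable (hB) in
/-- The comultiplication of `gr B`. -/
noncomputable def comulL : GrAlg hB →ₗ[k] GrAlg hB ⊗[k] GrAlg hB :=
  desc (fun n => symb₂ hB n ∘ₗ Coalgebra.comul ∘ₗ (coradFilt k B n).subtype) (by
    intro n x hx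
    cases n with
    | zero =>
      have : (x : B) = 0 := by simpa [coradFiltPred] using hx
      simp [this]
    -- In degree n + 1 the elements to be killed are those of B_n; their comultiplication has
    -- filtration degree n, one too low for the symbol.
    | succ n => exact symb₂_eq_zero_of_lt (Nat.lt_succ_self n) (comul_mem_tensorFilt hB hx))

theorem comulL_symb {n : ℕ} {x : B} (hx : x ∈ coradFilt k B n) :
    comulL hB (symb hB n x) = symb₂ hB n (Coalgebra.comul (R := k) x) :=
  desc_symb _ _ hx

variable (hB) in
/-- The counit of `gr B`. -/
noncomputable def counitL : GrAlg hB →ₗ[k] k :=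
  desc (fun n => if n = 0 then Coalgebra.counit ∘ₗ (coradFilt k B n).subtype else 0) (by
    intro n x hx
    cases n with
    | zero =>
      have : (x : B) = 0 := by simpa [coradFiltPred] using hx
      simp [this]
    | succ n => simp)

theorem counitL_symb {n : ℕ} {x : B} (hx : x ∈ coradFilt k B n) :
    counitL hB (symb hB n x) = if n = 0 then Coalgebra.counit (R := k) x else 0 := by
  rw [counitL, desc_symb _ _ hx]
  split_ifs <;> rfl

variable (hB) in
/-- The sum of the maps `Bᵢ ⊗ (Bⱼ ⊗ Bₗ) → C(i) ⊗ (C(j) ⊗ C(l))` with `i + j + l = n`. -/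
noncomputable def symb₃ (n : ℕ) :
    B ⊗[k] (B ⊗[k] B) →ₗ[k] GrAlg hB ⊗[k] (GrAlg hB ⊗[k] GrAlg hB) :=
  ∑ p ∈ Finset.HasAntidiagonal.antidiagonal n, TensorProduct.map (symb hB p.1) (symb₂ hB p.2)

theorem symb₃_tmul {i j n : ℕ} (h : i + j = n) {a : B} {u : B ⊗[k] B} (ha : a ∈ coradFilt k B i)
    (hu : u ∈ tensorFilt k B j) : symb₃ hB n (a ⊗ₜ u) = symb hB i a ⊗ₜ symb₂ hB j u := by
  rw [symb₃, LinearMap.sum_apply, Finset.sum_eq_single (i, j)]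
  · simp
  · rintro ⟨p, q⟩ hpq hne
    rw [Finset.HasAntidiagonal.mem_antidiagonal] at hpq
    rw [TensorProduct.map_tmul]
    rcases lt_trichotomy i p with hlt | rfl | hlt
    · rw [symb_eq_zero_of_lt hlt ha, TensorProduct.zero_tmul]
    · obtain rfl : j = q := by simp only at hpq; omega
      exact absurd rfl hne
    · rw [symb₂_eq_zero_of_lt (show j < q by simp only at hpq; omega) hu, TensorProduct.tmul_zero]
  · intro hn
    exact absurd (Finset.HasAntidiagonal.mem_antidiagonal.2 h) hn

/-- `symb₃` is built from one bracketing of the triple tensor product; this shows that it also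
computes symbols taken in the other bracketing. -/
theorem assoc_symb₂_tmul {i j n : ℕ} (h : i + j = n) {u : B ⊗[k] B} {b : B}
    (hu : u ∈ tensorFilt k B i) (hb : b ∈ coradFilt k B j) :
    TensorProduct.assoc k _ _ _ (symb₂ hB i u ⊗ₜ symb hB j b) =
      symb₃ hB n (TensorProduct.assoc k _ _ _ (u ⊗ₜ b)) := by
  refine symb₂_hom_ext
    ((TensorProduct.assoc k (GrAlg hB) (GrAlg hB) (GrAlg hB)).toLinearMap ∘ₗ
      (TensorProduct.mk k _ _).flip (symb hB j b))
    (symb₃ hB n ∘ₗ (TensorProduct.assoc k B B B).toLinearMap ∘ₗ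
      (TensorProduct.mk k _ _).flip b) ?_ hu
  intro p q hpq a ha a' ha'
  change symb hB p a ⊗ₜ (symb hB q a' ⊗ₜ symb hB j b) = symb₃ hB n (a ⊗ₜ (a' ⊗ₜ b))
  rw [symb₃_tmul (show p + (q + j) = n by omega) ha (tmul_mem_tensorFilt rfl ha' hb),
    symb₂_tmul rfl ha' hb]

/-- Both sides are `symb₃` of degree n applied to the two sides of coassociativity in B. -/
theorem coassoc_symb {n : ℕ} {x : B} (hx : x ∈ coradFilt k B n) :
    TensorProduct.assoc k _ _ _ (LinearMap.rTensor (GrAlg hB) (comulL hB)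
      (comulL hB (symb hB n x))) =
    LinearMap.lTensor (GrAlg hB) (comulL hB) (comulL hB (symb hB n x)) := by
  rw [comulL_symb hx]
  have hΔ := comul_mem_tensorFilt hB hx
  have h1 := symb₂_hom_ext (hB := hB)
    ((TensorProduct.assoc k (GrAlg hB) (GrAlg hB) (GrAlg hB)).toLinearMap ∘ₗ
      LinearMap.rTensor (GrAlg hB) (comulL hB))
    (symb₃ hB n ∘ₗ (TensorProduct.assoc k B B B).toLinearMap ∘ₗ
      LinearMap.rTensor B Coalgebra.comul) (fun i j hij a ha b hb => by
      rw [LinearMap.comp_apply, LinearMap.comp_apply, LinearMap.comp_apply,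
        LinearMap.rTensor_tmul, LinearMap.rTensor_tmul, comulL_symb ha]
      exact assoc_symb₂_tmul hij (comul_mem_tensorFilt hB ha) hb) hΔ
  have h2 := symb₂_hom_ext (hB := hB) (LinearMap.lTensor (GrAlg hB) (comulL hB))
    (symb₃ hB n ∘ₗ LinearMap.lTensor B Coalgebra.comul) (fun i j hij a ha b hb => by
      rw [LinearMap.comp_apply, LinearMap.lTensor_tmul, LinearMap.lTensor_tmul, comulL_symb hb,
        symb₃_tmul hij ha (comul_mem_tensorFilt hB hb)]) hΔ
  refine Eq.trans h1 (Eq.trans ?_ h2.symm)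
  exact congrArg (symb₃ hB n) (Coalgebra.coassoc_apply x)

theorem rTensor_counit_symb {n : ℕ} {x : B} (hx : x ∈ coradFilt k B n) :
    LinearMap.rTensor (GrAlg hB) (counitL hB) (comulL hB (symb hB n x)) = 1 ⊗ₜ symb hB n x := by
  rw [comulL_symb hx]
  refine (symb₂_hom_ext (hB := hB) (LinearMap.rTensor (GrAlg hB) (counitL hB))
    (LinearMap.lTensor k (symb hB n) ∘ₗ LinearMap.rTensor B Coalgebra.counit)
    (fun i j hij a ha b hb => ?_) (comul_mem_tensorFilt hB hx)).trans ?_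
  · rw [LinearMap.rTensor_tmul, LinearMap.comp_apply, LinearMap.rTensor_tmul,
      LinearMap.lTensor_tmul, counitL_symb ha]
    -- For i > 0 the counit of gr B vanishes on the left leg. The counit of B need not, but then b
    -- lies in B_j with j < n and its degree n symbol is zero.
    split_ifs with h0
    · rw [show j = n by omega]
    · rw [symb_eq_zero_of_lt (show j < n by omega) hb, TensorProduct.zero_tmul,
        TensorProduct.tmul_zero]
  · rw [LinearMap.comp_apply, Coalgebra.rTensor_counit_comul, LinearMap.lTensor_tmul]

theorem lTensor_counit_symb {n : ℕ} {x : B} (hx : x ∈ coradFilt k B n) :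
    LinearMap.lTensor (GrAlg hB) (counitL hB) (comulL hB (symb hB n x)) = symb hB n x ⊗ₜ 1 := by
  rw [comulL_symb hx]
  refine (symb₂_hom_ext (hB := hB) (LinearMap.lTensor (GrAlg hB) (counitL hB))
    (LinearMap.rTensor k (symb hB n) ∘ₗ LinearMap.lTensor B Coalgebra.counit)
    (fun i j hij a ha b hb => ?_) (comul_mem_tensorFilt hB hx)).trans ?_
  · rw [LinearMap.lTensor_tmul, LinearMap.comp_apply, LinearMap.lTensor_tmul,
      LinearMap.rTensor_tmul, counitL_symb hb]
    split_ifs with h0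
    · rw [show i = n by omega]
    · rw [symb_eq_zero_of_lt (show i < n by omega) ha, TensorProduct.zero_tmul,
        TensorProduct.tmul_zero]
  · rw [LinearMap.comp_apply, Coalgebra.lTensor_counit_comul, LinearMap.rTensor_tmul]

noncomputable instance : Coalgebra k (GrAlg hB) where
  comul := comulL hB
  counit := counitL hB
  coassoc := hom_ext fun _ _ hx => coassoc_symb hx
  rTensor_counit_comp_comul := hom_ext fun _ _ hx => rTensor_counit_symb hx
  lTensor_counit_comp_comul := hom_ext fun _ _ hx => lTensor_counit_symb hx

theorem comul_symb {n : ℕ} {x : B} (hx : x ∈ coradFilt k B n) :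
    Coalgebra.comul (R := k) (symb hB n x) = symb₂ hB n (Coalgebra.comul (R := k) x) :=
  comulL_symb hx

theorem counit_symb {n : ℕ} {x : B} (hx : x ∈ coradFilt k B n) :
    Coalgebra.counit (R := k) (symb hB n x) = if n = 0 then Coalgebra.counit (R := k) x else 0 :=
  counitL_symb hx

theorem counit_mul (a b : GrAlg hB) : Coalgebra.counit (R := k) (a * b) =
    Coalgebra.counit (R := k) a * Coalgebra.counit (R := k) b := by
  induction a using induction with
  | zero => simp
  | add x y hx hy => rw [add_mul, map_add, map_add, hx, hy, add_mul]
  | symb n x hx =>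
  induction b using induction with
  | zero => simp
  | add x y hx hy => rw [mul_add, map_add, map_add, hx, hy, mul_add]
  | symb m y hy =>
  rw [symb_mul_symb hx hy, counit_symb hx, counit_symb hy, counit_symb (mul_mem_coradFilt hB hx hy)]
  by_cases hn : n = 0 <;> by_cases hm : m = 0 <;> simp [hn, hm]

theorem comul_mul (a b : GrAlg hB) : Coalgebra.comul (R := k) (a * b) =
    Coalgebra.comul (R := k) a * Coalgebra.comul (R := k) b := by
  induction a using induction with
  | zero => simp
  | add x y hx hy => rw [add_mul, map_add, map_add, hx, hy, add_mul]
  | symb n x hx =>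
  induction b using induction with
  | zero => simp
  | add x y hx hy => rw [mul_add, map_add, map_add, hx, hy, mul_add]
  | symb m y hy =>
  rw [symb_mul_symb hx hy, comul_symb hx, comul_symb hy, comul_symb (mul_mem_coradFilt hB hx hy),
    symb₂_mul (comul_mem_tensorFilt hB hx) (comul_mem_tensorFilt hB hy), Bialgebra.comul_mul]

noncomputable instance : Bialgebra k (GrAlg hB) :=
  Bialgebra.mk' k (GrAlg hB)
    (by rw [one_def, counit_symb (one_mem_coradFilt_zero hB)]; simp)
    (counit_mul _ _)
    (by
      rw [one_def, comul_symb (one_mem_coradFilt_zero hB), Bialgebra.comul_one,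
        Algebra.TensorProduct.one_def, symb₂_tmul (add_zero 0) (one_mem_coradFilt_zero hB)
          (one_mem_coradFilt_zero hB)]
      rfl)
    (comul_mul _ _)

variable (hB) in
/-- The antipode of `gr B`. -/
noncomputable def antipodeL : GrAlg hB →ₗ[k] GrAlg hB :=
  desc (fun n => symb hB n ∘ₗ HopfAlgebra.antipode k ∘ₗ (coradFilt k B n).subtype) (by
    intro n x hx
    cases n with
    | zero =>
      have : (x : B) = 0 := by simpa [coradFiltPred] using hx
      simp [this]
    | succ n => exact symb_eq_zero (antipode_mem_coradFilt hB (n := n) hx))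

theorem antipodeL_symb {n : ℕ} {x : B} (hx : x ∈ coradFilt k B n) :
    antipodeL hB (symb hB n x) = symb hB n (HopfAlgebra.antipode k x) :=
  desc_symb _ _ hx

theorem symb_algebraMap (n : ℕ) (c : k) :
    symb hB n (algebraMap k B c) = algebraMap k (GrAlg hB) (if n = 0 then c else 0) := by
  split_ifs with h
  · rw [h, algebraMap_eq]
  · rw [map_zero, Algebra.algebraMap_eq_smul_one, map_smul,
      symb_eq_zero_of_lt (Nat.pos_of_ne_zero h) (one_mem_coradFilt_zero hB), smul_zero]

/-- Each antipode identity is the degree n symbol of the corresponding identity in B, because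
antipode and product commute with symbols; a scalar has nonzero symbol only in degree zero. -/
noncomputable instance : HopfAlgebra k (GrAlg hB) where
  antipode := antipodeL hB
  mul_antipode_rTensor_comul := hom_ext fun n x hx => by
    rw [LinearMap.comp_apply, LinearMap.comp_apply, LinearMap.comp_apply, comul_symb hx,
      counit_symb hx, Algebra.linearMap_apply]
    have h := symb₂_hom_ext (hB := hB)
      (LinearMap.mul' k (GrAlg hB) ∘ₗ LinearMap.rTensor (GrAlg hB) (antipodeL hB))
      (symb hB n ∘ₗ LinearMap.mul' k B ∘ₗ LinearMap.rTensor B (HopfAlgebra.antipode k))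
      (fun i j hij a ha b hb => by
        simp only [LinearMap.comp_apply, LinearMap.rTensor_tmul, LinearMap.mul'_apply]
        rw [antipodeL_symb ha, symb_mul_symb (antipode_mem_coradFilt hB ha) hb, hij])
      (comul_mem_tensorFilt hB hx)
    refine h.trans ?_
    rw [LinearMap.comp_apply, LinearMap.comp_apply, HopfAlgebra.mul_antipode_rTensor_comul_apply,
      symb_algebraMap]
  mul_antipode_lTensor_comul := hom_ext fun n x hx => by
    rw [LinearMap.comp_apply, LinearMap.comp_apply, LinearMap.comp_apply, comul_symb hx,
      counit_symb hx, Algebra.linearMap_apply]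
    have h := symb₂_hom_ext (hB := hB)
      (LinearMap.mul' k (GrAlg hB) ∘ₗ LinearMap.lTensor (GrAlg hB) (antipodeL hB))
      (symb hB n ∘ₗ LinearMap.mul' k B ∘ₗ LinearMap.lTensor B (HopfAlgebra.antipode k))
      (fun i j hij a ha b hb => by
        simp only [LinearMap.comp_apply, LinearMap.lTensor_tmul, LinearMap.mul'_apply]
        rw [antipodeL_symb hb, symb_mul_symb ha (antipode_mem_coradFilt hB hb), hij])
      (comul_mem_tensorFilt hB hx)
    refine h.trans ?_
    rw [LinearMap.comp_apply, LinearMap.comp_apply, HopfAlgebra.mul_antipode_lTensor_comul_apply,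
      symb_algebraMap]

theorem antipode_symb {n : ℕ} {x : B} (hx : x ∈ coradFilt k B n) :
    HopfAlgebra.antipode k (symb hB n x) = symb hB n (HopfAlgebra.antipode k x) :=
  antipodeL_symb hx

/-! ### The Poisson bracket -/

section Bracket

variable {P : PoissonBracket k B} [hP : P.IsPoissonBialgebra]
  (hG : ∀ g t : B, IsGroupLikeElem k g → IsGroupLikeElem k t → P.br g t = 0)

include hG in
theorem br_mem_coradFiltPred (hB : IsPointedCoalgebra k B) {i j : ℕ} {x y : B}
    (hx : x ∈ coradFiltPred k B i) (hy : y ∈ coradFilt k B j) :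
    P.br x y ∈ coradFiltPred k B (i + j) := by
  cases i with
  | zero =>
    obtain rfl : x = 0 := by simpa [coradFiltPred] using hx
    simp
  | succ i =>
    rw [show i + 1 + j = i + j + 1 by omega]
    exact br_mem_coradFilt hB P hG hx hy

variable (hB) in
/-- The bilinear map underlying the Poisson bracket of `gr B`. -/
noncomputable def brL : GrAlg hB →ₗ[k] GrAlg hB →ₗ[k] GrAlg hB :=
  desc₂ (fun i j => P.br.compr₂ (symb hB (i + j)))
    (fun i j x hx y hy => symb_eq_zero (br_mem_coradFiltPred hG hB hx hy))
    (fun i j x hx y hy => symb_eq_zero (by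
      rw [P.br_skew, add_comm]
      exact neg_mem (br_mem_coradFiltPred hG hB hy hx)))

theorem brL_symb {i j : ℕ} {x y : B} (hx : x ∈ coradFilt k B i) (hy : y ∈ coradFilt k B j) :
    brL hB hG (symb hB i x) (symb hB j y) = symb hB (i + j) (P.br x y) :=
  desc₂_symb _ _ _ hx hy

theorem brL_skew (a b : GrAlg hB) : brL hB hG a b = -brL hB hG b a := by
  induction a using induction with
  | zero => simp
  | add x y hx hy => rw [map_add, LinearMap.add_apply, hx, hy, map_add, neg_add]
  | symb n x hx =>
  induction b using induction with
  | zero => simp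
  | add x y hx hy => rw [map_add, hx, hy, map_add, LinearMap.add_apply, neg_add]
  | symb m y hy =>
  rw [brL_symb hG hx hy, brL_symb hG hy hx, P.br_skew, map_neg, add_comm]

theorem brL_jacobi (a b c : GrAlg hB) : brL hB hG a (brL hB hG b c) +
    brL hB hG b (brL hB hG c a) + brL hB hG c (brL hB hG a b) = 0 := by
  induction a using induction with
  | zero => simp
  | add x y hx hy =>
    simp only [map_add, LinearMap.add_apply]
    rw [← add_zero (0 : GrAlg hB)]
    nth_rewrite 1 [← hx]
    rw [← hy]
    abel
  | symb n x hx =>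
  induction b using induction with
  | zero => simp
  | add x y hx hy =>
    simp only [map_add, LinearMap.add_apply]
    rw [← add_zero (0 : GrAlg hB)]
    nth_rewrite 1 [← hx]
    rw [← hy]
    abel
  | symb m y hy =>
  induction c using induction with
  | zero => simp
  | add x y hx hy =>
    simp only [map_add, LinearMap.add_apply]
    rw [← add_zero (0 : GrAlg hB)]
    nth_rewrite 1 [← hx]
    rw [← hy]
    abel
  | symb l z hz =>
  rw [brL_symb hG hx hy, brL_symb hG hy hz, brL_symb hG hz hx,
    brL_symb hG hx (br_mem_coradFilt hB P hG hy hz), brL_symb hG hy (br_mem_coradFilt hB P hG hz hx),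
    brL_symb hG hz (br_mem_coradFilt hB P hG hx hy), show m + (l + n) = n + (m + l) by omega,
    show l + (n + m) = n + (m + l) by omega, ← map_add, ← map_add, P.jacobi, map_zero]

theorem brL_leibniz (a b c : GrAlg hB) :
    brL hB hG a (b * c) = brL hB hG a b * c + b * brL hB hG a c := by
  induction a using induction with
  | zero => simp
  | add x y hx hy => simp only [map_add, LinearMap.add_apply, hx, hy, add_mul, mul_add]; abel
  | symb n x hx =>
  induction b using induction with
  | zero => simp
  | add x y hx hy => simp only [map_add, hx, hy, add_mul]; abel
  | symb m y hy =>
  induction c using induction with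
  | zero => simp
  | add x y hx hy => simp only [map_add, hx, hy, mul_add]; abel
  | symb l z hz =>
  rw [symb_mul_symb hy hz, brL_symb hG hx (mul_mem_coradFilt hB hy hz), brL_symb hG hx hy,
    brL_symb hG hx hz, symb_mul_symb (br_mem_coradFilt hB P hG hx hy) hz,
    symb_mul_symb hy (br_mem_coradFilt hB P hG hx hz), show n + m + l = n + (m + l) by omega,
    show m + (n + l) = n + (m + l) by omega, ← map_add, P.leibniz]

/-- In characteristic 2 this does not follow from skew-symmetry. It is checked on homogeneous
classes, and skew-symmetry cancels the cross terms of a sum. -/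
theorem brL_self (a : GrAlg hB) : brL hB hG a a = 0 := by
  induction a using induction with
  | zero => simp
  | add x y hx hy =>
    simp only [map_add, LinearMap.add_apply, hx, hy]
    rw [brL_skew hG x y]
    simp
  | symb n x hx => rw [brL_symb hG hx hx, P.br_self, map_zero]

variable (hB) in
/-- The Poisson bracket of `gr B`. -/
noncomputable def bracket : PoissonBracket k (GrAlg hB) where
  br := brL hB hG
  br_self := brL_self hG
  jacobi := brL_jacobi hG
  leibniz := brL_leibniz hG

theorem bracket_symb {i j : ℕ} {x y : B} (hx : x ∈ coradFilt k B i) (hy : y ∈ coradFilt k B j) :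
    (bracket hB hG).br (symb hB i x) (symb hB j y) = symb hB (i + j) (P.br x y) :=
  brL_symb hG hx hy

theorem symb₂_tensorBr {n m : ℕ} {u v : B ⊗[k] B} (hu : u ∈ tensorFilt k B n)
    (hv : v ∈ tensorFilt k B m) :
    (bracket hB hG).tensorBr (symb₂ hB n u) (symb₂ hB m v) =
      symb₂ hB (n + m) (P.tensorBr u v) := by
  refine symb₂_bilinear (bracket hB hG).tensorBr P.tensorBr ?_ hu hv
  intro i j hij a ha b hb i' j' hij' c hc d hd
  rw [PoissonBracket.tensorBr_tmul, PoissonBracket.tensorBr_tmul, symb_mul_symb ha hc,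
    symb_mul_symb hb hd, bracket_symb hG ha hc, bracket_symb hG hb hd, map_add,
    symb₂_tmul (by omega) (mul_mem_coradFilt hB ha hc) (br_mem_coradFilt hB P hG hb hd),
    symb₂_tmul (by omega) (br_mem_coradFilt hB P hG ha hc) (mul_mem_coradFilt hB hb hd)]

instance isPoissonBialgebra_bracket : (bracket hB hG).IsPoissonBialgebra where
  comul_br a b := by
    induction a using induction with
    | zero => simp
    | add x y hx hy => simp only [map_add, LinearMap.add_apply, hx, hy]
    | symb n x hx =>
    induction b using induction with
    | zero => simp
    | add x y hx hy => simp only [map_add, hx, hy]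
    | symb m y hy =>
    rw [bracket_symb hG hx hy, comul_symb hx, comul_symb hy,
      comul_symb (br_mem_coradFilt hB P hG hx hy), hP.comul_br,
      symb₂_tensorBr hG (comul_mem_tensorFilt hB hx) (comul_mem_tensorFilt hB hy)]

end Bracket

end GrAlg
end GrAlg

/-! ### The grading, and operations on representatives -/

theorem isInternal_grComponent {k : Type v} {B : Type u} [Field k] [AddCommGroup B] [Module k B]
    [Coalgebra k B] {C : Type u} [AddCommGroup C] [Module k C] (e : Gr k B ≃ₗ[k] C) :
    DirectSum.IsInternal (grComponent e) := by
  let dec : C →ₗ[k] DirectSum ℕ fun n => grComponent e n :=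
    DirectSum.toModule k ℕ _ (fun n => DirectSum.lof k ℕ (fun n => grComponent e n) n ∘ₗ
      LinearMap.rangeRestrict (e.toLinearMap ∘ₗ DirectSum.lof k ℕ (GrPiece k B) n)) ∘ₗ
      e.symm.toLinearMap
  have hdec : ∀ n x, dec (e (DirectSum.lof k ℕ (GrPiece k B) n x)) =
      DirectSum.lof k ℕ (fun n => grComponent e n) n
        ⟨e (DirectSum.lof k ℕ (GrPiece k B) n x), x, rfl⟩ := by
    intro n x
    simp only [dec, LinearMap.comp_apply, LinearEquiv.coe_coe, LinearEquiv.symm_apply_apply,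
      DirectSum.toModule_lof]
    rfl
  have h1 : DirectSum.coeLinearMap (grComponent e) ∘ₗ dec = LinearMap.id := by
    have : DirectSum.coeLinearMap (grComponent e) ∘ₗ dec ∘ₗ e.toLinearMap = e.toLinearMap := by
      refine DirectSum.linearMap_ext k fun n => LinearMap.ext fun x => ?_
      simp only [LinearMap.comp_apply, LinearEquiv.coe_coe, hdec, DirectSum.coeLinearMap_lof]
    ext c
    simpa using LinearMap.congr_fun this (e.symm c)
  have h2 : dec ∘ₗ DirectSum.coeLinearMap (grComponent e) = LinearMap.id := by
    refine DirectSum.linearMap_ext k fun n => LinearMap.ext fun x => ?_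
    obtain ⟨_, x, rfl⟩ := x
    simp only [LinearMap.comp_apply, DirectSum.coeLinearMap_lof, LinearMap.id_apply]
    exact hdec n x
  let := DirectSum.Decomposition.ofLinearMap (grComponent e) dec h1 h2
  exact DirectSum.Decomposition.isInternal (grComponent e)

section GrAlg

variable {k : Type v} {B : Type u} [Field k] [CommRing B] [HopfAlgebra k B]

namespace GrAlg

variable {hB : IsPointedCoalgebra k B}

variable (hB) in
/-- The identification of `gr B` with the carrier of the graded Hopf algebra. -/
noncomputable def equiv : Gr k B ≃ₗ[k] GrAlg hB := LinearEquiv.refl k (Gr k B)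

theorem equiv_grCls (n : ℕ) (a : coradFilt k B n) :
    equiv hB (grCls k B n a) = symb hB n a := (symb_coe a).symm

theorem mem_grComponent {n : ℕ} {c : GrAlg hB} : c ∈ grComponent (equiv hB) n ↔
    ∃ x ∈ coradFilt k B n, symb hB n x = c := by
  constructor
  · rintro ⟨y, rfl⟩
    obtain ⟨x, rfl⟩ := Submodule.mkQ_surjective _ y
    exact ⟨x, x.2, symb_coe x⟩
  · rintro ⟨x, hx, rfl⟩
    rw [symb_eq hx]
    exact ⟨Submodule.mkQ _ ⟨x, hx⟩, rfl⟩

theorem symb_mem_grComponent {n : ℕ} {x : B} (hx : x ∈ coradFilt k B n) :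
    symb hB n x ∈ grComponent (equiv hB) n := mem_grComponent.2 ⟨x, hx, rfl⟩

theorem symb₂_mapIncl {n : ℕ} {p : ℕ × ℕ} (hp : p.1 + p.2 = n)
    (u : coradFilt k B p.1 ⊗[k] coradFilt k B p.2) :
    symb₂ hB n (TensorProduct.mapIncl (coradFilt k B p.1) (coradFilt k B p.2) u) =
      TensorProduct.map ((equiv hB).toLinearMap ∘ₗ grCls k B p.1)
        ((equiv hB).toLinearMap ∘ₗ grCls k B p.2) u := by
  induction u with
  | zero => simp
  | add x y hx hy => simp only [map_add, hx, hy]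
  | tmul a b =>
    rw [TensorProduct.mapIncl, TensorProduct.map_tmul, TensorProduct.map_tmul]
    refine (symb₂_tmul hp a.2 b.2).trans ?_
    rw [← equiv_grCls, ← equiv_grCls]
    rfl

variable {P : PoissonBracket k B} [hP : P.IsPoissonBialgebra]
  (hG : ∀ g t : B, IsGroupLikeElem k g → IsGroupLikeElem k t → P.br g t = 0)

theorem isAssociatedGraded : IsAssociatedGraded P (bracket hB hG) (equiv hB) where
  one := ⟨one_mem_coradFilt_zero hB, equiv_grCls 0 _⟩
  mul i j a b := ⟨mul_mem_coradFilt hB a.2 b.2, by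
    rw [equiv_grCls, equiv_grCls, equiv_grCls, symb_mul_symb a.2 b.2]⟩
  counit n a := by rw [equiv_grCls, counit_symb a.2]
  exists_comul n a := exists_of_mem_tensorFilt (comul_mem_tensorFilt hB a.2)
  comul n a u h := by
    rw [equiv_grCls, comul_symb a.2, h, map_sum]
    exact Finset.sum_congr rfl fun p hp =>
      symb₂_mapIncl (Finset.HasAntidiagonal.mem_antidiagonal.1 hp) (u p)
  antipode n a := ⟨antipode_mem_coradFilt hB a.2, by
    rw [equiv_grCls, equiv_grCls, antipode_symb a.2]⟩
  br i j a b := ⟨br_mem_coradFilt hB P hG a.2 b.2, by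
    rw [equiv_grCls, equiv_grCls, equiv_grCls, bracket_symb hG a.2 b.2]⟩

theorem isGradedPoissonHopf :
    IsGradedPoissonHopf (bracket hB hG) (grComponent (equiv hB)) where
  poisson := inferInstance
  isInternal := isInternal_grComponent _
  one_mem := symb_mem_grComponent (one_mem_coradFilt_zero hB)
  mul_mem i j x hx y hy := by
    obtain ⟨a, ha, rfl⟩ := mem_grComponent.1 hx
    obtain ⟨b, hb, rfl⟩ := mem_grComponent.1 hy
    rw [symb_mul_symb ha hb]
    exact symb_mem_grComponent (mul_mem_coradFilt hB ha hb)
  comul_mem n x hx := by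
    obtain ⟨a, ha, rfl⟩ := mem_grComponent.1 hx
    rw [comul_symb ha]
    have h : tensorFilt k B n ≤ (⨆ p ∈ Finset.HasAntidiagonal.antidiagonal n,
        LinearMap.range (TensorProduct.mapIncl (grComponent (equiv hB) p.1)
          (grComponent (equiv hB) p.2))).comap (symb₂ hB n) := by
      refine tensorFilt_le fun i j hij a ha b hb => ?_
      rw [Submodule.mem_comap, symb₂_tmul hij ha hb]
      refine Submodule.mem_iSup_of_mem (i, j) (Submodule.mem_iSup_of_mem
        (Finset.HasAntidiagonal.mem_antidiagonal.2 hij) ?_)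
      exact ⟨⟨_, symb_mem_grComponent ha⟩ ⊗ₜ ⟨_, symb_mem_grComponent hb⟩, rfl⟩
    exact h (comul_mem_tensorFilt hB ha)
  counit_eq_zero n hn x hx := by
    obtain ⟨a, ha, rfl⟩ := mem_grComponent.1 hx
    rw [counit_symb ha, if_neg hn]
  antipode_mem n x hx := by
    obtain ⟨a, ha, rfl⟩ := mem_grComponent.1 hx
    rw [antipode_symb ha]
    exact symb_mem_grComponent (antipode_mem_coradFilt hB ha)
  br_mem i j x hx y hy := by
    obtain ⟨a, ha, rfl⟩ := mem_grComponent.1 hx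
    obtain ⟨b, hb, rfl⟩ := mem_grComponent.1 hy
    rw [bracket_symb hG ha hb]
    exact symb_mem_grComponent (br_mem_coradFilt hB P hG ha hb)

/-! ### The inclusion of and the projection onto the group algebra -/

variable (hB) in
/-- The map `G → C(0)`. -/
noncomputable def groupLikeHom : GroupLike k B →* GrAlg hB where
  toFun g := symb hB 0 g
  map_one' := rfl
  map_mul' g t := by
    rw [symb_mul_symb (groupLike_mem_coradFilt_zero hB g) (groupLike_mem_coradFilt_zero hB t)]
    rfl

variable (hB) in
/-- The inclusion `kG → gr B`. -/
noncomputable def incl : MonoidAlgebra k (GroupLike k B) →ₐc[k] GrAlg hB :=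
  BialgHom.ofAlgHom (MonoidAlgebra.lift k (GrAlg hB) (GroupLike k B) (groupLikeHom hB))
    (MonoidAlgebra.algHom_ext (fun g => by
      have h := groupLike_mem_coradFilt_zero hB g
      simp [groupLikeHom, counit_symb h]) (by ext))
    (MonoidAlgebra.algHom_ext (fun g => by
      have h := groupLike_mem_coradFilt_zero hB g
      simp [groupLikeHom, comul_symb h, symb₂_tmul (add_zero 0) h h]) (by ext))

theorem incl_single (g : GroupLike k B) :
    incl hB (MonoidAlgebra.single g 1) = symb hB 0 g := by
  change MonoidAlgebra.lift k (GrAlg hB) (GroupLike k B) (groupLikeHom hB) _ = _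
  rw [MonoidAlgebra.lift_single, one_smul]
  rfl

/-- Group-like elements are linearly independent, so kG → B is injective and has a linear left
inverse over a field. -/
theorem exists_groupLike_projection : ∃ f : B →ₗ[k] MonoidAlgebra k (GroupLike k B),
    ∀ g : GroupLike k B, f g = MonoidAlgebra.single g 1 := by
  obtain ⟨f, hf⟩ := LinearMap.exists_leftInverse_of_injective
    (Finsupp.linearCombination k (GroupLike.val (R := k) (A := B)))
    (LinearMap.ker_eq_bot.2 linearIndep_groupLikeVal)
  refine ⟨(MonoidAlgebra.coeffLinearEquiv k).symm.toLinearMap ∘ₗ f, fun g => ?_⟩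
  have := LinearMap.congr_fun hf (Finsupp.single g 1)
  rw [LinearMap.comp_apply, Finsupp.linearCombination_single, one_smul] at this
  rw [LinearMap.comp_apply, this]
  rfl

variable (k B) in
/-- A linear map `B → kG` which is the identity on `G`. -/
noncomputable def groupLikeProj : B →ₗ[k] MonoidAlgebra k (GroupLike k B) :=
  exists_groupLike_projection.choose

theorem groupLikeProj_groupLike (g : GroupLike k B) :
    groupLikeProj k B g = MonoidAlgebra.single g 1 :=
  exists_groupLike_projection.choose_spec g

variable (hB) in
/-- The projection `gr B → kG` as a linear map. -/
noncomputable def projL : GrAlg hB →ₗ[k] MonoidAlgebra k (GroupLike k B) :=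
  desc (fun n => if n = 0 then groupLikeProj k B ∘ₗ (coradFilt k B n).subtype else 0) (by
    intro n x hx
    cases n with
    | zero =>
      have : (x : B) = 0 := by simpa [coradFiltPred] using hx
      simp [this]
    | succ n => simp)

theorem projL_symb {n : ℕ} {x : B} (hx : x ∈ coradFilt k B n) :
    projL hB (symb hB n x) = if n = 0 then groupLikeProj k B x else 0 := by
  rw [projL, desc_symb _ _ hx]
  split_ifs <;> rfl

theorem groupLikeProj_mul (hB : IsPointedCoalgebra k B) {x y : B} (hx : x ∈ coradFilt k B 0)
    (hy : y ∈ coradFilt k B 0) :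
    groupLikeProj k B (x * y) = groupLikeProj k B x * groupLikeProj k B y := by
  induction hx using coradFilt_zero_induction hB with
  | zero => simp
  | add a _ b _ ha hb => rw [add_mul, map_add, map_add, ha, hb, add_mul]
  | smul c a _ ha => rw [smul_mul_assoc, map_smul, map_smul, ha, smul_mul_assoc]
  | groupLike g =>
  induction hy using coradFilt_zero_induction hB with
  | zero => simp
  | add a _ b _ ha hb => rw [mul_add, map_add, map_add, ha, hb, mul_add]
  | smul c a _ ha => rw [mul_smul_comm, map_smul, map_smul, ha, mul_smul_comm]
  | groupLike t =>
  rw [← GroupLike.val_mul, groupLikeProj_groupLike, groupLikeProj_groupLike,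
    groupLikeProj_groupLike, MonoidAlgebra.single_mul_single, one_mul]

theorem projL_mul (a b : GrAlg hB) : projL hB (a * b) = projL hB a * projL hB b := by
  induction a using induction with
  | zero => simp
  | add x y hx hy => rw [add_mul, map_add, map_add, hx, hy, add_mul]
  | symb n x hx =>
  induction b using induction with
  | zero => simp
  | add x y hx hy => rw [mul_add, map_add, map_add, hx, hy, mul_add]
  | symb m y hy =>
  rw [symb_mul_symb hx hy, projL_symb hx, projL_symb hy, projL_symb (mul_mem_coradFilt hB hx hy)]
  by_cases hn : n = 0
  · by_cases hm : m = 0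
    · subst hn hm
      simpa using groupLikeProj_mul hB hx hy
    · simp [hm]
  · simp [hn]

variable (hB) in
/-- The projection `gr B → kG` as an algebra map. -/
noncomputable def projA : GrAlg hB →ₐ[k] MonoidAlgebra k (GroupLike k B) :=
  AlgHom.ofLinearMap (projL hB)
    (by
      rw [one_def, projL_symb (one_mem_coradFilt_zero hB), if_pos rfl, ← GroupLike.val_one (R := k),
        groupLikeProj_groupLike]
      rfl)
    projL_mul

theorem projA_symb {n : ℕ} {x : B} (hx : x ∈ coradFilt k B n) :
    projA hB (symb hB n x) = if n = 0 then groupLikeProj k B x else 0 :=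
  projL_symb hx

theorem projA_groupLike (g : GroupLike k B) :
    projA hB (symb hB 0 g) = MonoidAlgebra.single g 1 := by
  rw [projA_symb (groupLike_mem_coradFilt_zero hB g), if_pos rfl, groupLikeProj_groupLike]

theorem counit_projA (c : GrAlg hB) :
    Coalgebra.counit (R := k) (projA hB c) = Coalgebra.counit (R := k) c := by
  induction c using induction with
  | zero => simp
  | add x y hx hy => rw [map_add, map_add, map_add, hx, hy]
  | symb n x hx =>
  cases n with
  | succ n => rw [projA_symb hx, counit_symb hx]; simp
  | zero =>
  induction hx using coradFilt_zero_induction hB with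
  | zero => simp
  | add a _ b _ ha hb => rw [map_add, map_add, map_add, map_add, ha, hb]
  | smul c a _ ha => rw [map_smul, map_smul, map_smul, map_smul, ha]
  | groupLike g =>
  rw [projA_groupLike, counit_symb (groupLike_mem_coradFilt_zero hB g)]
  simp

/-- In positive degree every term of the symbol of Δx has a tensor factor of positive degree, which
the projection kills. Degree zero is checked on group-likes. -/
theorem comul_projA (c : GrAlg hB) :
    TensorProduct.map (projA hB).toLinearMap (projA hB).toLinearMap
      (Coalgebra.comul (R := k) c) = Coalgebra.comul (R := k) (projA hB c) := by
  induction c using induction with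
  | zero => simp
  | add x y hx hy => simp only [map_add, hx, hy]
  | symb n x hx =>
  cases n with
  | succ n =>
    rw [projA_symb hx, if_neg (Nat.succ_ne_zero n), map_zero, comul_symb hx]
    refine (symb₂_hom_ext (hB := hB) _ 0 (fun i j hij a ha b hb => ?_)
      (comul_mem_tensorFilt hB hx)).trans rfl
    rw [TensorProduct.map_tmul, AlgHom.toLinearMap_apply, AlgHom.toLinearMap_apply,
      projA_symb ha, projA_symb hb, LinearMap.zero_apply]
    by_cases hi : i = 0
    · rw [if_neg (show ¬ j = 0 by omega), TensorProduct.tmul_zero]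
    · rw [if_neg hi, TensorProduct.zero_tmul]
  | zero =>
  induction hx using coradFilt_zero_induction hB with
  | zero => simp
  | add a _ b _ ha hb => simp only [map_add, ha, hb]
  | smul c a _ ha => simp only [map_smul, ha]
  | groupLike g =>
  have h := groupLike_mem_coradFilt_zero hB g
  rw [projA_groupLike, comul_symb h, IsGroupLikeElem.comul_eq_tmul_self g.2,
    symb₂_tmul (add_zero 0) h h, TensorProduct.map_tmul, AlgHom.toLinearMap_apply, projA_groupLike,
    IsGroupLikeElem.comul_eq_tmul_self (MonoidAlgebra.isGroupLikeElem_single_one g)]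

variable (hB) in
/-- The projection `gr B → kG`. -/
noncomputable def proj : GrAlg hB →ₐc[k] MonoidAlgebra k (GroupLike k B) :=
  BialgHom.ofAlgHom (projA hB) (AlgHom.ext counit_projA) (AlgHom.ext comul_projA)

theorem proj_apply (c : GrAlg hB) : proj hB c = projA hB c := rfl

theorem proj_incl (x : MonoidAlgebra k (GroupLike k B)) : proj hB (incl hB x) = x := by
  induction x using MonoidAlgebra.induction_on with
  | of g =>
    rw [MonoidAlgebra.of_apply, incl_single, proj_apply, projA_groupLike]
  | add x y hx hy => rw [map_add, map_add, hx, hy]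
  | smul r x hx => rw [map_smul, map_smul, hx]

theorem proj_eq_zero {n : ℕ} (hn : n ≠ 0) {c : GrAlg hB} (hc : c ∈ grComponent (equiv hB) n) :
    proj hB c = 0 := by
  obtain ⟨a, ha, rfl⟩ := mem_grComponent.1 hc
  rw [proj_apply, projA_symb ha, if_neg hn]

theorem incl_isHom : (PoissonBracket.trivial k (MonoidAlgebra k (GroupLike k B))).IsHom
    (bracket hB hG) (incl hB : MonoidAlgebra k (GroupLike k B) →ₐ[k] GrAlg hB) := by
  intro x y
  change incl hB 0 = (bracket hB hG).br (incl hB x) (incl hB y)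
  rw [map_zero]
  symm
  induction x using MonoidAlgebra.induction_on with
  | of g =>
    induction y using MonoidAlgebra.induction_on with
    | of t =>
      rw [MonoidAlgebra.of_apply, MonoidAlgebra.of_apply, incl_single, incl_single,
        bracket_symb hG (groupLike_mem_coradFilt_zero hB g) (groupLike_mem_coradFilt_zero hB t),
        hG g t g.2 t.2, map_zero]
    | add x y hx hy => rw [map_add, map_add, hx, hy, add_zero]
    | smul r x hx => rw [map_smul, map_smul, hx, smul_zero]
  | add x y hx hy => rw [map_add, map_add, LinearMap.add_apply, hx, hy, add_zero]
  | smul r x hx => rw [map_smul, map_smul, LinearMap.smul_apply, hx, smul_zero]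

/-- The projection sees only the degree zero part of a bracket. That part comes from two elements of
B_0, whose bracket vanishes. -/
theorem proj_isHom : (bracket hB hG).IsHom
    (PoissonBracket.trivial k (MonoidAlgebra k (GroupLike k B)))
    (proj hB : GrAlg hB →ₐ[k] MonoidAlgebra k (GroupLike k B)) := by
  intro a b
  change projA hB ((bracket hB hG).br a b) = 0
  induction a using induction with
  | zero => simp
  | add x y hx hy => rw [map_add, LinearMap.add_apply, map_add, hx, hy, add_zero]
  | symb n x hx =>
  induction b using induction with
  | zero => simp
  | add x y hx hy => rw [map_add, map_add, hx, hy, add_zero]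
  | symb m y hy =>
  rw [bracket_symb hG hx hy, projA_symb (br_mem_coradFilt hB P hG hx hy)]
  split_ifs with h
  · obtain ⟨rfl, rfl⟩ : n = 0 ∧ m = 0 := by omega
    rw [br_eq_zero_of_mem_zero hB P hG hx hy, map_zero]
  · rfl

end GrAlg
end GrAlg

/-! ### The convolution group of algebra maps -/

section Convolution

open WithConv

variable {k : Type v} [Field k]

/-- The convolution product of algebra maps. -/
noncomputable def algConv {C D : Type*} [CommRing C] [Bialgebra k C] [CommRing D] [Algebra k D]
    (f g : C →ₐ[k] D) : C →ₐ[k] D := (toConv f * toConv g).ofConv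

section Bialgebra

variable {C D : Type*} [CommRing C] [Bialgebra k C] [CommRing D] [Algebra k D]

theorem algConv_apply (f g : C →ₐ[k] D) (c : C) : algConv f g c =
    Algebra.TensorProduct.productMap f g (Coalgebra.comul (R := k) c) :=
  AlgHom.convMul_apply _ _ _

theorem comp_algConv {D' : Type*} [CommRing D'] [Algebra k D'] (h : D →ₐ[k] D')
    (f g : C →ₐ[k] D) : h.comp (algConv f g) = algConv (h.comp f) (h.comp g) :=
  AlgHom.comp_convMul_distrib h (toConv f) (toConv g)

theorem algConv_comp {C' : Type*} [CommRing C'] [Bialgebra k C'] (f g : C →ₐ[k] D)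
    (h : C' →ₐc[k] C) : (algConv f g).comp (h : C' →ₐ[k] C) =
      algConv (f.comp (h : C' →ₐ[k] C)) (g.comp (h : C' →ₐ[k] C)) :=
  AlgHom.convMul_comp_bialgHom_distrib (toConv f) (toConv g) h

theorem algConv_assoc (f g h : C →ₐ[k] D) :
    algConv (algConv f g) h = algConv f (algConv g h) :=
  congrArg WithConv.ofConv (mul_assoc (toConv f) (toConv g) (toConv h))

/-- The unit of the convolution product. -/
noncomputable def algConvOne (k : Type v) [Field k] (C D : Type*) [CommRing C] [Bialgebra k C]
    [CommRing D] [Algebra k D] : C →ₐ[k] D :=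
  (Algebra.ofId k D).comp (Bialgebra.counitAlgHom k C)

theorem algConvOne_algConv (f : C →ₐ[k] D) : algConv (algConvOne k C D) f = f :=
  congrArg WithConv.ofConv (one_mul (toConv f))

theorem algConv_algConvOne (f : C →ₐ[k] D) : algConv f (algConvOne k C D) = f :=
  congrArg WithConv.ofConv (mul_one (toConv f))

/-- Writing (f ⊗ g)Δ as a convolution product turns identities between coactions and
comultiplications into computations in a group. -/
theorem algConv_includeLeft_includeRight {D' : Type*} [CommRing D'] [Algebra k D']
    (f : C →ₐ[k] D) (g : C →ₐ[k] D') :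
    algConv (Algebra.TensorProduct.includeLeft.comp f) (Algebra.TensorProduct.includeRight.comp g) =
      (Algebra.TensorProduct.map f g).comp (Bialgebra.comulAlgHom k C) := by
  ext c
  rw [algConv_apply, AlgHom.comp_apply, Bialgebra.comulAlgHom_apply]
  generalize Coalgebra.comul (R := k) c = u
  induction u with
  | zero => simp
  | add u v hu hv => simp only [map_add, hu, hv]
  | tmul a b => simp

end Bialgebra

variable {C D : Type*} [CommRing C] [HopfAlgebra k C] [CommRing D] [Algebra k D]

/-- The convolution inverse of an algebra map. -/
noncomputable def algConvInv (f : C →ₐ[k] D) : C →ₐ[k] D :=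
  f.comp (HopfAlgebra.antipodeAlgHom k C)

theorem comp_algConvInv {D' : Type*} [CommRing D'] [Algebra k D'] (h : D →ₐ[k] D')
    (f : C →ₐ[k] D) : h.comp (algConvInv f) = algConvInv (h.comp f) := rfl

theorem algConvInv_algConv_self (f : C →ₐ[k] D) :
    algConv (algConvInv f) f = algConvOne k C D := by
  have h1 : algConv (algConvInv (AlgHom.id k C)) (AlgHom.id k C) = algConvOne k C C :=
    congrArg WithConv.ofConv AlgHom.antipode_id_cancel
  have h2 := congrArg f.comp h1
  rw [comp_algConv, comp_algConvInv, AlgHom.comp_id] at h2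
  refine h2.trans ?_
  ext c
  simp [algConvOne, Algebra.ofId_apply]

theorem algConv_algConvInv_self (f : C →ₐ[k] D) :
    algConv f (algConvInv f) = algConvOne k C D := by
  ext c
  rw [algConv_apply]
  have h : ∀ u : C ⊗[k] C, Algebra.TensorProduct.productMap f (algConvInv f) u =
      f (LinearMap.mul' k C (LinearMap.lTensor C (HopfAlgebra.antipode k) u)) := by
    intro u
    induction u with
    | zero => simp
    | add u v hu hv => simp only [map_add, hu, hv]
    | tmul a b => simp [algConvInv]
  rw [h, HopfAlgebra.mul_antipode_lTensor_comul_apply]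
  simp [algConvOne, Algebra.ofId_apply]

theorem algConvInv_algConv (f g : C →ₐ[k] D) :
    algConvInv (algConv f g) = algConv (algConvInv g) (algConvInv f) := by
  have h : algConv (algConv f g) (algConv (algConvInv g) (algConvInv f)) = algConvOne k C D := by
    rw [algConv_assoc, ← algConv_assoc g, algConv_algConvInv_self, algConvOne_algConv,
      algConv_algConvInv_self]
  have h2 := congrArg (algConv (algConvInv (algConv f g))) h
  rw [← algConv_assoc, algConvInv_algConv_self, algConvOne_algConv, algConv_algConvOne] at h2
  exact h2.symm

end Convolution

/-! ### Radford's projection and the biproduct decomposition -/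

section Radford

variable {k : Type v} [Field k] {C : Type u} [CommRing C] [HopfAlgebra k C]
  {H : Type w} [CommRing H] [Bialgebra k H] (ι : H →ₐc[k] C) (π : C →ₐc[k] H)

namespace Radford

/-- The projection `c ↦ ∑ c₁ ιπS(c₂)` onto the coinvariants. -/
noncomputable def coinvProj : C →ₐ[k] C :=
  algConv (AlgHom.id k C) (algConvInv ((ι : H →ₐ[k] C).comp (π : C →ₐ[k] H)))

/-- The coaction `(id ⊗ π) Δ`. -/
noncomputable def coact : C →ₐ[k] C ⊗[k] H :=
  (Algebra.TensorProduct.map (AlgHom.id k C) (π : C →ₐ[k] H)).comp (Bialgebra.comulAlgHom k C)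

variable {π} in
theorem mem_rightCoinvariants {x : C} : x ∈ rightCoinvariants (π : C →ₐ[k] H) ↔
    coact π x = x ⊗ₜ 1 := Iff.rfl

theorem coact_eq_algConv : coact π = algConv Algebra.TensorProduct.includeLeft
    (Algebra.TensorProduct.includeRight.comp (π : C →ₐ[k] H)) := by
  rw [coact, ← algConv_includeLeft_includeRight, AlgHom.comp_id]

theorem coinvProj_algConv : algConv (coinvProj ι π)
    ((ι : H →ₐ[k] C).comp (π : C →ₐ[k] H)) = AlgHom.id k C := by
  rw [coinvProj, algConv_assoc, algConvInv_algConv_self, algConv_algConvOne]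

variable {ι π}

/-- Let λ and ρ be the two inclusions into C ⊗ H. The coaction is λ * ρπ and, as πι = id, its
composite with ιπ is λιπ * ρπ. Hence the coaction after E is λ * ρπ * (ρπ)⁻¹ * (λιπ)⁻¹ = λE. -/
theorem coinvProj_mem (hπι : ∀ x, π (ι x) = x) (c : C) :
    coinvProj ι π c ∈ rightCoinvariants (π : C →ₐ[k] H) := by
  rw [mem_rightCoinvariants]
  refine DFunLike.congr_fun (?_ : (coact π).comp (coinvProj ι π) =
    Algebra.TensorProduct.includeLeft.comp (coinvProj ι π)) c
  have h1 : (coact π).comp ((ι : H →ₐ[k] C).comp (π : C →ₐ[k] H)) =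
      algConv (Algebra.TensorProduct.includeLeft.comp ((ι : H →ₐ[k] C).comp (π : C →ₐ[k] H)))
        (Algebra.TensorProduct.includeRight.comp (π : C →ₐ[k] H)) := by
    rw [coact_eq_algConv]
    refine (algConv_comp (D := C ⊗[k] H) Algebra.TensorProduct.includeLeft
      (Algebra.TensorProduct.includeRight.comp (π : C →ₐ[k] H)) (ι.comp π)).trans ?_
    congr 1
    ext c
    simp [hπι]
  rw [coinvProj, comp_algConv, comp_algConv, comp_algConvInv, h1, AlgHom.comp_id, AlgHom.comp_id,
    comp_algConvInv, algConvInv_algConv, coact_eq_algConv, algConv_assoc,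
    ← algConv_assoc _ (algConvInv _), algConv_algConvInv_self, algConvOne_algConv]

/-- The identity E * ιπ = id factors through the coaction, and a coinvariant r has coaction r ⊗ 1.
-/
theorem coinvProj_eq_self {r : C} (hr : r ∈ rightCoinvariants (π : C →ₐ[k] H)) :
    coinvProj ι π r = r := by
  have h1 : (Algebra.TensorProduct.productMap (coinvProj ι π) (ι : H →ₐ[k] C)).comp (coact π) =
      AlgHom.id k C := by
    rw [coact_eq_algConv, comp_algConv, ← coinvProj_algConv ι π]
    congr 1
    · ext; simp
    · ext; simp
  have h2 := DFunLike.congr_fun h1 r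
  rw [AlgHom.comp_apply, mem_rightCoinvariants.1 hr] at h2
  simpa using h2

-- This expresses Δ(R) ⊆ C ⊗ R. The map c ⊗ h ↦ (id ⊗ E)Δ(c) (1 ⊗ ι(h)) composed with the coaction
-- is Δ, because E * ιπ = id; on a coinvariant the factor ι(h) is 1.
variable (ι π) in
theorem lTensor_coinvProj_comul {r : C} (hr : r ∈ rightCoinvariants (π : C →ₐ[k] H)) :
    Algebra.TensorProduct.map (AlgHom.id k C) (coinvProj ι π) (Coalgebra.comul (R := k) r) =
      Coalgebra.comul (R := k) r := by
  let Ψ : C ⊗[k] H →ₐ[k] C ⊗[k] C := Algebra.TensorProduct.productMap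
    ((Algebra.TensorProduct.map (AlgHom.id k C) (coinvProj ι π)).comp (Bialgebra.comulAlgHom k C))
    (Algebra.TensorProduct.includeRight.comp (ι : H →ₐ[k] C))
  have h1 : Ψ.comp (coact π) = Bialgebra.comulAlgHom k C := by
    have e1 : Ψ.comp Algebra.TensorProduct.includeLeft = algConv Algebra.TensorProduct.includeLeft
        (Algebra.TensorProduct.includeRight.comp (coinvProj ι π)) := by
      refine Eq.trans ?_ (algConv_includeLeft_includeRight (AlgHom.id k C) (coinvProj ι π)).symm
      exact Algebra.TensorProduct.productMap_left _ _
    have e2 : Ψ.comp (Algebra.TensorProduct.includeRight.comp (π : C →ₐ[k] H)) =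
        Algebra.TensorProduct.includeRight.comp ((ι : H →ₐ[k] C).comp (π : C →ₐ[k] H)) := by
      rw [← AlgHom.comp_assoc]
      exact congrArg (fun f : H →ₐ[k] C ⊗[k] C => f.comp (π : C →ₐ[k] H))
        (Algebra.TensorProduct.productMap_right _ _)
    rw [coact_eq_algConv, comp_algConv, e1, e2, algConv_assoc, ← comp_algConv, coinvProj_algConv]
    refine (algConv_includeLeft_includeRight (AlgHom.id k C) (AlgHom.id k C)).trans ?_
    rw [Algebra.TensorProduct.map_id, AlgHom.id_comp]
  have h2 := DFunLike.congr_fun h1 r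
  rw [AlgHom.comp_apply, mem_rightCoinvariants.1 hr] at h2
  simpa [Ψ, ← Algebra.TensorProduct.one_def] using h2

/-- The projection onto the coinvariants, as a map to the subalgebra of coinvariants. -/
noncomputable def coinvProj' (hπι : ∀ x, π (ι x) = x) :
    C →ₐ[k] rightCoinvariants (π : C →ₐ[k] H) :=
  (coinvProj ι π).codRestrict _ (coinvProj_mem hπι)

theorem coe_coinvProj' (hπι : ∀ x, π (ι x) = x) (c : C) :
    (coinvProj' hπι c : C) = coinvProj ι π c := rfl

theorem coinvProj'_coe (hπι : ∀ x, π (ι x) = x) (r : rightCoinvariants (π : C →ₐ[k] H)) :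
    coinvProj' hπι (r : C) = r := Subtype.ext (coinvProj_eq_self r.2)

/-- Since πι = id, restricting E = id * (ιπ)⁻¹ along ι gives ι times its convolution inverse. -/
theorem coinvProj'_comp_inclusion (hπι : ∀ x, π (ι x) = x) :
    (coinvProj' hπι).comp (ι : H →ₐ[k] C) =
      algConvOne k H (rightCoinvariants (π : C →ₐ[k] H)) := by
  have h1 : (coinvProj ι π).comp (ι : H →ₐ[k] C) = algConvOne k H C := by
    have e1 := congrArg (fun f : C →ₐ[k] C => f.comp (ι : H →ₐ[k] C))
      (algConv_algConvInv_self ((ι : H →ₐ[k] C).comp (π : C →ₐ[k] H)))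
    simp only [algConv_comp] at e1
    rw [coinvProj, algConv_comp, AlgHom.id_comp]
    have e2 : ((ι : H →ₐ[k] C).comp (π : C →ₐ[k] H)).comp (ι : H →ₐ[k] C) =
        (ι : H →ₐ[k] C) := by
      ext x
      simp [hπι]
    rw [e2] at e1
    rw [e1]
    ext x
    simp [algConvOne, Algebra.ofId_apply]
  ext x
  have h2 := DFunLike.congr_fun h1 x
  exact h2

/-- The inverse is (E ⊗ π)Δ. One composite is E * ιπ = id; the other is checked separately on R,
where E is the identity, and on H, where Eι is trivial. -/
theorem productMap_bijective (hπι : ∀ x, π (ι x) = x) :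
    Function.Bijective (Algebra.TensorProduct.productMap
      (rightCoinvariants (π : C →ₐ[k] H)).val (ι : H →ₐ[k] C)) := by
  let Θ : C →ₐ[k] rightCoinvariants (π : C →ₐ[k] H) ⊗[k] H :=
    (Algebra.TensorProduct.map (coinvProj' hπι) (π : C →ₐ[k] H)).comp (Bialgebra.comulAlgHom k C)
  have h1 : (Algebra.TensorProduct.productMap (rightCoinvariants (π : C →ₐ[k] H)).val
      (ι : H →ₐ[k] C)).comp Θ = AlgHom.id k C := by
    simp only [Θ]
    rw [← algConv_includeLeft_includeRight, comp_algConv, ← coinvProj_algConv ι π]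
    congr 1
    · ext; simp [coe_coinvProj']
    · ext; simp
  have h2 : Θ.comp (Algebra.TensorProduct.productMap (rightCoinvariants (π : C →ₐ[k] H)).val
      (ι : H →ₐ[k] C)) = AlgHom.id k _ := by
    refine Algebra.TensorProduct.ext ?_ ?_
    · ext r
      have e1 : Θ = (Algebra.TensorProduct.map (coinvProj' hπι) (AlgHom.id k H)).comp
          (coact π) := by
        rw [coact, ← AlgHom.comp_assoc, ← Algebra.TensorProduct.map_comp, AlgHom.comp_id,
          AlgHom.id_comp]
      have e2 : Θ (r : C) = r ⊗ₜ 1 := by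
        rw [e1, AlgHom.comp_apply, mem_rightCoinvariants.1 r.2, Algebra.TensorProduct.map_tmul,
          coinvProj'_coe, map_one]
      simpa using e2
    · have e1 : Θ.comp (ι : H →ₐ[k] C) = Algebra.TensorProduct.includeRight := by
        simp only [Θ]
        rw [← algConv_includeLeft_includeRight, algConv_comp, AlgHom.comp_assoc,
          coinvProj'_comp_inclusion, AlgHom.comp_assoc]
        have e3 : (π : C →ₐ[k] H).comp (ι : H →ₐ[k] C) = AlgHom.id k H := by
          ext x
          exact hπι x
        rw [e3, AlgHom.comp_id]
        refine Eq.trans ?_ (algConvOne_algConv _)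
        congr 1
      ext x
      simpa using DFunLike.congr_fun e1 x
  refine ⟨Function.LeftInverse.injective (g := Θ) fun x => DFunLike.congr_fun h2 x,
    Function.RightInverse.surjective (g := Θ) fun x => DFunLike.congr_fun h1 x⟩

theorem isBiproduct (hπι : ∀ x, π (ι x) = x) : IsBiproduct ι π where
  bijective := productMap_bijective hπι
  comul := by
    let R := rightCoinvariants (π : C →ₐ[k] H)
    let E' : C →ₐ[k] R := coinvProj' hπι
    let ρ : C →ₐ[k] H ⊗[k] R :=
      (Algebra.TensorProduct.map (π : C →ₐ[k] H) E').comp (Bialgebra.comulAlgHom k C)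
    let δ : C →ₐ[k] R ⊗[k] R :=
      (Algebra.TensorProduct.map E' E').comp (Bialgebra.comulAlgHom k C)
    -- The witnesses are (π ⊗ E)Δ and (E ⊗ E)Δ on R. The factor E on the right leg only corestricts
    -- to R, since Δ(R) ⊆ C ⊗ R.
    refine ⟨(ρ.comp R.val).toLinearMap, (δ.comp R.val).toLinearMap, fun r => ?_, fun r => ?_,
      fun r x => ?_⟩
    · have h : ∀ u : C ⊗[k] C, LinearMap.lTensor H R.val.toLinearMap
          (Algebra.TensorProduct.map (π : C →ₐ[k] H) E' u) =
          LinearMap.rTensor C (π : C →ₐ[k] H).toLinearMap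
            (Algebra.TensorProduct.map (AlgHom.id k C) (coinvProj ι π) u) := by
        intro u
        induction u with
        | zero => simp
        | add u v hu hv => simp only [map_add, hu, hv]
        | tmul a b => rfl
      refine (h _).trans ?_
      exact congrArg _ (lTensor_coinvProj_comul ι π r.2)
    · have h : ∀ u : C ⊗[k] C, TensorProduct.map R.val.toLinearMap R.val.toLinearMap
          (Algebra.TensorProduct.map E' E' u) =
          LinearMap.rTensor C (coinvProj ι π).toLinearMap
            (Algebra.TensorProduct.map (AlgHom.id k C) (coinvProj ι π) u) := by
        intro u
        induction u with
        | zero => simp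
        | add u v hu hv => simp only [map_add, hu, hv]
        | tmul a b => rfl
      refine (h _).trans ?_
      refine (congrArg _ (lTensor_coinvProj_comul ι π r.2)).trans ?_
      congr 2
    · rw [Bialgebra.comul_mul]
      congr 1
      · let G : C →ₐ[k] C ⊗[k] C := (Algebra.TensorProduct.map
          ((ι : H →ₐ[k] C).comp (π : C →ₐ[k] H)) (coinvProj ι π)).comp
            (Bialgebra.comulAlgHom k C)
        let F : C ⊗[k] C →ₐ[k] C ⊗[k] C := Algebra.TensorProduct.productMap
          (Algebra.TensorProduct.includeLeft.comp (coinvProj ι π)) G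
        -- With λ, ρ now the inclusions into C ⊗ C, this is λE * (λιπ * ρE) = λ(E * ιπ) * ρE = λ *
        -- ρE.
        have hF : F.comp (Bialgebra.comulAlgHom k C) =
            (Algebra.TensorProduct.map (AlgHom.id k C) (coinvProj ι π)).comp
              (Bialgebra.comulAlgHom k C) := by
          have e1 : F.comp (Bialgebra.comulAlgHom k C) =
              algConv (Algebra.TensorProduct.includeLeft.comp (coinvProj ι π)) G := by
            ext c
            rw [algConv_apply]
            rfl
          rw [e1]
          simp only [G]
          rw [← algConv_includeLeft_includeRight, ← algConv_assoc, ← comp_algConv,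
            coinvProj_algConv, algConv_includeLeft_includeRight]
        let L : R ⊗[k] (H ⊗[k] R) →ₗ[k] C ⊗[k] C := TensorProduct.map
          (Algebra.TensorProduct.productMap R.val (ι : H →ₐ[k] C)).toLinearMap
          R.val.toLinearMap ∘ₗ (TensorProduct.assoc k R H R).symm.toLinearMap
        have hL : ∀ a : C, L ∘ₗ TensorProduct.mk k R (H ⊗[k] R) (E' a) ∘ₗ
            (Algebra.TensorProduct.map (π : C →ₐ[k] H) E').toLinearMap =
            LinearMap.mulLeft k (coinvProj ι π a ⊗ₜ 1) ∘ₗ (Algebra.TensorProduct.map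
              ((ι : H →ₐ[k] C).comp (π : C →ₐ[k] H)) (coinvProj ι π)).toLinearMap := by
          intro a
          refine TensorProduct.ext' fun p q => ?_
          change (coinvProj ι π a * ι (π p)) ⊗ₜ[k] coinvProj ι π q =
            (coinvProj ι π a ⊗ₜ[k] 1) * (ι (π p) ⊗ₜ[k] coinvProj ι π q)
          rw [Algebra.TensorProduct.tmul_mul_tmul, one_mul]
        have h' : L ∘ₗ LinearMap.lTensor R (ρ.comp R.val).toLinearMap ∘ₗ
            (Algebra.TensorProduct.map E' E').toLinearMap =
            F.toLinearMap ∘ₗ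
              (Algebra.TensorProduct.map (AlgHom.id k C) (coinvProj ι π)).toLinearMap :=
          TensorProduct.ext' fun a b =>
            (LinearMap.congr_fun (hL a) (Coalgebra.comul (R := k) (coinvProj ι π b)))
        have h := LinearMap.congr_fun h'
        refine Eq.trans ?_ (h (Coalgebra.comul (R := k) (r : C))).symm
        refine Eq.trans ?_ (congrArg F (lTensor_coinvProj_comul ι π r.2)).symm
        refine Eq.trans ?_ (DFunLike.congr_fun hF (r : C)).symm
        exact (lTensor_coinvProj_comul ι π r.2).symm
      · exact (CoalgHomClass.map_comp_comul_apply ι x).symm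

end Radford
end Radford

/-! ### Enveloping algebras: induction and derivations -/

namespace PoissonBracket

namespace Env

section Induction

variable {k : Type v} {A : Type u} [CommRing k] [CommRing A] [Algebra k A]
  {P : PoissonBracket k A}

theorem mk_surjective : Function.Surjective (mk P) := RingQuot.mkAlgHom_surjective k (EnvRel P)

theorem induction {p : Env P → Prop} (algebraMap : ∀ c : k, p (algebraMap k (Env P) c))
    (m : ∀ x, p (m P x)) (h : ∀ x, p (h P x)) (mul : ∀ a b, p a → p b → p (a * b))
    (add : ∀ a b, p a → p b → p (a + b)) (a : Env P) : p a := by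
  obtain ⟨y, rfl⟩ := mk_surjective a
  induction y using FreeAlgebra.induction with
  | grade0 c =>
    rw [AlgHom.commutes]
    exact algebraMap c
  | grade1 x =>
    cases x with
    | inl x => exact m x
    | inr x => exact h x
  | mul a b ha hb =>
    rw [map_mul]
    exact mul _ _ ha hb
  | add a b ha hb =>
    rw [map_add]
    exact add _ _ ha hb

theorem h_one : h P 1 = 0 := by
  have := h_mul P 1 1
  rw [mul_one, map_one (m P), one_mul] at this
  simpa using this

theorem m_mul_m_comm (x y : A) : m P x * m P y = m P y * m P x := by
  rw [← map_mul, mul_comm, map_mul]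

theorem h_mul_m (x y : A) : h P x * m P y = m P y * h P x + m P (P.br x y) := by
  rw [m_br]
  abel

theorem h_mul_h (x y : A) : h P x * h P y = h P y * h P x + h P (P.br x y) := by
  rw [h_br]
  abel

end Induction

section Derivation

variable {k : Type v} {A : Type u} [CommRing k] [CommRing A] [Algebra k A]
  {P : PoissonBracket k A}

open TrivSqZeroExt in
/-- The algebra map `a ↦ a + δ(a) ε` for the derivation `δ` of `A^e` induced by a Poisson
derivation `d` of `A`. -/
theorem exists_dualNumber (d : A →ₗ[k] A) (hd : ∀ x y, d (x * y) = d x * y + x * d y)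
    (hbr : ∀ x y, d (P.br x y) = P.br (d x) y + P.br x (d y)) :
    ∃ D : Env P →ₐ[k] DualNumber (Env P), (∀ x, D (m P x) = inl (m P x) + inr (m P (d x))) ∧
      ∀ x, D (h P x) = inl (h P x) + inr (h P (d x)) := by
  have d1 : d 1 = 0 := by simpa using hd 1 1
  let F : A →ₐ[k] DualNumber (Env P) := AlgHom.ofLinearMap
    { toFun := fun x => inl (m P x) + inr (m P (d x))
      map_add' := fun x y => by ext <;> simp
      map_smul' := fun c x => by ext <;> simp }
    (by ext <;> simp [d1])
    (fun x y => by
      ext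
      · simp
      · simp only [LinearMap.coe_mk, AddHom.coe_mk, snd_add, snd_inl, snd_inr, zero_add, snd_mul,
          fst_add, fst_inl, fst_inr, add_zero, smul_eq_mul,
          MulOpposite.smul_eq_mul_unop, MulOpposite.unop_op, hd, map_add,
          map_mul]
        abel)
  let K : A →ₗ[k] DualNumber (Env P) :=
    { toFun := fun x => inl (h P x) + inr (h P (d x))
      map_add' := fun x y => by ext <;> simp
      map_smul' := fun c x => by ext <;> simp }
  have hF : ∀ x, F x = inl (m P x) + inr (m P (d x)) := fun _ => rfl
  have hK : ∀ x, K x = inl (h P x) + inr (h P (d x)) := fun _ => rfl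
  refine ⟨lift F K (fun x y => ?_) (fun x y => ?_) (fun x y => ?_), fun x => ?_, fun x => ?_⟩
  · ext
    · simp [hK, h_br]
    · simp only [hK, snd_add, snd_inl, snd_inr, zero_add, snd_mul, snd_sub,
          fst_add, fst_inl, fst_inr, add_zero, smul_eq_mul,
          MulOpposite.smul_eq_mul_unop, MulOpposite.unop_op, hbr, map_add,
          h_br]
      abel
  · ext
    · simp [hK, hF, h_mul]
    · simp only [hK, hF, snd_add, snd_inl, snd_inr, zero_add, snd_mul,
          fst_add, fst_inl, fst_inr, add_zero, smul_eq_mul,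
          MulOpposite.smul_eq_mul_unop, MulOpposite.unop_op, hd, map_add,
          h_mul]
      abel
  · ext
    · simp [hK, hF, m_br]
    · simp only [hK, hF, snd_add, snd_inl, snd_inr, zero_add, snd_mul, snd_sub,
          fst_add, fst_inl, fst_inr, add_zero, smul_eq_mul,
          MulOpposite.smul_eq_mul_unop, MulOpposite.unop_op, hbr, map_add,
          m_br]
      abel
  · rw [lift_m, hF]
  · rw [lift_h, hK]

/-- A Poisson derivation of `A` extends to a derivation of `A^e`. -/
theorem exists_derivation (d : A →ₗ[k] A) (hd : ∀ x y, d (x * y) = d x * y + x * d y)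
    (hbr : ∀ x y, d (P.br x y) = P.br (d x) y + P.br x (d y)) :
    ∃ δ : Env P →ₗ[k] Env P, (∀ x, δ (m P x) = m P (d x)) ∧ (∀ x, δ (h P x) = h P (d x)) ∧
      ∀ a b, δ (a * b) = δ a * b + a * δ b := by
  obtain ⟨D, hm, hh⟩ := exists_dualNumber d hd hbr
  -- The algebra map to the dual numbers lifts the identity, so its ε-coefficient is a derivation.
  have hfst : ∀ a, (D a).fst = a := by
    intro a
    induction a using induction with
    | algebraMap c => rw [AlgHom.commutes]; rfl
    | m x => simp [hm]
    | h x => simp [hh]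
    | mul a b ha hb => rw [map_mul, TrivSqZeroExt.fst_mul, ha, hb]
    | add a b ha hb => rw [map_add, TrivSqZeroExt.fst_add, ha, hb]
  refine ⟨(TrivSqZeroExt.sndHom (Env P) (Env P)).restrictScalars k ∘ₗ D.toLinearMap, fun x => ?_,
    fun x => ?_, fun a b => ?_⟩
  · simp [hm]
  · simp [hh]
  · simp [hfst, add_comm]

end Derivation

end Env

/-! ### Derivation families and the action of `(kG)^e` on `A^e` -/

/-- A family of commuting Poisson derivations indexed additively by a group `G`. -/
structure DerivationFamily {k : Type v} {A : Type u} [CommRing k] [CommRing A] [Algebra k A]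
    (P : PoissonBracket k A) (G : Type w) [CommGroup G] where
  d : G → A →ₗ[k] A
  d_group_mul : ∀ g t x, d (g * t) x = d g x + d t x
  d_comm : ∀ g t x, d g (d t x) = d t (d g x)
  d_mul : ∀ g x y, d g (x * y) = d g x * y + x * d g y
  d_br : ∀ g x y, d g (P.br x y) = P.br (d g x) y + P.br x (d g y)

namespace DerivationFamily

variable {k : Type v} {A : Type u} [Field k] [CommRing A] [Algebra k A]
  {P : PoissonBracket k A} {G : Type w} [CommGroup G] (D : DerivationFamily P G)

theorem d_group_one (x : A) : D.d 1 x = 0 := by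
  have := D.d_group_mul 1 1 x
  rw [mul_one] at this
  simpa using this

/-- The endomorphism `m_y ↦ m_y`, `h_y ↦ h_y + m_{d y}` of `A^e`. -/
noncomputable def twist (g : G) : Env P →ₐ[k] Env P :=
  Env.lift (Env.m P) (Env.h P + (Env.m P).toLinearMap ∘ₗ D.d g)
    (fun x y => by
      simp only [LinearMap.add_apply, LinearMap.comp_apply, AlgHom.toLinearMap_apply, D.d_br,
        map_add, Env.h_br]
      rw [P.br_skew (D.d g x), map_neg, Env.m_br, Env.m_br, add_mul, mul_add, mul_add, add_mul,
        mul_add, mul_add, Env.m_mul_m_comm (D.d g x) (D.d g y)]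
      abel)
    (fun x y => by
      simp only [LinearMap.add_apply, LinearMap.comp_apply, AlgHom.toLinearMap_apply, D.d_mul,
        map_add, Env.h_mul, map_mul, mul_add]
      rw [Env.m_mul_m_comm (D.d g x)]
      abel)
    (fun x y => by
      simp only [LinearMap.add_apply, LinearMap.comp_apply, AlgHom.toLinearMap_apply, Env.m_br]
      rw [add_mul, mul_add, Env.m_mul_m_comm (D.d g x)]
      abel)

@[simp] theorem twist_m (g : G) (x : A) : D.twist g (Env.m P x) = Env.m P x := by simp [twist]

@[simp] theorem twist_h (g : G) (x : A) :
    D.twist g (Env.h P x) = Env.h P x + Env.m P (D.d g x) := by simp [twist]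

theorem twist_mul (g t : G) : D.twist (g * t) = (D.twist g).comp (D.twist t) :=
  Env.algHom_ext (fun x => by simp) (fun x => by simp [D.d_group_mul, add_assoc])

theorem twist_one : D.twist 1 = AlgHom.id k (Env P) :=
  Env.algHom_ext (fun x => by simp) (fun x => by simp [D.d_group_one])

/-- The derivation of `A^e` induced by `d g`. -/
noncomputable def der (g : G) : Env P →ₗ[k] Env P :=
  (Env.exists_derivation (D.d g) (D.d_mul g) (D.d_br g)).choose

@[simp] theorem der_m (g : G) (x : A) : D.der g (Env.m P x) = Env.m P (D.d g x) :=
  (Env.exists_derivation (D.d g) (D.d_mul g) (D.d_br g)).choose_spec.1 x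

@[simp] theorem der_h (g : G) (x : A) : D.der g (Env.h P x) = Env.h P (D.d g x) :=
  (Env.exists_derivation (D.d g) (D.d_mul g) (D.d_br g)).choose_spec.2.1 x

theorem der_mul (g : G) (a b : Env P) : D.der g (a * b) = D.der g a * b + a * D.der g b :=
  (Env.exists_derivation (D.d g) (D.d_mul g) (D.d_br g)).choose_spec.2.2 a b

theorem der_one (g : G) : D.der g 1 = 0 := by
  have := D.der_mul g 1 1
  rw [mul_one, one_mul, mul_one] at this
  simpa using this

theorem der_algebraMap (g : G) (c : k) : D.der g (algebraMap k (Env P) c) = 0 := by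
  rw [Algebra.algebraMap_eq_smul_one, map_smul, der_one, smul_zero]

theorem der_group_mul (g t : G) (a : Env P) : D.der (g * t) a = D.der g a + D.der t a := by
  induction a using Env.induction with
  | algebraMap c => simp only [der_algebraMap, add_zero]
  | m x => simp [D.d_group_mul]
  | h x => simp [D.d_group_mul]
  | mul a b ha hb => simp only [der_mul, ha, hb, add_mul, mul_add]; abel
  | add a b ha hb => simp only [map_add, ha, hb]; abel

theorem der_comm (g t : G) (a : Env P) : D.der g (D.der t a) = D.der t (D.der g a) := by
  induction a using Env.induction with
  | algebraMap c => simp only [der_algebraMap, map_zero]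
  | m x => simp [D.d_comm g t]
  | h x => simp [D.d_comm g t]
  | mul a b ha hb => simp only [der_mul, map_add, ha, hb]; abel
  | add a b ha hb => simp only [map_add, ha, hb]

theorem twist_der (g t : G) (a : Env P) : D.twist g (D.der t a) = D.der t (D.twist g a) := by
  induction a using Env.induction with
  | algebraMap c => simp only [der_algebraMap, map_zero, AlgHom.commutes]
  | m x => simp
  | h x => simp [D.d_comm g t]
  | mul a b ha hb => simp only [der_mul, map_add, map_mul, ha, hb]
  | add a b ha hb => simp only [map_add, ha, hb]

/-- The monoid hom from `G` to the endomorphisms of `A^e`. -/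
noncomputable def twistHom : G →* Module.End k (Env P) where
  toFun g := (D.twist g).toLinearMap
  map_one' := by rw [twist_one]; rfl
  map_mul' g t := by rw [twist_mul]; rfl

/-- The linear map sending `g` to the operator of `h_g`. -/
noncomputable def derOp : MonoidAlgebra k G →ₗ[k] Module.End k (Env P) :=
  Finsupp.linearCombination k (fun g => (D.twist g).toLinearMap * D.der g) ∘ₗ
    (MonoidAlgebra.coeffLinearEquiv k).toLinearMap

theorem derOp_single (g : G) : D.derOp (MonoidAlgebra.single g 1) =
    (D.twist g).toLinearMap * D.der g := by
  refine (Finsupp.linearCombination_single k 1 g).trans ?_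
  rw [one_smul]

/-- The algebra map `kG → End(A^e)`. -/
noncomputable def twistOp : MonoidAlgebra k G →ₐ[k] Module.End k (Env P) :=
  MonoidAlgebra.lift k _ G D.twistHom

theorem twistOp_single (g : G) : D.twistOp (MonoidAlgebra.single g 1) =
    (D.twist g).toLinearMap := by
  rw [twistOp, MonoidAlgebra.lift_single, one_smul]
  rfl

theorem twistOp_of (g : G) : D.twistOp (MonoidAlgebra.of k G g) = (D.twist g).toLinearMap :=
  D.twistOp_single g

theorem derOp_of (g : G) : D.derOp (MonoidAlgebra.of k G g) =
    (D.twist g).toLinearMap * D.der g :=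
  D.derOp_single g

/-- The bracket on kG is zero, so the h-operators must commute. They do: twists and derivations
commute among themselves and with each other. -/
theorem derOp_mul_derOp (x y : MonoidAlgebra k G) : D.derOp x * D.derOp y =
    D.derOp y * D.derOp x := by
  induction x using MonoidAlgebra.induction_on with
  | of g =>
    induction y using MonoidAlgebra.induction_on with
    | of t =>
      rw [derOp_of, derOp_of]
      ext a
      simp only [Module.End.mul_apply, AlgHom.toLinearMap_apply]
      rw [← D.twist_der, ← D.twist_der, D.der_comm]
      rw [← AlgHom.comp_apply, ← AlgHom.comp_apply, ← twist_mul, ← twist_mul, mul_comm]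
    | add x y hx hy => rw [map_add, mul_add, add_mul, hx, hy]
    | smul r x hx => rw [map_smul, mul_smul_comm, smul_mul_assoc, hx]
  | add x y hx hy => rw [map_add, mul_add, add_mul, hx, hy]
  | smul r x hx => rw [map_smul, mul_smul_comm, smul_mul_assoc, hx]

/-- On group elements this is τ_{gt} δ_{gt} = τ_t τ_g δ_g + τ_g τ_t δ_t: the twist is multiplicative
in g and the derivation additive. -/
theorem derOp_mul (x y : MonoidAlgebra k G) : D.derOp (x * y) =
    D.twistOp y * D.derOp x + D.twistOp x * D.derOp y := by
  induction x using MonoidAlgebra.induction_on with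
  | of g =>
    induction y using MonoidAlgebra.induction_on with
    | of t =>
      rw [← map_mul, derOp_of, derOp_of, derOp_of, twistOp_of, twistOp_of]
      ext a
      simp only [Module.End.mul_apply, AlgHom.toLinearMap_apply, LinearMap.add_apply]
      rw [← AlgHom.comp_apply, ← AlgHom.comp_apply, ← twist_mul, ← twist_mul, mul_comm t g,
        D.der_group_mul, map_add]
    | add x y hx hy => simp only [mul_add, map_add, add_mul, hx, hy]; abel
    | smul r x hx =>
      rw [mul_smul_comm, map_smul, hx, map_smul, map_smul, smul_mul_assoc, mul_smul_comm, smul_add]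
  | add x y hx hy => simp only [mul_add, map_add, add_mul, hx, hy]; abel
  | smul r x hx =>
    rw [smul_mul_assoc, map_smul, hx, map_smul, map_smul, smul_mul_assoc, mul_smul_comm, smul_add]

theorem derOp_twistOp (x y : MonoidAlgebra k G) : D.derOp x * D.twistOp y =
    D.twistOp y * D.derOp x := by
  induction x using MonoidAlgebra.induction_on with
  | of g =>
    induction y using MonoidAlgebra.induction_on with
    | of t =>
      rw [derOp_of, twistOp_of]
      ext a
      simp only [Module.End.mul_apply, AlgHom.toLinearMap_apply]
      rw [← D.twist_der, ← AlgHom.comp_apply, ← AlgHom.comp_apply, ← twist_mul, ← twist_mul,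
        mul_comm t g]
    | add x y hx hy => rw [map_add, mul_add, add_mul, hx, hy]
    | smul r x hx => rw [map_smul, mul_smul_comm, smul_mul_assoc, hx]
  | add x y hx hy => rw [map_add, mul_add, add_mul, hx, hy]
  | smul r x hx => rw [map_smul, mul_smul_comm, smul_mul_assoc, hx]

/-- The action of `(kG)^e` on `A^e`. -/
noncomputable def act : Env (trivial k (MonoidAlgebra k G)) →ₐ[k] Module.End k (Env P) :=
  Env.lift D.twistOp D.derOp
    (fun x y => by
      rw [D.derOp_mul_derOp x y, sub_self]
      exact map_zero _)
    D.derOp_mul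
    (fun x y => by
      rw [D.derOp_twistOp x y, sub_self]
      exact map_zero _)

theorem act_m (g : G) : D.act (Env.m _ (MonoidAlgebra.single g 1)) = (D.twist g).toLinearMap := by
  rw [act, Env.lift_m, twistOp_single]

theorem act_h (g : G) : D.act (Env.h _ (MonoidAlgebra.single g 1)) =
    (D.twist g).toLinearMap * D.der g := by
  rw [act, Env.lift_h, derOp_single]

end DerivationFamily

/-- Induction on elements of `(kG)^e`. -/
theorem env_monoidAlgebra_induction {k : Type v} [CommRing k] {G : Type w} [CommMonoid G]
    {P : PoissonBracket k (MonoidAlgebra k G)} {p : Env P → Prop}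
    (algebraMap : ∀ c : k, p (algebraMap k (Env P) c))
    (m : ∀ g : G, p (Env.m P (MonoidAlgebra.single g 1)))
    (h : ∀ g : G, p (Env.h P (MonoidAlgebra.single g 1))) (mul : ∀ a b, p a → p b → p (a * b))
    (add : ∀ a b, p a → p b → p (a + b)) (a : Env P) : p a := by
  have smul : ∀ (c : k) a, p a → p (c • a) := fun c a ha => by
    rw [Algebra.smul_def]
    exact mul _ _ (algebraMap c) ha
  induction a using Env.induction with
  | algebraMap c => exact algebraMap c
  | m x =>
    induction x using MonoidAlgebra.induction_on with
    | of g => exact m g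
    | add x y hx hy => rw [map_add]; exact add _ _ hx hy
    | smul r x hx => rw [map_smul]; exact smul _ _ hx
  | h x =>
    induction x using MonoidAlgebra.induction_on with
    | of g => exact h g
    | add x y hx hy => rw [map_add]; exact add _ _ hx hy
    | smul r x hx => rw [map_smul]; exact smul _ _ hx
  | mul a b ha hb => exact mul _ _ ha hb
  | add a b ha hb => exact add _ _ ha hb

theorem comul_m_single {k : Type v} [CommRing k] {G : Type w} [CommGroup G] (g : G) :
    Coalgebra.comul (R := k) (Env.m (trivial k (MonoidAlgebra k G)) (MonoidAlgebra.single g 1)) =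
      Env.m _ (MonoidAlgebra.single g 1) ⊗ₜ Env.m _ (MonoidAlgebra.single g 1) := by
  rw [Env.comul_m]
  simp

theorem comul_h_single {k : Type v} [CommRing k] {G : Type w} [CommGroup G] (g : G) :
    Coalgebra.comul (R := k) (Env.h (trivial k (MonoidAlgebra k G)) (MonoidAlgebra.single g 1)) =
      Env.m _ (MonoidAlgebra.single g 1) ⊗ₜ Env.h _ (MonoidAlgebra.single g 1) +
      Env.h _ (MonoidAlgebra.single g 1) ⊗ₜ Env.m _ (MonoidAlgebra.single g 1) := by
  rw [Env.comul_h]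
  simp

namespace DerivationFamily

variable {k : Type v} {A : Type u} [Field k] [CommRing A] [Algebra k A]
  {P : PoissonBracket k A} {G : Type w} [CommGroup G] (D : DerivationFamily P G)

theorem act_apply_one (x : Env (trivial k (MonoidAlgebra k G))) :
    D.act x 1 = algebraMap k (Env P) (Coalgebra.counit x) := by
  induction x using env_monoidAlgebra_induction with
  | algebraMap c =>
    rw [AlgHom.commutes, Bialgebra.counit_algebraMap, Module.algebraMap_end_apply,
      Algebra.algebraMap_eq_smul_one]
  | m g =>
    rw [act_m, Env.counit_m, AlgHom.toLinearMap_apply, map_one]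
    simp
  | h g =>
    rw [act_h, Env.counit_h, Module.End.mul_apply, der_one, map_zero, map_zero]
  | mul a b ha hb =>
    rw [map_mul, Module.End.mul_apply, hb, Algebra.algebraMap_eq_smul_one, map_smul, ha,
      Bialgebra.counit_mul, mul_comm, map_mul, Algebra.smul_def]
  | add a b ha hb => rw [map_add, LinearMap.add_apply, ha, hb, map_add, map_add]

/-- The diagonal action of `(kG)^e` on `A^e ⊗ A^e`. -/
noncomputable def act₂ :
    Env (trivial k (MonoidAlgebra k G)) →ₐ[k] Module.End k (Env P ⊗[k] Env P) :=
  (Module.endTensorEndAlgHom (R := k) (S := k) (A := k)).comp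
    ((Algebra.TensorProduct.map D.act D.act).comp (Bialgebra.comulAlgHom k _))

/-- Stated as an intertwining relation between two algebra maps in x, the product rule passes to
products in x. On generators it says that twists are algebra maps and that δ_g is a derivation. -/
theorem act_mul' (x : Env (trivial k (MonoidAlgebra k G))) :
    D.act x ∘ₗ LinearMap.mul' k (Env P) = LinearMap.mul' k (Env P) ∘ₗ D.act₂ x := by
  induction x using env_monoidAlgebra_induction with
  | algebraMap c =>
    rw [AlgHom.commutes, AlgHom.commutes]
    ext a b
    simp [Module.algebraMap_end_apply]
  | m g =>
    ext a b
    simp [act₂, comul_m_single, Module.endTensorEndAlgHom_apply, act_m]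
  | h g =>
    ext a b
    simp [act₂, comul_h_single, Module.endTensorEndAlgHom_apply, act_m, act_h, der_mul, add_comm]
  | mul a b ha hb =>
    rw [map_mul, map_mul]
    change D.act a ∘ₗ (D.act b ∘ₗ _) = _
    rw [hb, ← LinearMap.comp_assoc, ha]
    rfl
  | add a b ha hb => rw [map_add, map_add, LinearMap.add_comp, LinearMap.comp_add, ha, hb]

/-- `A^e` as a `(kG)^e`-module algebra. -/
noncomputable def moduleAlgebra :
    ModuleAlgebra k (Env (trivial k (MonoidAlgebra k G))) (Env P) where
  act := D.act
  act_one := D.act_apply_one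
  act_mul x a b := by
    refine (LinearMap.congr_fun (D.act_mul' x) (a ⊗ₜ b)).trans ?_
    simp only [LinearMap.comp_apply, act₂, AlgHom.comp_apply, Bialgebra.comulAlgHom_apply]
    generalize Coalgebra.comul (R := k) x = u
    induction u with
    | zero => simp
    | add u v hu hv => simp only [map_add, LinearMap.add_apply, hu, hv]
    | tmul p q => simp [Module.endTensorEndAlgHom_apply]

end DerivationFamily

end PoissonBracket

/-! ### Algebra maps out of a smash product -/

namespace ModuleAlgebra.Smash

variable {k : Type v} {H : Type u} {A : Type w} [CommRing k] [Ring H]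
    [Bialgebra k H] [Ring A] [Algebra k A] (σ : ModuleAlgebra k H A)

theorem mk_mul_mk_eq (a b : A) (x y : H) : mk σ a x * mk σ b y =
    LinearMap.rTensor H (LinearMap.mulLeft k a) (diag σ x (b ⊗ₜ y)) := rfl

theorem mk_one_mul_mk (a b : A) (y : H) : mk σ a 1 * mk σ b y = mk σ (a * b) y := by
  rw [mk_mul_mk_eq, map_one]
  rfl

theorem mk_mul_mk_one (a : A) (x y : H) : mk σ a x * mk σ 1 y = mk σ a (x * y) := by
  rw [mk_mul_mk_eq, diag_mulRight, diag_one]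
  simp [mk]
  rfl

/-- The embedding of the module algebra in the smash product. -/
noncomputable def inlHom : A →ₐ[k] Smash σ :=
  AlgHom.ofLinearMap ((TensorProduct.mk k A H).flip 1) rfl
    (fun a b => (mk_one_mul_mk σ a b 1).symm)

/-- The embedding of the bialgebra in the smash product. -/
noncomputable def inrHom : H →ₐ[k] Smash σ :=
  AlgHom.ofLinearMap (TensorProduct.mk k A H 1) rfl (fun x y => (mk_mul_mk_one σ 1 x y).symm)

theorem inlHom_apply (a : A) : inlHom σ a = mk σ a 1 := rfl

theorem inrHom_apply (x : H) : inrHom σ x = mk σ 1 x := rfl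

theorem inlHom_mul_inrHom (a : A) (x : H) : inlHom σ a * inrHom σ x = mk σ a x := by
  rw [inlHom_apply, inrHom_apply, mk_one_mul_mk, mul_one]

theorem algHom_ext {E : Type*} [Ring E] [Algebra k E] {f g : Smash σ →ₐ[k] E}
    (hl : f.comp (inlHom σ) = g.comp (inlHom σ)) (hr : f.comp (inrHom σ) = g.comp (inrHom σ)) :
    f = g := by
  have h : f.toLinearMap = g.toLinearMap := by
    refine TensorProduct.ext' (M := A) (N := H) fun a x => ?_
    change f (mk σ a x) = g (mk σ a x)
    rw [← inlHom_mul_inrHom, map_mul, map_mul]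
    exact congrArg₂ _ (DFunLike.congr_fun hl a) (DFunLike.congr_fun hr x)
  exact AlgHom.ext fun x => LinearMap.congr_fun h x

/-- The algebra map on the smash product given by algebra maps on the factors which satisfy the
commutation rule of the smash product. -/
noncomputable def lift {E : Type*} [Ring E] [Algebra k E] (f : A →ₐ[k] E) (g : H →ₐ[k] E)
    (hfg : ∀ x b, g x * f b = LinearMap.mul' k E
      (TensorProduct.map f.toLinearMap g.toLinearMap (diag σ x (b ⊗ₜ 1)))) :
    Smash σ →ₐ[k] E :=
  AlgHom.ofLinearMap (LinearMap.mul' k E ∘ₗ TensorProduct.map f.toLinearMap g.toLinearMap)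
    (by
      change f 1 * g 1 = 1
      rw [map_one, map_one, mul_one])
    (by
      let Φ : A ⊗[k] H →ₗ[k] E := LinearMap.mul' k E ∘ₗ TensorProduct.map f.toLinearMap g.toLinearMap
      have hΦ : ∀ a x, Φ (a ⊗ₜ x) = f a * g x := fun _ _ => rfl
      -- Compatibility with left multiplication by A and right multiplication by H reduces
      -- multiplicativity to the products x · b, which is the hypothesis.
      have h1 : ∀ (a : A) (w : A ⊗[k] H), Φ (LinearMap.rTensor H (LinearMap.mulLeft k a) w) =
          f a * Φ w := by
        intro a w
        induction w with
        | zero => simp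
        | add u v hu hv => simp only [map_add, hu, hv, mul_add]
        | tmul b y =>
          rw [LinearMap.rTensor_tmul, hΦ, hΦ, LinearMap.mulLeft_apply, map_mul, mul_assoc]
      have h2 : ∀ (y : H) (w : A ⊗[k] H), Φ (LinearMap.lTensor A (LinearMap.mulRight k y) w) =
          Φ w * g y := by
        intro y w
        induction w with
        | zero => simp
        | add u v hu hv => simp only [map_add, hu, hv, add_mul]
        | tmul b z =>
          rw [LinearMap.lTensor_tmul, hΦ, hΦ, LinearMap.mulRight_apply, map_mul, mul_assoc]
      have h3 : ∀ u v : A ⊗[k] H, Φ (lmul σ u v) = Φ u * Φ v := by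
        intro u v
        induction u with
        | zero => simp
        | add p q hp hq => simp only [map_add, LinearMap.add_apply, hp, hq, add_mul]
        | tmul a x =>
          induction v with
          | zero => simp
          | add p q hp hq => simp only [map_add, hp, hq, mul_add]
          | tmul b y =>
            rw [lmul_tmul, Module.End.mul_apply, h1, diag_mulRight, h2, hΦ, hΦ]
            have h4 : Φ (diag σ x (b ⊗ₜ 1)) = g x * f b := (hfg x b).symm
            rw [h4]
            simp only [mul_assoc]
      exact h3)

end ModuleAlgebra.Smash

/-! ### Logarithmic elements of `(kG)^e` -/

namespace PoissonBracket.DerivationFamily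

open ModuleAlgebra

variable {k : Type v} {A : Type u} [Field k] [CommRing A] [Algebra k A]
  {P : PoissonBracket k A} {G : Type w} [CommGroup G] (D : DerivationFamily P G)

variable (k) in
/-- The element `m_g` of `(kG)^e`. -/
noncomputable def gm (g : G) : Env (trivial k (MonoidAlgebra k G)) :=
  Env.m _ (MonoidAlgebra.single g 1)

variable (k) in
/-- The element `h_g` of `(kG)^e`. -/
noncomputable def gh (g : G) : Env (trivial k (MonoidAlgebra k G)) :=
  Env.h _ (MonoidAlgebra.single g 1)

variable (k) in
/-- The logarithmic element `m_{g⁻¹} h_g` of `(kG)^e`. -/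
noncomputable def gl (g : G) : Env (trivial k (MonoidAlgebra k G)) := gm k g⁻¹ * gh k g

theorem gm_one : gm k (1 : G) = 1 := map_one (Env.m _)

theorem gm_mul (g t : G) : gm k (g * t) = gm k g * gm k t := by
  rw [gm, gm, gm, ← map_mul, MonoidAlgebra.single_mul_single, one_mul]

theorem gm_mul_inv (g : G) : gm k g * gm k g⁻¹ = 1 := by
  rw [← gm_mul, mul_inv_cancel, gm_one]

theorem gm_comm (g t : G) : gm k g * gm k t = gm k t * gm k g := by
  rw [← gm_mul, mul_comm, gm_mul]

theorem gh_mul_gm (g t : G) : gh k g * gm k t = gm k t * gh k g := by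
  have := Env.m_br (trivial k (MonoidAlgebra k G)) (MonoidAlgebra.single g 1)
    (MonoidAlgebra.single t 1)
  exact sub_eq_zero.1 (this.symm.trans (map_zero _))

theorem gh_comm (g t : G) : gh k g * gh k t = gh k t * gh k g := by
  have := Env.h_br (trivial k (MonoidAlgebra k G)) (MonoidAlgebra.single g 1)
    (MonoidAlgebra.single t 1)
  exact sub_eq_zero.1 (this.symm.trans (map_zero _))

theorem gh_mul (g t : G) : gh k (g * t) = gm k t * gh k g + gm k g * gh k t := by
  have := Env.h_mul (trivial k (MonoidAlgebra k G)) (MonoidAlgebra.single g 1)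
    (MonoidAlgebra.single t 1)
  rw [MonoidAlgebra.single_mul_single, one_mul] at this
  exact this

theorem gm_mul_gl (g : G) : gm k g * gl k g = gh k g := by
  rw [gl, ← mul_assoc, gm_mul_inv, one_mul]

theorem gl_mul_gm (g t : G) : gl k g * gm k t = gm k t * gl k g := by
  rw [gl, mul_assoc, gh_mul_gm, ← mul_assoc, gm_comm, mul_assoc]

theorem gl_comm (g t : G) : gl k g * gl k t = gl k t * gl k g := by
  rw [gl, gl, mul_assoc, ← mul_assoc (gh k g), gh_mul_gm, mul_assoc (gm k t⁻¹), gh_comm,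
    ← mul_assoc (gm k g⁻¹), gm_comm, mul_assoc, mul_assoc, ← mul_assoc (gm k g⁻¹) (gh k t),
    ← gh_mul_gm]
  simp only [mul_assoc]

/-- This is the additivity l_{gt} = l_g + l_t, multiplied by m_g m_t. -/
theorem gm_mul_gl_mul (g t : G) :
    gh k (g * t) = gm k g * gm k t * (gl k g + gl k t) := by
  rw [gh_mul, mul_add, ← gm_mul_gl g, ← gm_mul_gl t, gm_comm g t, ← mul_assoc, ← mul_assoc,
    gm_comm g t]

/-! ### Commutation rules in the smash product `A^e # (kG)^e` -/

/-- `A^e # (kG)^e`. -/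
abbrev SmashEnv : Type _ := Smash D.moduleAlgebra

/-- The embedding of `A^e`. -/
noncomputable def jA : Env P →ₐ[k] D.SmashEnv := Smash.inlHom D.moduleAlgebra

/-- The embedding of `(kG)^e`. -/
noncomputable def jG : Env (trivial k (MonoidAlgebra k G)) →ₐ[k] D.SmashEnv :=
  Smash.inrHom D.moduleAlgebra

theorem diag_gm (g : G) (b : Env P) : Smash.diag D.moduleAlgebra (gm k g) (b ⊗ₜ 1) =
    D.twist g b ⊗ₜ gm k g := by
  rw [Smash.diag_tmul, gm, comul_m_single, TensorProduct.map_tmul]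
  change D.act (Env.m _ (MonoidAlgebra.single g 1)) b ⊗ₜ[k] _ = _
  rw [act_m, LinearMap.mulRight_apply, mul_one]
  rfl

theorem diag_gh (g : G) (b : Env P) : Smash.diag D.moduleAlgebra (gh k g) (b ⊗ₜ 1) =
    D.twist g b ⊗ₜ gh k g + D.twist g (D.der g b) ⊗ₜ gm k g := by
  rw [Smash.diag_tmul, gh, comul_h_single, map_add, TensorProduct.map_tmul, TensorProduct.map_tmul]
  change D.act (Env.m _ (MonoidAlgebra.single g 1)) b ⊗ₜ[k] _ +
    D.act (Env.h _ (MonoidAlgebra.single g 1)) b ⊗ₜ[k] _ = _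
  rw [act_m, act_h, LinearMap.mulRight_apply, LinearMap.mulRight_apply, mul_one, mul_one]
  rfl

theorem jG_mul_jA (x : Env (trivial k (MonoidAlgebra k G))) (b : Env P) :
    D.jG x * D.jA b = (Smash.diag D.moduleAlgebra x (b ⊗ₜ 1) : Env P ⊗[k] _) := by
  refine (Smash.mk_mul_mk_eq D.moduleAlgebra 1 b x 1).trans ?_
  have : LinearMap.mulLeft k (1 : Env P) = LinearMap.id := by ext; simp
  rw [this, LinearMap.rTensor_id]
  rfl

theorem jA_mul_jG (b : Env P) (x : Env (trivial k (MonoidAlgebra k G))) :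
    D.jA b * D.jG x = (b ⊗ₜ x : Env P ⊗[k] _) :=
  Smash.inlHom_mul_inrHom D.moduleAlgebra b x

theorem jG_gm_mul_jA (g : G) (b : Env P) :
    D.jG (gm k g) * D.jA b = D.jA (D.twist g b) * D.jG (gm k g) := by
  rw [jG_mul_jA, jA_mul_jG, diag_gm]

theorem jG_gh_mul_jA (g : G) (b : Env P) : D.jG (gh k g) * D.jA b =
    D.jA (D.twist g b) * D.jG (gh k g) + D.jA (D.twist g (D.der g b)) * D.jG (gm k g) := by
  rw [jG_mul_jA, jA_mul_jG, jA_mul_jG, diag_gh]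
  rfl

theorem twist_inv_twist (g : G) (b : Env P) : D.twist g⁻¹ (D.twist g b) = b := by
  rw [← AlgHom.comp_apply, ← twist_mul, inv_mul_cancel, twist_one, AlgHom.id_apply]

/-- Multiplying h_g by m_{g⁻¹} undoes the twist in its commutation rule, so commuting with l_g is
just δ_g. For this reason the relations of C^e are verified in terms of the l_g. -/
theorem jG_gl_mul_jA (g : G) (b : Env P) : D.jG (gl k g) * D.jA b =
    D.jA b * D.jG (gl k g) + D.jA (D.der g b) := by
  rw [gl, map_mul, mul_assoc, jG_gh_mul_jA, mul_add, ← mul_assoc, ← mul_assoc, jG_gm_mul_jA,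
    jG_gm_mul_jA, twist_inv_twist, twist_inv_twist, mul_assoc, mul_assoc, ← map_mul D.jG,
    ← map_mul D.jG, gm_comm g⁻¹ g, gm_mul_inv, map_one, mul_one, map_mul]

end PoissonBracket.DerivationFamily

/-! ### Logarithmic derivations inside a Poisson algebra -/

namespace PoissonBracket

theorem br_mul_left {k : Type v} {A : Type u} [CommRing k] [CommRing A] [Algebra k A]
    (P : PoissonBracket k A) (a b c : A) : P.br (a * b) c = a * P.br b c + P.br a c * b := by
  rw [P.br_skew, P.leibniz, P.br_skew c a, P.br_skew c b]
  ring

theorem br_br {k : Type v} {A : Type u} [CommRing k] [CommRing A] [Algebra k A]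
    (P : PoissonBracket k A) (a b c : A) :
    P.br a (P.br b c) = P.br (P.br a b) c + P.br b (P.br a c) := by
  have h := P.jacobi a b c
  rw [P.br_skew c a, map_neg, P.br_skew c (P.br a b)] at h
  linear_combination h

theorem Env.map_m {k : Type v} {A : Type u} [CommRing k] [CommRing A] [Algebra k A]
    {P : PoissonBracket k A} {A' : Type w} [CommRing A'] [Algebra k A'] {Q : PoissonBracket k A'}
    (f : A →ₐ[k] A') (hf : P.IsHom Q f) (x : A) :
    Env.map f hf (Env.m P x) = Env.m Q (f x) :=
  Env.lift_m _ _ _ _ _ x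

theorem Env.map_h {k : Type v} {A : Type u} [CommRing k] [CommRing A] [Algebra k A]
    {P : PoissonBracket k A} {A' : Type w} [CommRing A'] [Algebra k A'] {Q : PoissonBracket k A'}
    (f : A →ₐ[k] A') (hf : P.IsHom Q f) (x : A) :
    Env.map f hf (Env.h P x) = Env.h Q (f x) :=
  Env.lift_h _ _ _ _ _ x

section LogDerivation

variable {k : Type v} {C : Type u} [Field k] [CommRing C] [Algebra k C]
  {PC : PoissonBracket k C} {G : Type w} [CommGroup G] {ι : MonoidAlgebra k G →ₐ[k] C}

theorem map_single_mul (g t : G) : ι (MonoidAlgebra.single (g * t) 1) =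
    ι (MonoidAlgebra.single g 1) * ι (MonoidAlgebra.single t 1) := by
  rw [← map_mul, MonoidAlgebra.single_mul_single, one_mul]

theorem map_single_one : ι (MonoidAlgebra.single 1 1) = 1 := map_one ι

theorem map_single_inv_mul (g : G) :
    ι (MonoidAlgebra.single g⁻¹ 1) * ι (MonoidAlgebra.single g 1) = 1 := by
  rw [← map_single_mul, inv_mul_cancel, map_single_one]

theorem br_map_map (hι : (trivial k (MonoidAlgebra k G)).IsHom PC ι) (x y : MonoidAlgebra k G) :
    PC.br (ι x) (ι y) = 0 := by
  rw [← hι]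
  exact map_zero ι

/-- Obtained by bracketing g⁻¹ g = 1 with x. -/
theorem br_map_single_inv (g : G) (x : C) : PC.br (ι (MonoidAlgebra.single g⁻¹ 1)) x =
    -(ι (MonoidAlgebra.single g⁻¹ 1) *
      (ι (MonoidAlgebra.single g⁻¹ 1) * PC.br (ι (MonoidAlgebra.single g 1)) x)) := by
  have h1 : PC.br 1 x = 0 := by simpa using PC.br_mul_left 1 1 x
  have h := PC.br_mul_left (ι (.single g⁻¹ 1)) (ι (.single g 1)) x
  rw [map_single_inv_mul, h1] at h
  linear_combination -ι (.single g⁻¹ 1) * h -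
    PC.br (ι (.single g⁻¹ 1)) x * map_single_inv_mul (ι := ι) g

variable (hι : (trivial k (MonoidAlgebra k G)).IsHom PC ι) {R : Subalgebra k C}
  (hR : ∀ x ∈ R, ∀ y ∈ R, PC.br x y ∈ R)
  (hs : ∀ (g : G) (y : R), ι (MonoidAlgebra.single g⁻¹ 1) *
    PC.br (ι (MonoidAlgebra.single g 1)) y ∈ R)

/-- The logarithmic derivations `y ↦ g⁻¹ {g, y}` of `R`. -/
noncomputable def logDerivation : DerivationFamily (PC.restrict R hR) G where
  d g :=
    { toFun := fun y => ⟨_, hs g y⟩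
      map_add' := fun x y => by ext; simp [mul_add]
      map_smul' := fun c x => by ext; simp }
  d_group_mul g t x := by
    ext
    change ι _ * PC.br (ι _) _ = ι _ * PC.br (ι _) _ + ι _ * PC.br (ι _) _
    rw [map_single_mul, mul_inv, map_single_mul, br_mul_left]
    linear_combination (ι (.single g⁻¹ 1) * PC.br (ι (.single g 1)) x) *
      map_single_inv_mul (ι := ι) t + (ι (.single t⁻¹ 1) * PC.br (ι (.single t 1)) x) *
      map_single_inv_mul (ι := ι) g
  d_comm g t x := by
    ext
    change ι _ * PC.br (ι _) (ι _ * PC.br (ι _) _) = ι _ * PC.br (ι _) (ι _ * PC.br (ι _) _)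
    -- As {g, t⁻¹} = 0, the prefactors come out of the brackets; {g, t} = 0 and the Jacobi identity
    -- exchange the two brackets.
    rw [PC.leibniz, PC.leibniz, br_map_map hι, br_map_map hι,
      PC.br_br (ι (.single g 1)) (ι (.single t 1)), br_map_map hι]
    simp only [zero_mul, map_zero, LinearMap.zero_apply, zero_add]
    ring
  d_mul g x y := by
    ext
    change ι _ * PC.br (ι _) ((x : C) * y) = (ι _ * PC.br (ι _) _) * _ + _ * (ι _ * PC.br (ι _) _)
    rw [PC.leibniz]
    ring
  d_br g x y := by
    ext
    change ι _ * PC.br (ι _) (PC.br x y) = PC.br (ι _ * PC.br (ι _) _) _ +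
      PC.br _ (ι _ * PC.br (ι _) _)
    -- Beyond the Jacobi identity, the Leibniz rule leaves the terms {g⁻¹, y}{g, x} and {x, g⁻¹}{g,
    -- y}. They are -g⁻²{g, y}{g, x} and its negative.
    rw [br_mul_left, PC.leibniz, PC.br_br (ι (.single g 1)), br_map_single_inv,
      PC.br_skew x (ι _), br_map_single_inv]
    ring

theorem coe_logDerivation (g : G) (y : R) : ((logDerivation hι hR hs).d g y : C) =
    ι (MonoidAlgebra.single g⁻¹ 1) * PC.br (ι (MonoidAlgebra.single g 1)) y := rfl

theorem br_map_single (g : G) (y : R) : PC.br (ι (MonoidAlgebra.single g 1)) y =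
    ι (MonoidAlgebra.single g 1) * (logDerivation hι hR hs).d g y := by
  rw [coe_logDerivation]
  linear_combination -PC.br (ι (.single g 1)) y * map_single_inv_mul (ι := ι) g

/-- One has {y, g⁻¹} = g⁻¹ d_g(y), and g⁻¹ passes through {g, -}. This accounts for the term m_{{g,
{y, g⁻¹}}} in the action and shows that it is well defined on R. -/
theorem coe_logDerivation_logDerivation (g : G) (y : R) :
    ((logDerivation hι hR hs).d g ((logDerivation hι hR hs).d g y) : C) =
      PC.br (ι (MonoidAlgebra.single g 1)) (PC.br y (ι (MonoidAlgebra.single g⁻¹ 1))) := by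
  rw [PC.br_skew y, br_map_single_inv, coe_logDerivation, coe_logDerivation, neg_neg,
    PC.leibniz _ (ι (.single g⁻¹ 1)) (ι (.single g⁻¹ 1) * _), br_map_map hι, zero_mul, zero_add]

/-- The restriction of `C^e` along the inclusion of a Poisson subalgebra `R`. -/
noncomputable abbrev envVal : Env (PC.restrict R hR) →ₐ[k] Env PC :=
  Env.map R.val (PC.isHom_val R hR)

/-- On h_y it follows from {y, g} = -g d_g(y); the extra term m_{g d_g(y)} is absorbed by the twist.
-/
theorem m_mul_envVal (g : G) (b : Env (PC.restrict R hR)) :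
    Env.m PC (ι (MonoidAlgebra.single g 1)) * envVal hR b =
      envVal hR ((logDerivation hι hR hs).twist g b) * Env.m PC (ι (MonoidAlgebra.single g 1)) := by
  induction b using Env.induction with
  | algebraMap c => simp only [AlgHom.commutes, Algebra.commutes]
  | m y =>
    rw [DerivationFamily.twist_m, Env.map_m]
    exact Env.m_mul_m_comm _ _
  | h y =>
    rw [DerivationFamily.twist_h, map_add, Env.map_m, Env.map_h]
    change _ * Env.h PC (y : C) = (Env.h PC (y : C) + Env.m PC _) * _
    rw [add_mul, Env.h_mul_m, PC.br_skew, br_map_single hι hR hs, ← map_mul, add_assoc, ← map_add,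
      mul_comm]
    change _ = _ + Env.m PC (- (_ * _) + ((logDerivation hι hR hs).d g y : C) * _)
    rw [neg_add_cancel, map_zero, add_zero]
  | mul a b ha hb => rw [map_mul, map_mul, map_mul, ← mul_assoc, ha, mul_assoc, hb, mul_assoc]
  | add a b ha hb => simp only [map_add, mul_add, add_mul, ha, hb]

/-- On h_y one expands h of {g, y} = g d_g(y) by the product rule: m_{d_g(y)} h_g belongs to the
twist of h_y, and m_g h_{d_g(y)} is the twisted derivative moved past m_g. -/
theorem h_mul_envVal (g : G) (b : Env (PC.restrict R hR)) :
    Env.h PC (ι (MonoidAlgebra.single g 1)) * envVal hR b =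
      envVal hR ((logDerivation hι hR hs).twist g b) * Env.h PC (ι (MonoidAlgebra.single g 1)) +
      envVal hR ((logDerivation hι hR hs).twist g ((logDerivation hι hR hs).der g b)) *
        Env.m PC (ι (MonoidAlgebra.single g 1)) := by
  induction b using Env.induction with
  | algebraMap c =>
    simp only [AlgHom.commutes, Algebra.commutes, DerivationFamily.der_algebraMap, map_zero,
      zero_mul, add_zero]
  | m y =>
    rw [DerivationFamily.der_m, DerivationFamily.twist_m, DerivationFamily.twist_m, Env.map_m,
      Env.map_m]
    change _ * Env.m PC (y : C) = Env.m PC (y : C) * _ + Env.m PC _ * _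
    rw [Env.h_mul_m, br_map_single hι hR hs, ← map_mul, mul_comm (ι _)]
    rfl
  | h y =>
    rw [DerivationFamily.der_h, ← m_mul_envVal, DerivationFamily.twist_h, map_add, Env.map_m, Env.map_h,
      Env.map_h]
    change _ * Env.h PC (y : C) = (Env.h PC (y : C) + Env.m PC ((logDerivation hι hR hs).d g y : C))
      * _ + _ * Env.h PC ((logDerivation hι hR hs).d g y : C)
    rw [Env.h_mul_h, br_map_single hι hR hs, Env.h_mul]
    noncomm_ring
  | mul a b ha hb =>
    simp only [map_mul, DerivationFamily.der_mul, map_add]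
    rw [← mul_assoc, ha, add_mul, mul_assoc, hb, mul_assoc (envVal hR _) (Env.m PC _),
      m_mul_envVal hι hR hs]
    noncomm_ring
  | add a b ha hb =>
    simp only [map_add, mul_add, add_mul, ha, hb]
    abel

end LogDerivation

/-! ### Checking maps from `A^e # (kG)^e` on generators -/

namespace DerivationFamily
open ModuleAlgebra

variable {k : Type v} {A : Type u} [Field k] [CommRing A] [Algebra k A]
  {P : PoissonBracket k A} {G : Type w} [CommGroup G] (D : DerivationFamily P G)

/-- The commutation rule of `A^e # (kG)^e` need only be checked on the generators of `(kG)^e`. -/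
theorem mul_eq_of_generators {E : Type*} [Ring E] [Algebra k E] (f : Env P →ₐ[k] E)
    (g : Env (trivial k (MonoidAlgebra k G)) →ₐ[k] E)
    (hm : ∀ t b, g (gm k t) * f b = f (D.twist t b) * g (gm k t))
    (hh : ∀ t b, g (gh k t) * f b =
      f (D.twist t b) * g (gh k t) + f (D.twist t (D.der t b)) * g (gm k t))
    (x : Env (trivial k (MonoidAlgebra k G))) (b : Env P) :
    g x * f b = LinearMap.mul' k E
      (TensorProduct.map f.toLinearMap g.toLinearMap (Smash.diag D.moduleAlgebra x (b ⊗ₜ 1))) := by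
  let Φ : Env P ⊗[k] Env (trivial k (MonoidAlgebra k G)) →ₗ[k] E :=
    LinearMap.mul' k E ∘ₗ TensorProduct.map f.toLinearMap g.toLinearMap
  have hΦ : ∀ a x, Φ (a ⊗ₜ x) = f a * g x := fun _ _ => rfl
  have ext : ∀ x, (∀ b y, g x * (f b * g y) = Φ (Smash.diag D.moduleAlgebra x (b ⊗ₜ y))) →
      ∀ w, g x * Φ w = Φ (Smash.diag D.moduleAlgebra x w) := by
    intro x h w
    induction w with
    | zero => simp
    | add u v hu hv => simp only [map_add, mul_add, hu, hv]
    | tmul b y => rw [hΦ, h]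
  -- The statement is strengthened from b ⊗ 1 to arbitrary w, so that it is stable under products in
  -- x.
  have main : ∀ w, g x * Φ w = Φ (Smash.diag D.moduleAlgebra x w) := by
    induction x using env_monoidAlgebra_induction with
    | algebraMap c =>
      intro w
      rw [AlgHom.commutes, AlgHom.commutes, Module.algebraMap_end_apply, map_smul,
        Algebra.smul_def]
    | m t =>
      refine ext _ fun b y => ?_
      have h := D.diag_gm t b
      rw [gm] at h
      rw [Smash.diag_mulRight, h, LinearMap.lTensor_tmul, hΦ, LinearMap.mulRight_apply, map_mul,
        ← mul_assoc, ← mul_assoc]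
      exact congrArg (· * g y) (hm t b)
    | h t =>
      refine ext _ fun b y => ?_
      have h := D.diag_gh t b
      rw [gh] at h
      rw [Smash.diag_mulRight, h, map_add, map_add, LinearMap.lTensor_tmul, LinearMap.lTensor_tmul,
        hΦ, hΦ, LinearMap.mulRight_apply, LinearMap.mulRight_apply, map_mul, map_mul,
        ← mul_assoc, ← mul_assoc, ← mul_assoc, ← add_mul]
      exact congrArg (· * g y) (hh t b)
    | mul x y hx hy =>
      intro w
      rw [map_mul, map_mul, mul_assoc, hy, hx, Module.End.mul_apply]
    | add x y hx hy =>
      intro w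
      rw [map_add, map_add, add_mul, hx, hy, LinearMap.add_apply, map_add]
  have := main (b ⊗ₜ 1)
  rwa [hΦ, map_one, mul_one] at this

theorem algHom_ext {E : Type*} [Ring E] [Algebra k E] {F F' : D.SmashEnv →ₐ[k] E}
    (hm : ∀ r, F (D.jA (Env.m P r)) = F' (D.jA (Env.m P r)))
    (hh : ∀ r, F (D.jA (Env.h P r)) = F' (D.jA (Env.h P r)))
    (hgm : ∀ g, F (D.jG (gm k g)) = F' (D.jG (gm k g)))
    (hgh : ∀ g, F (D.jG (gh k g)) = F' (D.jG (gh k g))) : F = F' := by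
  refine Smash.algHom_ext _ (Env.algHom_ext hm hh) (AlgHom.ext fun x => ?_)
  change F (D.jG x) = F' (D.jG x)
  induction x using env_monoidAlgebra_induction with
  | algebraMap c => simp only [AlgHom.commutes]
  | m g => exact hgm g
  | h g => exact hgh g
  | mul x y hx hy => simp only [map_mul, hx, hy]
  | add x y hx hy => simp only [map_add, hx, hy]

end DerivationFamily

end PoissonBracket

/-! ### The isomorphism `Φ` and its inverse -/

namespace PoissonBracket

open ModuleAlgebra DerivationFamily

variable {k : Type v} {C : Type u} [Field k] [CommRing C] [Algebra k C]
  {PC : PoissonBracket k C} {G : Type w} [CommGroup G] {ι : MonoidAlgebra k G →ₐ[k] C}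
  (hι : (trivial k (MonoidAlgebra k G)).IsHom PC ι) {R : Subalgebra k C}
  (hR : ∀ x ∈ R, ∀ y ∈ R, PC.br x y ∈ R)
  (hs : ∀ (g : G) (y : R), ι (MonoidAlgebra.single g⁻¹ 1) *
    PC.br (ι (MonoidAlgebra.single g 1)) y ∈ R)

/-- The algebra map `a # x ↦ Ψ(a) ι^e(x)`. -/
noncomputable def smashHom : (logDerivation hι hR hs).SmashEnv →ₐ[k] Env PC :=
  Smash.lift _ (envVal hR) (Env.map ι hι)
    ((logDerivation hι hR hs).mul_eq_of_generators _ _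
      (fun t b => by rw [gm, Env.map_m, m_mul_envVal hι hR hs])
      (fun t b => by rw [gm, gh, Env.map_m, Env.map_h, h_mul_envVal hι hR hs]))

theorem smashHom_mk (a : Env (PC.restrict R hR)) (x : Env (trivial k (MonoidAlgebra k G))) :
    smashHom hι hR hs (Smash.mk _ a x) = envVal hR a * Env.map ι hι x := rfl

theorem smashHom_jA (a : Env (PC.restrict R hR)) :
    smashHom hι hR hs ((logDerivation hι hR hs).jA a) = envVal hR a := by
  refine (smashHom_mk hι hR hs a 1).trans ?_
  rw [map_one, mul_one]

theorem smashHom_jG (x : Env (trivial k (MonoidAlgebra k G))) :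
    smashHom hι hR hs ((logDerivation hι hR hs).jG x) = Env.map ι hι x := by
  refine (smashHom_mk hι hR hs 1 x).trans ?_
  rw [map_one, one_mul]

section Inverse

theorem gh_one : gh k (1 : G) = 0 := Env.h_one

theorem jG_m_mul_jA_m (x : MonoidAlgebra k G) (r : R) :
    (logDerivation hι hR hs).jG (Env.m _ x) * (logDerivation hι hR hs).jA (Env.m _ r) =
      (logDerivation hι hR hs).jA (Env.m _ r) * (logDerivation hι hR hs).jG (Env.m _ x) := by
  induction x using MonoidAlgebra.induction_on with
  | of g =>
    have := (logDerivation hι hR hs).jG_gm_mul_jA g (Env.m _ r)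
    rwa [twist_m] at this
  | add x y hx hy => simp only [map_add, add_mul, mul_add, hx, hy]
  | smul c x hx => simp only [map_smul, smul_mul_assoc, mul_smul_comm, hx]

variable (hb : Function.Bijective (Algebra.TensorProduct.productMap R.val ι))

/-- The isomorphism `R ⊗ kG ≃ C`. -/
noncomputable def biproductEquiv : R ⊗[k] MonoidAlgebra k G ≃ₐ[k] C := AlgEquiv.ofBijective _ hb

include hb in
theorem biproduct_induction {p : C → Prop} (mul : ∀ (r : R) (g : G), p (r * ι (.single g 1)))
    (add : ∀ x y, p x → p y → p (x + y)) (c : C) : p c := by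
  obtain ⟨w, rfl⟩ := hb.2 c
  have zero : p 0 := by simpa using mul 0 1
  induction w with
  | zero => rwa [map_zero]
  | add x y hx hy => rw [map_add]; exact add _ _ hx hy
  | tmul r x =>
    rw [Algebra.TensorProduct.productMap_apply_tmul]
    induction x using MonoidAlgebra.induction_on generalizing r with
    | of g => exact mul r g
    | add x y hx hy => rw [map_add, mul_add]; exact add _ _ (hx r) (hy r)
    | smul c x hx =>
      have := hx (c • r)
      rwa [map_smul, smul_mul_assoc, ← mul_smul_comm, ← map_smul] at this

/-- The map `C → R^e # (kG)^e` with `rg ↦ m_r # m_g`. -/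
noncomputable def smashM : C →ₐ[k] (logDerivation hι hR hs).SmashEnv :=
  (Algebra.TensorProduct.lift
    ((logDerivation hι hR hs).jA.comp (Env.m _)) ((logDerivation hι hR hs).jG.comp (Env.m _))
    (fun r x => (jG_m_mul_jA_m hι hR hs x r).symm)).comp (biproductEquiv hb).symm.toAlgHom

/-- The map `C → R^e # (kG)^e` with `rg ↦ m_r # h_g + (1 # m_g)(h_r # 1)`. -/
noncomputable def smashH : C →ₗ[k] (logDerivation hι hR hs).SmashEnv :=
  TensorProduct.lift (
    (LinearMap.mul k (logDerivation hι hR hs).SmashEnv).compl₁₂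
      ((logDerivation hι hR hs).jA.comp (Env.m _)).toLinearMap
      ((logDerivation hι hR hs).jG.toLinearMap ∘ₗ (Env.h _)) +
    (LinearMap.mul k (logDerivation hι hR hs).SmashEnv).flip.compl₁₂
      ((logDerivation hι hR hs).jA.toLinearMap ∘ₗ (Env.h _))
      ((logDerivation hι hR hs).jG.comp (Env.m _)).toLinearMap) ∘ₗ
    (biproductEquiv hb).symm.toLinearMap

theorem biproductEquiv_symm_mul (r : R) (x : MonoidAlgebra k G) :
    (biproductEquiv hb).symm (r * ι x) = r ⊗ₜ x := by
  rw [AlgEquiv.symm_apply_eq]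
  rfl

theorem smashM_mul (r : R) (g : G) : smashM hι hR hs hb (r * ι (.single g 1)) =
    (logDerivation hι hR hs).jA (Env.m _ r) * (logDerivation hι hR hs).jG (gm k g) := by
  rw [smashM, AlgHom.comp_apply]
  exact congrArg _ (biproductEquiv_symm_mul hb r _)

theorem smashH_mul (r : R) (g : G) : smashH hι hR hs hb (r * ι (.single g 1)) =
    (logDerivation hι hR hs).jA (Env.m _ r) * (logDerivation hι hR hs).jG (gh k g) +
    (logDerivation hι hR hs).jG (gm k g) * (logDerivation hι hR hs).jA (Env.h _ r) := by
  change TensorProduct.lift _ ((biproductEquiv hb).symm _) = _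
  rw [biproductEquiv_symm_mul]
  rfl

theorem smashM_mul' (r : R) (g : G) : smashM hι hR hs hb (r * ι (.single g 1)) =
    (logDerivation hι hR hs).jG (gm k g) * (logDerivation hι hR hs).jA (Env.m _ r) := by
  rw [smashM_mul]
  exact (jG_m_mul_jA_m hι hR hs _ r).symm

/-- The normal form m_g (m_r l_g + h_r): the group part is a left factor, and the rest moves past
elements of R^e by derivations. -/
theorem smashH_mul' (r : R) (g : G) : smashH hι hR hs hb (r * ι (.single g 1)) =
    (logDerivation hι hR hs).jG (gm k g) *
      ((logDerivation hι hR hs).jA (Env.m _ r) * (logDerivation hι hR hs).jG (gl k g) +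
        (logDerivation hι hR hs).jA (Env.h _ r)) := by
  rw [smashH_mul, ← gm_mul_gl, map_mul, mul_add, ← mul_assoc, ← mul_assoc, gm,
    jG_m_mul_jA_m hι hR hs]

theorem smashH_mul_group (r : R) (g t : G) : smashH hι hR hs hb (r * ι (.single (g * t) 1)) =
    (logDerivation hι hR hs).jG (gm k g) * (logDerivation hι hR hs).jG (gm k t) *
      ((logDerivation hι hR hs).jA (Env.m _ r) * ((logDerivation hι hR hs).jG (gl k g) +
        (logDerivation hι hR hs).jG (gl k t)) + (logDerivation hι hR hs).jA (Env.h _ r)) := by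
  rw [smashH_mul, gm_mul_gl_mul, ← gm_mul, map_mul, ← mul_assoc, gm,
    ← jG_m_mul_jA_m hι hR hs, mul_assoc, ← mul_add, ← gm, gm_mul, map_mul, map_add]

/-- The commutation of `h_r` with `m_g`. -/
theorem jA_h_mul_jG_gm (r : R) (g : G) :
    (logDerivation hι hR hs).jA (Env.h _ r) * (logDerivation hι hR hs).jG (gm k g) =
      (logDerivation hι hR hs).jG (gm k g) * ((logDerivation hι hR hs).jA (Env.h _ r) -
        (logDerivation hι hR hs).jA (Env.m _ ((logDerivation hι hR hs).d g r))) := by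
  rw [mul_sub, jG_gm_mul_jA, jG_gm_mul_jA, twist_m, twist_h, map_add, add_mul, add_sub_cancel_right]

theorem log_mul_jG_gm (r : R) (g t : G) :
    ((logDerivation hι hR hs).jA (Env.m _ r) * (logDerivation hι hR hs).jG (gl k g) +
        (logDerivation hι hR hs).jA (Env.h _ r)) * (logDerivation hι hR hs).jG (gm k t) =
      (logDerivation hι hR hs).jG (gm k t) *
      ((logDerivation hι hR hs).jA (Env.m _ r) * (logDerivation hι hR hs).jG (gl k g) +
        (logDerivation hι hR hs).jA (Env.h _ r) -
        (logDerivation hι hR hs).jA (Env.m _ ((logDerivation hι hR hs).d t r))) := by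
  rw [add_mul, jA_h_mul_jG_gm, mul_assoc, ← map_mul, gl_mul_gm, map_mul, ← mul_assoc, gm,
    ← jG_m_mul_jA_m hι hR hs, mul_sub, mul_sub, mul_add, add_sub_assoc, mul_assoc]

/-- The Leibniz rule with {g, t} = 0, {g, s} = g d_g(s) and {r, t} = -t d_t(r). -/
theorem br_mul_mul (r s : R) (g t : G) :
    PC.br (r * ι (.single g 1)) (s * ι (.single t 1)) =
      (((PC.restrict R hR).br r s - s * (logDerivation hι hR hs).d t r +
        r * (logDerivation hι hR hs).d g s : R) : C) * ι (.single (g * t) 1) := by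
  rw [PC.leibniz, PC.br_mul_left, PC.br_mul_left, br_map_map hι, PC.br_skew r (ι _),
    br_map_single hι hR hs, br_map_single hι hR hs, map_single_mul]
  push_cast
  rw [coe_restrict_br]
  ring

/-- Dictionary for the three relations, for the elements rg and st: a, b are m_r, m_s; x, y are h_r,
h_s; p, q are m_g, m_t; D, T are l_g, l_t; z, w are m and h of {r, s}; d₁, e₁ are m and h of d_t(r);
d₂, e₂ are m and h of d_g(s). -/
theorem relation_m_br {S : Type*} [Ring S] {a b x p q D z d₁ d₂ : S}
    (hpq : p * q = q * p) (hbp : b * p = p * b) (hab : a * b = b * a) (hb₁ : b * d₁ = d₁ * b)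
    (hX : (a * D + x) * q = q * (a * D + x - d₁))
    (hDb : D * b = b * D + d₂) (hxb : x * b = b * x + z) :
    p * q * (z - b * d₁ + a * d₂) =
      p * (a * D + x) * (q * b) - q * b * (p * (a * D + x)) := by
  linear_combination (norm := noncomm_ring) -p * hX * b - p * q * hxb - p * q * a * hDb
    + p * q * hb₁ * (-1) + q * hbp * (a * D + x) - hpq * b * (a * D + x) - p * q * hab * D

theorem relation_h_mul {S : Type*} [Ring S] {a b x y p q D T : S}
    (hpq : p * q = q * p) (hbp : b * p = p * b) (haq : a * q = q * a) (hab : a * b = b * a) :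
    p * q * (a * b * (D + T) + (b * x + a * y)) =
      q * b * (p * (a * D + x)) + p * a * (q * (b * T + y)) := by
  linear_combination (norm := noncomm_ring) -q * hbp * (a * D + x) - p * haq * (b * T + y)
    + hpq * b * (a * D + x) + p * q * hab * D

theorem relation_h_br {S : Type*} [Ring S] {a b x y p q D T z w d₁ d₂ e₁ e₂ : S}
    (hpq : p * q = q * p) (hab : a * b = b * a) (hb₁ : b * d₁ = d₁ * b) (ha₂ : a * d₂ = d₂ * a)
    (hX : (a * D + x) * q = q * (a * D + x - d₁)) (hY : (b * T + y) * p = p * (b * T + y - d₂))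
    (hDb : D * b = b * D + d₂) (hDy : D * y = y * D + e₂) (hTa : T * a = a * T + d₁)
    (hTx : T * x = x * T + e₁) (hxb : x * b = b * x + z) (hxy : x * y = y * x + w)
    (hya : y * a = a * y - z) (hDT : D * T = T * D) :
    p * q * ((z - b * d₁ + a * d₂) * (D + T) + (w - (d₁ * y + b * e₁) + (d₂ * x + a * e₂))) =
      p * (a * D + x) * (q * (b * T + y)) - q * (b * T + y) * (p * (a * D + x)) := by
  -- The commutator is first computed without the group factors; moving q and p through then
  -- contributes the corrections d₁ and d₂.
  have h : (a * D + x) * (b * T + y) - (b * T + y) * (a * D + x) =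
      a * d₂ * T + a * e₂ + z * T + w - b * d₁ * D - b * e₁ + z * D := by
    linear_combination (norm := noncomm_ring) a * hDb * T + a * hDy + hxb * T + hxy - b * hTa * D
      - b * hTx - hya * D + hab * D * T + b * a * hDT
  linear_combination (norm := noncomm_ring) -p * hX * (b * T + y) + q * hY * (a * D + x)
    - p * q * h - p * q * hb₁ * T + p * q * ha₂ * D
    - hpq * (b * T + y - d₂) * (a * D + x)

theorem jG_gm_comm (D : DerivationFamily (PC.restrict R hR) G) (g t : G) :
    D.jG (gm k g) * D.jG (gm k t) = D.jG (gm k t) * D.jG (gm k g) := by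
  rw [← map_mul, gm_comm, map_mul]

theorem jA_m_comm (D : DerivationFamily (PC.restrict R hR) G) (r s : R) :
    D.jA (Env.m _ r) * D.jA (Env.m _ s) = D.jA (Env.m _ s) * D.jA (Env.m _ r) := by
  rw [← map_mul, Env.m_mul_m_comm, map_mul]

theorem jG_gl_mul_jA_m (D : DerivationFamily (PC.restrict R hR) G) (g : G) (s : R) :
    D.jG (gl k g) * D.jA (Env.m _ s) =
      D.jA (Env.m _ s) * D.jG (gl k g) + D.jA (Env.m _ (D.d g s)) := by
  rw [jG_gl_mul_jA, der_m]

theorem jG_gl_mul_jA_h (D : DerivationFamily (PC.restrict R hR) G) (g : G) (s : R) :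
    D.jG (gl k g) * D.jA (Env.h _ s) =
      D.jA (Env.h _ s) * D.jG (gl k g) + D.jA (Env.h _ (D.d g s)) := by
  rw [jG_gl_mul_jA, der_h]

theorem jA_h_mul_jA_m (D : DerivationFamily (PC.restrict R hR) G) (r s : R) :
    D.jA (Env.h _ r) * D.jA (Env.m _ s) =
      D.jA (Env.m _ s) * D.jA (Env.h _ r) + D.jA (Env.m _ ((PC.restrict R hR).br r s)) := by
  rw [← map_mul, Env.h_mul_m, map_add, map_mul]

theorem jA_h_mul_jA_h (D : DerivationFamily (PC.restrict R hR) G) (r s : R) :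
    D.jA (Env.h _ r) * D.jA (Env.h _ s) =
      D.jA (Env.h _ s) * D.jA (Env.h _ r) + D.jA (Env.h _ ((PC.restrict R hR).br r s)) := by
  rw [← map_mul, Env.h_mul_h, map_add, map_mul]

theorem smashM_br (x y : C) : smashM hι hR hs hb (PC.br x y) =
    smashH hι hR hs hb x * smashM hι hR hs hb y - smashM hι hR hs hb y * smashH hι hR hs hb x := by
  induction x using biproduct_induction hb with
  | add x x' hx hx' => simp only [map_add, LinearMap.add_apply, add_mul, mul_add, hx, hx']; abel
  | mul r g =>
    induction y using biproduct_induction hb with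
    | add x x' hx hx' => simp only [map_add, add_mul, mul_add, hx, hx']; abel
    | mul s t =>
      rw [br_mul_mul hι hR hs, smashM_mul', smashM_mul', smashH_mul', gm_mul, map_mul]
      simp only [map_add, map_sub, map_mul]
      exact relation_m_br (jG_gm_comm hR _ _ _) (jG_m_mul_jA_m hι hR hs _ _).symm
        (jA_m_comm hR _ _ _) (jA_m_comm hR _ _ _) (log_mul_jG_gm hι hR hs _ _ _)
        (jG_gl_mul_jA_m hR _ _ _) (jA_h_mul_jA_m hR _ _ _)

theorem smashH_mul_mul (x y : C) : smashH hι hR hs hb (x * y) =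
    smashM hι hR hs hb y * smashH hι hR hs hb x + smashM hι hR hs hb x * smashH hι hR hs hb y := by
  induction x using biproduct_induction hb with
  | add x x' hx hx' => simp only [map_add, add_mul, mul_add, hx, hx']; abel
  | mul r g =>
    induction y using biproduct_induction hb with
    | add x x' hx hx' => simp only [map_add, add_mul, mul_add, hx, hx']; abel
    | mul s t =>
      have e : (r : C) * ι (.single g 1) * (s * ι (.single t 1)) =
          ((r * s : R) : C) * ι (.single (g * t) 1) := by
        rw [map_single_mul]
        push_cast
        ring
      rw [e, smashH_mul_group, smashH_mul', smashH_mul', smashM_mul', smashM_mul', Env.h_mul]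
      simp only [map_add, map_mul]
      exact relation_h_mul (jG_gm_comm hR _ _ _) (jG_m_mul_jA_m hι hR hs _ _).symm
        (jG_m_mul_jA_m hι hR hs _ _).symm (jA_m_comm hR _ _ _)

theorem smashH_br (x y : C) : smashH hι hR hs hb (PC.br x y) =
    smashH hι hR hs hb x * smashH hι hR hs hb y - smashH hι hR hs hb y * smashH hι hR hs hb x := by
  induction x using biproduct_induction hb with
  | add x x' hx hx' => simp only [map_add, LinearMap.add_apply, add_mul, mul_add, hx, hx']; abel
  | mul r g =>
    induction y using biproduct_induction hb with
    | add x x' hx hx' => simp only [map_add, add_mul, mul_add, hx, hx']; abel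
    | mul s t =>
      rw [br_mul_mul hι hR hs, smashH_mul_group, smashH_mul', smashH_mul']
      simp only [map_add, map_sub, map_mul, Env.h_mul]
      -- The commutator of h_s and m_r involves {s, r}, rewritten here as -{r, s} so that a single
      -- letter z suffices.
      have hya := jA_h_mul_jA_m hR (logDerivation hι hR hs) s r
      rw [br_skew, map_neg, map_neg, ← sub_eq_add_neg] at hya
      have hDT : (logDerivation hι hR hs).jG (gl k g) * (logDerivation hι hR hs).jG (gl k t) =
          (logDerivation hι hR hs).jG (gl k t) * (logDerivation hι hR hs).jG (gl k g) := by
        rw [← map_mul, gl_comm, map_mul]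
      exact relation_h_br (jG_gm_comm hR _ _ _)
        (jA_m_comm hR _ _ _) (jA_m_comm hR _ _ _) (jA_m_comm hR _ _ _)
        (log_mul_jG_gm hι hR hs _ _ _) (log_mul_jG_gm hι hR hs _ _ _)
        (jG_gl_mul_jA_m hR _ _ _) (jG_gl_mul_jA_h hR _ _ _) (jG_gl_mul_jA_m hR _ _ _)
        (jG_gl_mul_jA_h hR _ _ _) (jA_h_mul_jA_m hR _ _ _) (jA_h_mul_jA_h hR _ _ _) hya hDT

/-- The inverse of `smashHom`. -/
noncomputable def smashInv : Env PC →ₐ[k] (logDerivation hι hR hs).SmashEnv :=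
  Env.lift (smashM hι hR hs hb) (smashH hι hR hs hb) (smashH_br hι hR hs hb)
    (smashH_mul_mul hι hR hs hb) (smashM_br hι hR hs hb)

theorem smashHom_smashM (c : C) : smashHom hι hR hs (smashM hι hR hs hb c) = Env.m PC c := by
  induction c using biproduct_induction hb with
  | mul r g =>
    rw [smashM_mul, map_mul, smashHom_jA, smashHom_jG, gm, Env.map_m, Env.map_m, map_mul]
    rfl
  | add x y hx hy => simp only [map_add, hx, hy]

theorem smashHom_smashH (c : C) : smashHom hι hR hs (smashH hι hR hs hb c) = Env.h PC c := by
  induction c using biproduct_induction hb with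
  | mul r g =>
    rw [smashH_mul, map_add, map_mul, map_mul, smashHom_jA, smashHom_jA, smashHom_jG, smashHom_jG,
      gm, gh, Env.map_m, Env.map_m, Env.map_h, Env.map_h, Env.h_mul, add_comm]
    rfl
  | add x y hx hy => simp only [map_add, hx, hy]

theorem smashHom_comp_smashInv :
    (smashHom hι hR hs).comp (smashInv hι hR hs hb) = AlgHom.id k (Env PC) :=
  Env.algHom_ext
    (fun x => (congrArg _ (Env.lift_m _ _ _ _ _ x)).trans (smashHom_smashM hι hR hs hb x))
    (fun x => (congrArg _ (Env.lift_h _ _ _ _ _ x)).trans (smashHom_smashH hι hR hs hb x))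

theorem smashInv_m (c : C) : smashInv hι hR hs hb (Env.m PC c) = smashM hι hR hs hb c :=
  Env.lift_m _ _ _ _ _ c

theorem smashInv_h (c : C) : smashInv hι hR hs hb (Env.h PC c) = smashH hι hR hs hb c :=
  Env.lift_h _ _ _ _ _ c

theorem smashInv_comp_smashHom :
    (smashInv hι hR hs hb).comp (smashHom hι hR hs) = AlgHom.id k _ := by
  refine DerivationFamily.algHom_ext _ (fun r => ?_) (fun r => ?_) (fun g => ?_) (fun g => ?_) <;>
    rw [AlgHom.comp_apply, AlgHom.id_apply]
  · have := smashM_mul hι hR hs hb r 1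
    rw [map_single_one, mul_one, gm_one, map_one, mul_one] at this
    rw [smashHom_jA, Env.map_m, smashInv_m]
    exact this
  · have := smashH_mul hι hR hs hb r 1
    rw [map_single_one, mul_one, gm_one, map_one, one_mul, gh_one, map_zero, mul_zero,
      zero_add] at this
    rw [smashHom_jA, Env.map_h, smashInv_h]
    exact this
  · have := smashM_mul hι hR hs hb 1 g
    rw [OneMemClass.coe_one, one_mul, map_one, map_one, one_mul] at this
    rw [smashHom_jG, gm, Env.map_m, smashInv_m, this, gm]
  · have := smashH_mul hι hR hs hb 1 g
    rw [OneMemClass.coe_one, one_mul, map_one, map_one, one_mul, Env.h_one, map_zero, mul_zero,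
      add_zero] at this
    rw [smashHom_jG, gh, Env.map_h, smashInv_h, this, gh]

/-- The isomorphism `R^e # (kG)^e ≃ C^e`. -/
noncomputable def smashEquiv : (logDerivation hι hR hs).SmashEnv ≃ₐ[k] Env PC :=
  AlgEquiv.ofAlgHom (smashHom hι hR hs) (smashInv hι hR hs hb)
    (smashHom_comp_smashInv hι hR hs hb) (smashInv_comp_smashHom hι hR hs hb)

/-- Since m_1 = 1 and h_1 = 0, the case g = 1 determines F on m_r and h_r, and r = 1 determines it
on m_g and h_g. These generate the smash product. -/
theorem eq_smashEquiv_iff (F : (logDerivation hι hR hs).SmashEnv →ₐ[k] Env PC) :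
    F = (smashEquiv hι hR hs hb : (logDerivation hι hR hs).SmashEnv →ₐ[k] Env PC) ↔
      ∀ (r : R) (g : G),
        F (Smash.mk _ (Env.m _ r) (Env.m _ (.single g 1))) =
          Env.m PC (r * ι (.single g 1)) ∧
        F (Smash.mk _ (Env.m _ r) (Env.h _ (.single g 1)) +
          Smash.mk _ 1 (Env.m _ (.single g 1)) * Smash.mk _ (Env.h _ r) 1) =
          Env.h PC (r * ι (.single g 1)) := by
  have hS : ∀ (r : R) (g : G),
      smashHom hι hR hs (Smash.mk _ (Env.m _ r) (Env.m _ (.single g 1))) =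
          Env.m PC (r * ι (.single g 1)) ∧
      smashHom hι hR hs (Smash.mk _ (Env.m _ r) (Env.h _ (.single g 1)) +
          Smash.mk _ 1 (Env.m _ (.single g 1)) * Smash.mk _ (Env.h _ r) 1) =
          Env.h PC (r * ι (.single g 1)) := by
    intro r g
    rw [← smashHom_smashM hι hR hs hb, ← smashHom_smashH hι hR hs hb, smashM_mul, smashH_mul,
      jA_mul_jG, jA_mul_jG]
    exact ⟨rfl, rfl⟩
  change F = smashHom hι hR hs ↔ _
  refine ⟨fun h => h ▸ hS, fun h => ?_⟩
  have h1 : ∀ r g, F (Smash.mk _ (Env.m _ r) (gm k g)) =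
      smashHom hι hR hs (Smash.mk _ (Env.m _ r) (gm k g)) := fun r g =>
    (h r g).1.trans (hS r g).1.symm
  have h2 : ∀ r g, F (Smash.mk _ (Env.m _ r) (gh k g) +
      Smash.mk _ 1 (gm k g) * Smash.mk _ (Env.h _ r) 1) =
      smashHom hι hR hs (Smash.mk _ (Env.m _ r) (gh k g) +
      Smash.mk _ 1 (gm k g) * Smash.mk _ (Env.h _ r) 1) := fun r g =>
    (h r g).2.trans (hS r g).2.symm
  have mkjA : ∀ a, Smash.mk _ a 1 = (logDerivation hι hR hs).jA a := fun _ => rfl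
  have mkjG : ∀ x, Smash.mk _ 1 x = (logDerivation hι hR hs).jG x := fun _ => rfl
  have mk0 : ∀ a, Smash.mk (logDerivation hι hR hs).moduleAlgebra a 0 = 0 := fun a =>
    TensorProduct.tmul_zero _ a
  refine DerivationFamily.algHom_ext _ (fun r => ?_) (fun r => ?_) (fun g => ?_) (fun g => ?_)
  · have := h1 r 1
    rwa [gm_one, mkjA] at this
  · have := h2 r 1
    rwa [gm_one, gh_one, mk0, zero_add, ← Smash.one_eq, one_mul, mkjA] at this
  · have := h1 1 g
    rwa [map_one, mkjG] at this
  · have := h2 1 g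
    rwa [map_one, Env.h_one, mkjG, mkjA, map_zero, mul_zero, add_zero] at this

end Inverse

end PoissonBracket

/-! ### Coinvariants of Poisson bialgebra maps -/

namespace PoissonBracket

open Radford

variable {k : Type v} [Field k] {C : Type u} [CommRing C] [HopfAlgebra k C]
  {PC : PoissonBracket k C}

section Coinvariants

variable {H : Type w} [CommRing H] [Bialgebra k H] {π : C →ₐc[k] H}

/-- In Δ{x, y} the terms ac ⊗ {b, d} are killed by id ⊗ π, because the bracket of the target is
zero. -/
theorem coact_br [hPC : PC.IsPoissonBialgebra]
    (hπ : PC.IsHom (trivial k H) (π : C →ₐ[k] H)) (x y : C) :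
    coact π (PC.br x y) = TensorProduct.map₂ PC.br (LinearMap.mul k H) (coact π x) (coact π y) := by
  have h : ∀ u v : C ⊗[k] C,
      Algebra.TensorProduct.map (AlgHom.id k C) (π : C →ₐ[k] H) (PC.tensorBr u v) =
        TensorProduct.map₂ PC.br (LinearMap.mul k H)
          (Algebra.TensorProduct.map (AlgHom.id k C) (π : C →ₐ[k] H) u)
          (Algebra.TensorProduct.map (AlgHom.id k C) (π : C →ₐ[k] H) v) := by
    intro u v
    induction u with
    | zero => simp
    | add x y hx hy => simp only [map_add, LinearMap.add_apply, hx, hy]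
    | tmul a b =>
      induction v with
      | zero => simp
      | add x y hx hy => simp only [map_add, hx, hy]
      | tmul c d =>
        have hz : (π : C →ₐ[k] H) (PC.br b d) = 0 := hπ b d
        rw [tensorBr_tmul, map_add, Algebra.TensorProduct.map_tmul, Algebra.TensorProduct.map_tmul,
          hz, TensorProduct.tmul_zero, zero_add, map_mul, Algebra.TensorProduct.map_tmul,
          Algebra.TensorProduct.map_tmul, TensorProduct.map₂_apply_tmul]
        rfl
  change Algebra.TensorProduct.map (AlgHom.id k C) (π : C →ₐ[k] H) (Coalgebra.comul _) = _
  rw [hPC.comul_br, h]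
  rfl

theorem br_mem_rightCoinvariants [hPC : PC.IsPoissonBialgebra]
    (hπ : PC.IsHom (trivial k H) (π : C →ₐ[k] H)) {x y : C}
    (hx : x ∈ rightCoinvariants (π : C →ₐ[k] H)) (hy : y ∈ rightCoinvariants (π : C →ₐ[k] H)) :
    PC.br x y ∈ rightCoinvariants (π : C →ₐ[k] H) := by
  rw [mem_rightCoinvariants] at *
  rw [coact_br hπ, hx, hy, TensorProduct.map₂_apply_tmul, TensorProduct.map_tmul,
    LinearMap.mul_apply', mul_one]

theorem coact_of_comul_eq {c : C} (hc : Coalgebra.comul (R := k) c = c ⊗ₜ c) :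
    coact π c = c ⊗ₜ π c := by
  change Algebra.TensorProduct.map (AlgHom.id k C) (π : C →ₐ[k] H) (Coalgebra.comul _) = _
  rw [hc]
  rfl

theorem map_m_map_m (hπ : PC.IsHom (trivial k H) (π : C →ₐ[k] H)) (u : C ⊗[k] C) :
    Algebra.TensorProduct.map (AlgHom.id k (Env PC)) (Env.map (π : C →ₐ[k] H) hπ)
      (TensorProduct.map (Env.m PC).toLinearMap (Env.m PC).toLinearMap u) =
    TensorProduct.map (Env.m PC).toLinearMap (Env.m (trivial k H)).toLinearMap
      (Algebra.TensorProduct.map (AlgHom.id k C) (π : C →ₐ[k] H) u) := by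
  induction u with
  | zero => simp
  | add x y hx hy => simp only [map_add, hx, hy]
  | tmul a b => simp [Env.map_m]

theorem map_m_map_h (hπ : PC.IsHom (trivial k H) (π : C →ₐ[k] H)) (u : C ⊗[k] C) :
    Algebra.TensorProduct.map (AlgHom.id k (Env PC)) (Env.map (π : C →ₐ[k] H) hπ)
      (TensorProduct.map (Env.m PC).toLinearMap (Env.h PC) u) =
    TensorProduct.map (Env.m PC).toLinearMap (Env.h (trivial k H))
      (Algebra.TensorProduct.map (AlgHom.id k C) (π : C →ₐ[k] H) u) := by
  induction u with
  | zero => simp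
  | add x y hx hy => simp only [map_add, hx, hy]
  | tmul a b => simp [Env.map_h]

theorem map_h_map_m (hπ : PC.IsHom (trivial k H) (π : C →ₐ[k] H)) (u : C ⊗[k] C) :
    Algebra.TensorProduct.map (AlgHom.id k (Env PC)) (Env.map (π : C →ₐ[k] H) hπ)
      (TensorProduct.map (Env.h PC) (Env.m PC).toLinearMap u) =
    TensorProduct.map (Env.h PC) (Env.m (trivial k H)).toLinearMap
      (Algebra.TensorProduct.map (AlgHom.id k C) (π : C →ₐ[k] H) u) := by
  induction u with
  | zero => simp
  | add x y hx hy => simp only [map_add, hx, hy]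
  | tmul a b => simp [Env.map_m]

/-- Coinvariants form a subalgebra, so generators suffice. For h_y with y ∈ R the coaction is m_y ⊗
h_1 + h_y ⊗ m_1, and h_1 = 0. -/
theorem envVal_mem_rightCoinvariants [hPC : PC.IsPoissonBialgebra]
    (hπ : PC.IsHom (trivial k H) (π : C →ₐ[k] H))
    {R : Subalgebra k C} (hRπ : R = rightCoinvariants (π : C →ₐ[k] H))
    (hR : ∀ x ∈ R, ∀ y ∈ R, PC.br x y ∈ R) (a : Env (PC.restrict R hR)) :
    envVal hR a ∈ rightCoinvariants (Env.map (π : C →ₐ[k] H) hπ) := by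
  have hy : ∀ y : R, Algebra.TensorProduct.map (AlgHom.id k C) (π : C →ₐ[k] H)
      (Coalgebra.comul (R := k) (y : C)) = (y : C) ⊗ₜ 1 := by
    rintro ⟨y, hy⟩
    rw [hRπ, mem_rightCoinvariants] at hy
    exact hy
  induction a using Env.induction with
  | algebraMap c =>
    rw [AlgHom.commutes]
    exact Subalgebra.algebraMap_mem _ c
  | m y =>
    rw [Env.map_m]
    change Algebra.TensorProduct.map (AlgHom.id k (Env PC)) (Env.map (π : C →ₐ[k] H) hπ)
      (Coalgebra.comul (R := k) (Env.m PC (y : C))) = Env.m PC (y : C) ⊗ₜ 1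
    rw [Env.comul_m, map_m_map_m, hy, TensorProduct.map_tmul]
    simp
  | h y =>
    rw [Env.map_h]
    change Algebra.TensorProduct.map (AlgHom.id k (Env PC)) (Env.map (π : C →ₐ[k] H) hπ)
      (Coalgebra.comul (R := k) (Env.h PC (y : C))) = Env.h PC (y : C) ⊗ₜ 1
    rw [Env.comul_h, map_add, map_m_map_h, map_h_map_m, hy, TensorProduct.map_tmul,
      TensorProduct.map_tmul, Env.h_one]
    simp
  | mul a b ha hb =>
    rw [map_mul]
    exact mul_mem ha hb
  | add a b ha hb =>
    rw [map_add]
    exact add_mem ha hb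

end Coinvariants

section Group

variable {G : Type w} [CommGroup G] {ι : MonoidAlgebra k G →ₐc[k] C}
  {π : C →ₐc[k] MonoidAlgebra k G}

theorem coact_map_single (hπι : ∀ x, π (ι x) = x) (g : G) :
    coact π (ι (MonoidAlgebra.single g 1)) =
      ι (MonoidAlgebra.single g 1) ⊗ₜ MonoidAlgebra.single g 1 := by
  have h : Coalgebra.comul (R := k) (ι (MonoidAlgebra.single g 1)) =
      ι (MonoidAlgebra.single g 1) ⊗ₜ ι (MonoidAlgebra.single g 1) := by
    rw [← CoalgHomClass.map_comp_comul_apply, MonoidAlgebra.comul_single,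
      CommSemiring.comul_apply, TensorProduct.map_tmul, TensorProduct.map_tmul]
    rfl
  rw [coact_of_comul_eq h, hπι]

/-- The coaction of {g, y} is {g, y} ⊗ g, and the factor g⁻¹ ⊗ g⁻¹ from the coaction of g⁻¹ cancels
the g on the right. -/
theorem log_mem_rightCoinvariants [hPC : PC.IsPoissonBialgebra]
    (hπι : ∀ x, π (ι x) = x)
    (hπ : PC.IsHom (trivial k (MonoidAlgebra k G)) (π : C →ₐ[k] MonoidAlgebra k G)) (g : G) {y : C}
    (hy : y ∈ rightCoinvariants (π : C →ₐ[k] MonoidAlgebra k G)) :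
    ι (MonoidAlgebra.single g⁻¹ 1) * PC.br (ι (MonoidAlgebra.single g 1)) y ∈
      rightCoinvariants (π : C →ₐ[k] MonoidAlgebra k G) := by
  rw [mem_rightCoinvariants] at *
  rw [map_mul, coact_br hπ, hy, coact_map_single hπι, coact_map_single hπι,
    TensorProduct.map₂_apply_tmul, TensorProduct.map_tmul,
    Algebra.TensorProduct.tmul_mul_tmul, LinearMap.mul_apply', mul_one,
    MonoidAlgebra.single_mul_single, inv_mul_cancel, mul_one]
  rfl

end Group
end PoissonBracket

/-! ### Assembly -/

open GrAlg

theorem mainTheorem7 {k : Type v} [Field k] {B : Type u} [CommRing B] [HopfAlgebra k B]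
    (P : PoissonBracket k B) (hP : P.IsPoissonBialgebra) (hB : IsPointedCoalgebra k B)
    (hG : ∀ g t : B, IsGroupLikeElem k g → IsGroupLikeElem k t → P.br g t = 0) :
    -- the Poisson Hopf algebra `C = gr B`
    ∃ (C : Type u) (_ : CommRing C) (_ : HopfAlgebra k C) (PC : PoissonBracket k C)
      (_ : PC.IsPoissonBialgebra) (e : Gr k B ≃ₗ[k] C),
      IsAssociatedGraded P PC e ∧
      IsGradedPoissonHopf PC (grComponent e) ∧
      -- the inclusion of `kG` and the projection onto `kG`
      ∃ (ι : MonoidAlgebra k (GroupLike k B) →ₐc[k] C)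
        (π : C →ₐc[k] MonoidAlgebra k (GroupLike k B)),
        (∀ g : GroupLike k B, ∃ h : (g : B) ∈ coradFilt k B 0,
          ι (MonoidAlgebra.single g 1) = e (grCls k B 0 ⟨g, h⟩)) ∧
        (∀ x, π (ι x) = x) ∧
        (∀ n ≠ 0, ∀ x ∈ grComponent e n, π x = 0) ∧
        IsBiproduct ι π ∧
        -- both are Poisson maps, and `R` is a Poisson subalgebra, stable under the operations below
        ∃ (hι : (PoissonBracket.trivial k (MonoidAlgebra k (GroupLike k B))).IsHom PC
            (ι : MonoidAlgebra k (GroupLike k B) →ₐ[k] C))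
          (hπ : PC.IsHom (PoissonBracket.trivial k (MonoidAlgebra k (GroupLike k B)))
            (π : C →ₐ[k] MonoidAlgebra k (GroupLike k B)))
          (R : Subalgebra k C)
          (_ : R = rightCoinvariants (π : C →ₐ[k] MonoidAlgebra k (GroupLike k B)))
          (hR : ∀ x ∈ R, ∀ y ∈ R, PC.br x y ∈ R)
          (hs : ∀ (g : GroupLike k B) (y : R), ι (MonoidAlgebra.single g⁻¹ 1) *
            PC.br (ι (MonoidAlgebra.single g 1)) y ∈ R)
          (hs' : ∀ (g : GroupLike k B) (y : R), PC.br (ι (MonoidAlgebra.single g 1))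
            (PC.br y (ι (MonoidAlgebra.single g⁻¹ 1))) ∈ R)
          -- the action of `(kG)^e` on `R^e`
          (σ : ModuleAlgebra k
            (PoissonBracket.trivial k (MonoidAlgebra k (GroupLike k B))).Env
            (PC.restrict R hR).Env),
          (∀ (g : GroupLike k B) (y : R),
            σ.act (PoissonBracket.Env.m _ (MonoidAlgebra.single g 1))
                (PoissonBracket.Env.m _ y) = PoissonBracket.Env.m _ y ∧
            σ.act (PoissonBracket.Env.m _ (MonoidAlgebra.single g 1))
                (PoissonBracket.Env.h _ y) =
              PoissonBracket.Env.h _ y + PoissonBracket.Env.m _ ⟨_, hs g y⟩ ∧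
            σ.act (PoissonBracket.Env.h _ (MonoidAlgebra.single g 1))
                (PoissonBracket.Env.m _ y) = PoissonBracket.Env.m _ ⟨_, hs g y⟩ ∧
            σ.act (PoissonBracket.Env.h _ (MonoidAlgebra.single g 1))
                (PoissonBracket.Env.h _ y) =
              PoissonBracket.Env.h _ ⟨_, hs g y⟩ + PoissonBracket.Env.m _ ⟨_, hs' g y⟩) ∧
          -- `R^e` maps to the coinvariants of `π^e`
          (∀ a, PoissonBracket.Env.map R.val (PC.isHom_val R hR) a ∈
            rightCoinvariants (PoissonBracket.Env.map
              (π : C →ₐ[k] MonoidAlgebra k (GroupLike k B)) hπ)) ∧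
          -- the isomorphism `Φ`
          ∃ Φ : σ.Smash ≃ₐ[k] PC.Env,
            (∀ a x, Φ (ModuleAlgebra.Smash.mk σ a x) =
              PoissonBracket.Env.map R.val (PC.isHom_val R hR) a *
                PoissonBracket.Env.map (ι : MonoidAlgebra k (GroupLike k B) →ₐ[k] C) hι x) ∧
            -- `Φ` is the unique algebra map with `Φ γ = m` and `Φ λ = h`
            ∀ F : σ.Smash →ₐ[k] PC.Env,
              F = (Φ : σ.Smash →ₐ[k] PC.Env) ↔
              ∀ (r : R) (g : GroupLike k B),
                F (ModuleAlgebra.Smash.mk σ (PoissonBracket.Env.m _ r)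
                    (PoissonBracket.Env.m _ (MonoidAlgebra.single g 1))) =
                  PoissonBracket.Env.m PC (r * ι (MonoidAlgebra.single g 1)) ∧
                F (ModuleAlgebra.Smash.mk σ (PoissonBracket.Env.m _ r)
                    (PoissonBracket.Env.h _ (MonoidAlgebra.single g 1)) +
                  ModuleAlgebra.Smash.mk σ 1
                      (PoissonBracket.Env.m _ (MonoidAlgebra.single g 1)) *
                    ModuleAlgebra.Smash.mk σ (PoissonBracket.Env.h _ r) 1) =
                  PoissonBracket.Env.h PC (r * ι (MonoidAlgebra.single g 1)) := by
  have := hP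
  have hπι := proj_incl (hB := hB)
  have hι := incl_isHom (hB := hB) hG
  have hπ := proj_isHom (hB := hB) hG
  have hR : ∀ x ∈ rightCoinvariants (proj hB : GrAlg hB →ₐ[k] MonoidAlgebra k (GroupLike k B)),
      ∀ y ∈ rightCoinvariants (proj hB : GrAlg hB →ₐ[k] MonoidAlgebra k (GroupLike k B)),
      (bracket hB hG).br x y ∈
        rightCoinvariants (proj hB : GrAlg hB →ₐ[k] MonoidAlgebra k (GroupLike k B)) :=
    fun x hx y hy => PoissonBracket.br_mem_rightCoinvariants hπ hx hy
  have hs : ∀ (g : GroupLike k B)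
      (y : rightCoinvariants (proj hB : GrAlg hB →ₐ[k] MonoidAlgebra k (GroupLike k B))),
      incl hB (MonoidAlgebra.single g⁻¹ 1) *
        (bracket hB hG).br (incl hB (MonoidAlgebra.single g 1)) y ∈
        rightCoinvariants (proj hB : GrAlg hB →ₐ[k] MonoidAlgebra k (GroupLike k B)) :=
    fun g y => PoissonBracket.log_mem_rightCoinvariants hπι hπ g y.2
  let D := PoissonBracket.logDerivation hι hR hs
  -- As {g, {y, g⁻¹}} is the square of d_g applied to y, this gives both its membership in R and the
  -- formula for the action of h_g on h_y.
  have hdd := PoissonBracket.coe_logDerivation_logDerivation hι hR hs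
  have hb := Radford.isBiproduct hπι
  refine ⟨GrAlg hB, inferInstance, inferInstance, bracket hB hG, inferInstance, equiv hB,
    isAssociatedGraded hG, isGradedPoissonHopf hG, incl hB, proj hB,
    fun g => ⟨groupLike_mem_coradFilt_zero hB g, ?_⟩, hπι,
    fun n hn x hx => proj_eq_zero hn hx, hb, hι, hπ, _, rfl, hR, hs,
    fun g y => hdd g y ▸ (D.d g (D.d g y)).2, D.moduleAlgebra, fun g y => ⟨?_, ?_, ?_, ?_⟩,
    PoissonBracket.envVal_mem_rightCoinvariants hπ rfl hR,
    PoissonBracket.smashEquiv hι hR hs hb.bijective, fun a x => rfl,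
    PoissonBracket.eq_smashEquiv_iff hι hR hs hb.bijective⟩
  · rw [incl_single, equiv_grCls]
  · change D.act _ _ = _
    rw [D.act_m, AlgHom.toLinearMap_apply, D.twist_m]
  · change D.act _ _ = _
    rw [D.act_m, AlgHom.toLinearMap_apply, D.twist_h]
    rfl
  · change D.act _ _ = _
    rw [D.act_h, Module.End.mul_apply, D.der_m, AlgHom.toLinearMap_apply, D.twist_m]
    rfl
  · change D.act _ _ = _
    rw [D.act_h, Module.End.mul_apply, D.der_h, AlgHom.toLinearMap_apply, D.twist_h]
    refine congrArg₂ (· + ·) rfl (congrArg (PoissonBracket.Env.m _) ?_)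
    exact Subtype.ext (hdd g y)
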